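/- Let $G=SL(2,\mathbb C)$, $\mathfrak g=\mathfrak{sl}(2,\mathbb C)$ with standard basis $\mathbf e,\mathbf h,\mathbf f$, let $N_+$ and $T$ be the upper triangular unipotent and the diagonal subgroups, $\mathbf w_0=\begin{pmatrix}0&-1\\1&0\end{pmatrix}$, and let $G_0=N_+\mathbf w_0TN_+$ be the big Bruhat cell. The algebra $\mathfrak R(G_0)$ of regular functions on $G_0$ is a $\mathfrak g\oplus\mathfrak g$-module under $$(\pi_l(x)\psi)(g)=\tfrac{d}{dt}\psi(e^{-tx}g)\big|_{t=0},\qquad (\pi_r(x)\psi)(g)=\tfrac{d}{dt}\psi(g\,e^{tx})\big|_{t=0}.$$ Let $\omega$ be the involution of $\mathfrak g$ with $\mathbf e\mapsto-\mathbf f$, $\mathbf h\mapsto-\mathbf h$, $\mathbf f\mapsto-\mathbf e$. Let $\mathcal U(\mathfrak g)'$ be the space of linear functionals on the universal enveloping algebra, with the $\mathfrak g\oplus\mathfrak g$-action $(\pi_l(x)\phi)(u)=\phi(ux)$, $(\pi_r(x)\phi)(u)=-\phi(\omega(x)u)$. For a $\mathfrak g$-module $V$ with weight space decomposition $V=\bigoplus_\mu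 V[\mu]$, let $V^\star$ be the restricted dual $\bigoplus_\mu V[\mu]'$ with $\langle xv',v\rangle=-\langle v',\omega(x)v\rangle$, and let $\mathbb M(V)\subset\mathcal U(\mathfrak g)'$ be the span of the matrix elements $\phi_{v,v'}(u)=\langle v',uv\rangle$, $v\in V$, $v'\in V^\star$. Let $\mathcal O$ be the Bernstein--Gelfand--Gelfand category of finitely generated, locally $\mathbf e$-nilpotent $\mathfrak g$-modules with weight space decomposition. For each $\lambda\in-\mathbf P^{++}=\{-1,-2,-3,\dots\}$ the irreducible module $V_\lambda$ of highest weight $\lambda$ has a projective cover in $\mathcal O$. Let $P_\lambda$ be such a projective cover (a big projective module), for each $\lambda\in-\mathbf P^{++}$. 1. The map $\vartheta:\mathfrak R(G_0)\to\mathcal U(\mathfrak g)'$, $\vartheta_\psi(u)=(\pi_l(u)\psi)(\mathbf w_0)$, is an injective homomorphism of $\mathfrak g\oplus\mathfrak g$-modules, the sum of the subspaces $\mathbb M(P_\lambda)$, $\lambda\in-\mathbf P^{++}$, is direct, and it is the image of $\vartheta$. Thus $$\mathfrak R(G_0)\cong\bigoplus_{\lambda\in-\mathbf P^{++}}\mathbb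 M(P_\lambda).$$ 2. As a $\mathfrak g\oplus\mathfrak g$-module, $$\mathfrak R(G_0)\cong\bigoplus_{\lambda\in-\mathbf P^{++}}(P_\lambda\otimes P_\lambda^\star)/I_\lambda,$$ where $I_\lambda$ is the kernel of the $\mathfrak g\oplus\mathfrak g$-homomorphism $P_\lambda\otimes P_\lambda^\star\to\mathcal U(\mathfrak g)'$, $v\otimes v'\mapsto\phi_{v,v'}$. The isomorphism can be chosen so that the function corresponding to the class of $v\otimes v'$ is mapped by $\vartheta$ to $\phi_{v,v'}$. -/

import Mathlib

namespace BigCell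

attribute [local instance 100] LieRing.ofAssociativeRing

open scoped Matrix MatrixGroups

/-- The Lie algebra `g = sl(2, ℂ)` of traceless matrices. -/
abbrev sl2 : LieSubalgebra ℂ (Matrix (Fin 2) (Fin 2) ℂ) :=
  LieAlgebra.SpecialLinear.sl (Fin 2) ℂ

theorem mem_sl2_iff (x : Matrix (Fin 2) (Fin 2) ℂ) : x ∈ sl2 ↔ x.trace = 0 := Iff.rfl

def sl2E : sl2 := ⟨!![0, 1; 0, 0], by simp [mem_sl2_iff, Matrix.trace_fin_two]⟩
def sl2H : sl2 := ⟨!![1, 0; 0, -1], by simp [mem_sl2_iff, Matrix.trace_fin_two]⟩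
def sl2F : sl2 := ⟨!![0, 0; 1, 0], by simp [mem_sl2_iff, Matrix.trace_fin_two]⟩

/-- The involution of `g` with `e ↦ -f`, `h ↦ -h`, `f ↦ -e`, that is `x ↦ -xᵀ`
(conjugation by the representative `w0` of the longest Weyl group element). -/
def omega : sl2 →ₗ⁅ℂ⁆ sl2 where
  toFun x := ⟨-(x : Matrix (Fin 2) (Fin 2) ℂ)ᵀ, by
    have := (mem_sl2_iff _).1 x.2
    simp [mem_sl2_iff, this]⟩
  map_add' x y := by ext1; simp [add_comm]
  map_smul' c x := by ext1; simp
  map_lie' := by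
    intro x y
    ext1
    simp [LieRing.of_associative_ring_bracket, Matrix.transpose_sub, Matrix.transpose_mul]

theorem omega_e : omega sl2E = -sl2F := by
  ext i j; fin_cases i <;> fin_cases j <;> simp [omega, sl2E, sl2F]
theorem omega_h : omega sl2H = -sl2H := by
  ext i j; fin_cases i <;> fin_cases j <;> simp [omega, sl2H]
theorem omega_f : omega sl2F = -sl2E := by
  ext i j; fin_cases i <;> fin_cases j <;> simp [omega, sl2E, sl2F]

theorem lie_h_e : ⁅sl2H, sl2E⁆ = (2 : ℂ) • sl2E := by
  ext i j; fin_cases i <;> fin_cases j <;> simp [sl2H, sl2E, LieRing.of_associative_ring_bracket]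
  norm_num
theorem lie_h_f : ⁅sl2H, sl2F⁆ = (-2 : ℂ) • sl2F := by
  ext i j; fin_cases i <;> fin_cases j <;> simp [sl2H, sl2F, LieRing.of_associative_ring_bracket]
  norm_num
theorem lie_e_f : ⁅sl2E, sl2F⁆ = sl2H := by
  ext i j; fin_cases i <;> fin_cases j <;> simp [sl2H, sl2E, sl2F, LieRing.of_associative_ring_bracket]

theorem det_exp_sl2 (x : sl2) :
    (NormedSpace.exp (x : Matrix (Fin 2) (Fin 2) ℂ)).det = 1 := by
  set A : Matrix (Fin 2) (Fin 2) ℂ := (x : Matrix (Fin 2) (Fin 2) ℂ)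
  set J : Matrix (Fin 2) (Fin 2) ℂ := !![0, -1; 1, 0] with hJ
  have hJd : J.det = 1 := by simp [hJ, Matrix.det_fin_two]
  have hJu : IsUnit J := by
    rw [Matrix.isUnit_iff_isUnit_det, hJd]; exact isUnit_one
  have hJi : J⁻¹ = !![0, 1; -1, 0] := by
    rw [Matrix.inv_def, hJd]; simp [hJ, Matrix.adjugate_fin_two]
  have key : ∀ M : Matrix (Fin 2) (Fin 2) ℂ, J * M * J⁻¹ = M.adjugateᵀ := by
    intro M
    rw [hJi, Matrix.eta_fin_two M, hJ, Matrix.mul_fin_two, Matrix.mul_fin_two]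
    ext i j
    fin_cases i <;> fin_cases j <;> simp [Matrix.adjugate_fin_two]
  have htr : A 0 0 + A 1 1 = 0 := by
    have := (mem_sl2_iff _).1 x.2
    simpa [Matrix.trace_fin_two] using this
  have hadj : A.adjugate = -A := by
    ext i j
    fin_cases i <;> fin_cases j <;> simp [Matrix.adjugate_fin_two]
    · linear_combination htr
    · linear_combination htr
  have h1 := Matrix.exp_conj J A hJu
  rw [key, key, hadj, Matrix.exp_transpose, Matrix.exp_neg] at h1
  have h2 : (NormedSpace.exp A)⁻¹ = (NormedSpace.exp A).adjugate := Matrix.transpose_injective h1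
  have hu := Matrix.isUnit_exp A
  have hd := (Matrix.isUnit_iff_isUnit_det _).1 hu
  have h3 := Matrix.mul_adjugate (NormedSpace.exp A)
  rw [← h2, Matrix.mul_nonsing_inv _ hd] at h3
  have h4 := congrFun (congrFun h3 0) 0
  simpa using h4.symm

/-- The exponential map `g → SL(2, ℂ)`. -/
noncomputable def expSL (x : sl2) : SL(2, ℂ) :=
  ⟨NormedSpace.exp (x : Matrix (Fin 2) (Fin 2) ℂ), det_exp_sl2 x⟩

theorem coe_expSL (x : sl2) : (expSL x : Matrix (Fin 2) (Fin 2) ℂ) =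
    NormedSpace.exp (x : Matrix (Fin 2) (Fin 2) ℂ) := rfl

theorem expSL_zero : expSL 0 = 1 := by
  ext1; simp [expSL]

/-- Upper triangular unipotent matrices. -/
def unip (x : ℂ) : SL(2, ℂ) := ⟨!![1, x; 0, 1], by simp [Matrix.det_fin_two]⟩
/-- The representative of the longest Weyl group element. -/
def w0 : SL(2, ℂ) := ⟨!![0, -1; 1, 0], by simp [Matrix.det_fin_two]⟩
/-- Diagonal matrices of determinant one. -/
noncomputable def torus (z : ℂˣ) : SL(2, ℂ) := ⟨!![(z : ℂ), 0; 0, (z : ℂ)⁻¹], by simp [Matrix.det_fin_two]⟩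

/-- The big Bruhat cell `G₀ = N₊ w₀ T N₊` of `SL(2, ℂ)`. -/
def bigCell : Set SL(2, ℂ) := {g | ∃ (x y : ℂ) (z : ℂˣ), g = unip x * w0 * torus z * unip y}

theorem coe_cell (x y : ℂ) (z : ℂˣ) :
    ((unip x * w0 * torus z * unip y : SL(2, ℂ)) : Matrix (Fin 2) (Fin 2) ℂ) =
      !![x * z, x * y * z - (z : ℂ)⁻¹; (z : ℂ), y * z] := by
  have h1 : ∀ u : ℂ, (unip u : Matrix (Fin 2) (Fin 2) ℂ) = !![1, u; 0, 1] := fun _ => rfl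
  have h2 : (w0 : Matrix (Fin 2) (Fin 2) ℂ) = !![0, -1; 1, 0] := rfl
  have h3 : (torus z : Matrix (Fin 2) (Fin 2) ℂ) = !![(z : ℂ), 0; 0, (z : ℂ)⁻¹] := rfl
  rw [Matrix.SpecialLinearGroup.coe_mul, Matrix.SpecialLinearGroup.coe_mul,
    Matrix.SpecialLinearGroup.coe_mul, h1, h1, h2, h3, Matrix.mul_fin_two, Matrix.mul_fin_two,
    Matrix.mul_fin_two]
  ext i j
  fin_cases i <;> fin_cases j <;> simp <;> ring

theorem mem_bigCell_iff (g : SL(2, ℂ)) : g ∈ bigCell ↔ g 1 0 ≠ 0 := by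
  constructor
  · rintro ⟨x, y, z, rfl⟩
    rw [coe_cell]
    simp
  · intro hg
    refine ⟨g 0 0 / g 1 0, g 1 1 / g 1 0, Units.mk0 _ hg, ?_⟩
    have hd : g 0 0 * g 1 1 - g 0 1 * g 1 0 = 1 := by
      have := g.det_coe; rwa [Matrix.det_fin_two] at this
    apply Subtype.ext
    rw [coe_cell]
    ext i j
    fin_cases i <;> fin_cases j <;> simp <;> field_simp
    linear_combination -hd

theorem w0_mem : w0 ∈ bigCell := by
  rw [mem_bigCell_iff]
  simp [w0]

/-- The value of a polynomial in the four matrix entries. -/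
noncomputable def evalAt (g : SL(2, ℂ)) : MvPolynomial (Fin 2 × Fin 2) ℂ →ₐ[ℂ] ℂ :=
  MvPolynomial.aeval fun ij => g ij.1 ij.2

/-- A function on `G₀` is regular if it is, Zariski locally, a quotient of polynomials in the
matrix entries. -/
def IsRegular (ψ : bigCell → ℂ) : Prop :=
  ∀ g : bigCell, ∃ p q : MvPolynomial (Fin 2 × Fin 2) ℂ, evalAt g q ≠ 0 ∧
    ∀ k : bigCell, evalAt k q ≠ 0 → ψ k = evalAt k p / evalAt k q

/-- The algebra `R(G₀)` of regular functions on `G₀`. -/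
def regularFunctions : Subalgebra ℂ (bigCell → ℂ) where
  carrier := {ψ | IsRegular ψ}
  mul_mem' := by
    intro φ ψ hφ hψ g
    obtain ⟨p, q, hq, hpq⟩ := hφ g
    obtain ⟨r, s, hs, hrs⟩ := hψ g
    refine ⟨p * r, q * s, by simp [hq, hs], fun k hk => ?_⟩
    rw [map_mul, mul_ne_zero_iff] at hk
    simp only [Pi.mul_apply, map_mul, hpq k hk.1, hrs k hk.2]
    exact div_mul_div_comm _ _ _ _
  add_mem' := by
    intro φ ψ hφ hψ g
    obtain ⟨p, q, hq, hpq⟩ := hφ g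
    obtain ⟨r, s, hs, hrs⟩ := hψ g
    refine ⟨p * s + q * r, q * s, by simp [hq, hs], fun k hk => ?_⟩
    rw [map_mul, mul_ne_zero_iff] at hk
    simp only [Pi.add_apply, map_mul, map_add, hpq k hk.1, hrs k hk.2]
    exact div_add_div _ _ hk.1 hk.2
  algebraMap_mem' := by
    intro c g
    exact ⟨MvPolynomial.C c, 1, by simp, fun k _ => by simp [evalAt]⟩

open Classical in
/-- Extension by zero from `bigCell` to the group. -/
noncomputable def extendByZero (ψ : bigCell → ℂ) (g : SL(2, ℂ)) : ℂ :=
  if hg : g ∈ bigCell then ψ ⟨g, hg⟩ else 0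

/-- `(π_l(x) ψ)(g) = d/dt ψ(exp(-t x) g)` at `t = 0`. The point `exp(-t x) g` lies in `G₀` for
all small `t`; for regular `ψ` the derivative exists, see `hasDerivAt_left`. -/
noncomputable def leftDeriv (x : sl2) (ψ : bigCell → ℂ) (g : bigCell) : ℂ :=
  deriv (fun t : ℂ => extendByZero ψ (expSL (-(t • x)) * g)) 0

/-- `(π_r(x) ψ)(g) = d/dt ψ(g exp(t x))` at `t = 0`; see `hasDerivAt_right`. -/
noncomputable def rightDeriv (x : sl2) (ψ : bigCell → ℂ) (g : bigCell) : ℂ :=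
  deriv (fun t : ℂ => extendByZero ψ (g * expSL (t • x))) 0

/-- The polynomial vector field of the infinitesimal action of a pair of matrices. -/
noncomputable def vf (a b : Matrix (Fin 2) (Fin 2) ℂ) :
    Derivation ℂ (MvPolynomial (Fin 2 × Fin 2) ℂ) (MvPolynomial (Fin 2 × Fin 2) ℂ) :=
  MvPolynomial.mkDerivation ℂ fun ij =>
    ∑ k, (-(a ij.1 k)) • MvPolynomial.X (k, ij.2) + ∑ k, b k ij.2 • MvPolynomial.X (ij.1, k)

theorem evalAt_vf_X (a b : Matrix (Fin 2) (Fin 2) ℂ) (g : SL(2, ℂ)) (ij : Fin 2 × Fin 2) :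
    evalAt g (vf a b (MvPolynomial.X ij)) =
      (-(a * (g : Matrix (Fin 2) (Fin 2) ℂ)) + (g : Matrix (Fin 2) (Fin 2) ℂ) * b) ij.1 ij.2 := by
  simp [vf, evalAt, Matrix.mul_apply, MvPolynomial.mkDerivation_X]
  ring

theorem vf_add (a b a' b' : Matrix (Fin 2) (Fin 2) ℂ) :
    vf (a + a') (b + b') = vf a b + vf a' b' := by
  apply MvPolynomial.derivation_ext
  intro i
  simp [vf, MvPolynomial.mkDerivation_X, add_smul]
  ring

theorem vf_smul (c : ℂ) (a b : Matrix (Fin 2) (Fin 2) ℂ) :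
    vf (c • a) (c • b) = c • vf a b := by
  apply MvPolynomial.derivation_ext
  intro i
  simp [vf, MvPolynomial.mkDerivation_X, mul_smul]

theorem vf_lie (a b a' b' : Matrix (Fin 2) (Fin 2) ℂ) (p : MvPolynomial (Fin 2 × Fin 2) ℂ) :
    vf (a * a' - a' * a) (b * b' - b' * b) p =
      vf a b (vf a' b' p) - vf a' b' (vf a b p) := by
  have : vf (a * a' - a' * a) (b * b' - b' * b) = ⁅vf a b, vf a' b'⁆ := by
    apply MvPolynomial.derivation_ext
    rintro ⟨i, j⟩
    rw [Derivation.commutator_apply]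
    simp only [vf, MvPolynomial.mkDerivation_X, map_add, Derivation.map_smul,
      Fin.sum_univ_two, Matrix.sub_apply, Matrix.mul_apply]
    simp only [MvPolynomial.smul_eq_C_mul, map_sub, map_add, map_mul, map_neg]
    ring
  rw [this, Derivation.commutator_apply]

theorem hasDerivAt_evalAt (γ : ℂ → SL(2, ℂ)) (a b : Matrix (Fin 2) (Fin 2) ℂ)
    (hγ : ∀ i j, HasDerivAt (fun t => γ t i j)
      ((-(a * (γ 0 : Matrix (Fin 2) (Fin 2) ℂ)) + (γ 0 : Matrix (Fin 2) (Fin 2) ℂ) * b) i j) 0)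
    (p : MvPolynomial (Fin 2 × Fin 2) ℂ) :
    HasDerivAt (fun t => evalAt (γ t) p) (evalAt (γ 0) (vf a b p)) 0 := by
  induction p using MvPolynomial.induction_on with
  | C c =>
    have : vf a b (MvPolynomial.C c) = 0 := MvPolynomial.derivation_C _ _
    rw [this]
    simpa [evalAt] using hasDerivAt_const (0 : ℂ) c
  | add p q hp hq => simpa using hp.fun_add hq
  | mul_X p ij hp =>
    have h1 := hp.fun_mul (hγ ij.1 ij.2)
    rw [← evalAt_vf_X] at h1
    have h2 : ∀ g : SL(2, ℂ), evalAt g (MvPolynomial.X ij) = g ij.1 ij.2 := by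
      intro g; simp [evalAt]
    simp only [map_mul, Derivation.leibniz, map_add, smul_eq_mul, h2]
    refine h1.congr_deriv ?_
    rw [← h2 (γ 0)]
    ring

theorem hasDerivAt_extendByZero {ψ : bigCell → ℂ} {p q : MvPolynomial (Fin 2 × Fin 2) ℂ}
    (hpq : ∀ k : bigCell, evalAt k q ≠ 0 → ψ k = evalAt k p / evalAt k q)
    (g : bigCell) (hg : evalAt g q ≠ 0) (γ : ℂ → SL(2, ℂ)) (hγ0 : γ 0 = g)
    (a b : Matrix (Fin 2) (Fin 2) ℂ)
    (hγ : ∀ i j, HasDerivAt (fun t => γ t i j)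
      ((-(a * (γ 0 : Matrix (Fin 2) (Fin 2) ℂ)) + (γ 0 : Matrix (Fin 2) (Fin 2) ℂ) * b) i j) 0) :
    HasDerivAt (fun t => extendByZero ψ (γ t))
      (evalAt g (vf a b p * q - p * vf a b q) / evalAt g (q ^ 2)) 0 := by
  have hp := hasDerivAt_evalAt γ a b hγ p
  have hq := hasDerivAt_evalAt γ a b hγ q
  have hd := hp.div hq (by rw [hγ0]; exact hg)
  rw [hγ0] at hd
  simp only [map_sub, map_mul, map_pow]
  refine hd.congr_of_eventuallyEq ?_
  have h1 : ∀ᶠ t in nhds (0 : ℂ), γ t 1 0 ≠ 0 :=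
    (hγ 1 0).continuousAt.eventually_ne (by rw [hγ0]; exact (mem_bigCell_iff _).1 g.2)
  have h2 : ∀ᶠ t in nhds (0 : ℂ), evalAt (γ t) q ≠ 0 :=
    hq.continuousAt.eventually_ne (by rw [hγ0]; exact hg)
  filter_upwards [h1, h2] with t ht1 ht2
  have hm : γ t ∈ bigCell := (mem_bigCell_iff _).2 ht1
  simp only [extendByZero, hm, dif_pos]
  exact hpq ⟨γ t, hm⟩ ht2

open scoped Matrix.Norms.Operator in
theorem hasDerivAt_exp_entry (x g : Matrix (Fin 2) (Fin 2) ℂ) (i j : Fin 2) :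
    HasDerivAt (fun t : ℂ => (NormedSpace.exp (t • x) * g) i j) ((x * g) i j) 0 ∧
    HasDerivAt (fun t : ℂ => (g * NormedSpace.exp (t • x)) i j) ((g * x) i j) 0 := by
  have h0 := hasDerivAt_exp_smul_const (𝕂 := ℂ) x 0
  rw [zero_smul, NormedSpace.exp_zero, one_mul] at h0
  let l1 : Matrix (Fin 2) (Fin 2) ℂ →ₗ[ℂ] ℂ :=
    { toFun := fun M => (M * g) i j
      map_add' := fun M N => by simp [add_mul]
      map_smul' := fun c M => by simp }
  let l2 : Matrix (Fin 2) (Fin 2) ℂ →ₗ[ℂ] ℂ :=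
    { toFun := fun M => (g * M) i j
      map_add' := fun M N => by simp [mul_add]
      map_smul' := fun c M => by simp }
  exact ⟨(LinearMap.toContinuousLinearMap l1).hasFDerivAt.comp_hasDerivAt (0 : ℂ) h0,
    (LinearMap.toContinuousLinearMap l2).hasFDerivAt.comp_hasDerivAt (0 : ℂ) h0⟩

theorem hasDerivAt_left (x : sl2) {ψ : bigCell → ℂ} {p q : MvPolynomial (Fin 2 × Fin 2) ℂ}
    (hpq : ∀ k : bigCell, evalAt k q ≠ 0 → ψ k = evalAt k p / evalAt k q)
    (g : bigCell) (hg : evalAt g q ≠ 0) :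
    HasDerivAt (fun t : ℂ => extendByZero ψ (expSL (-(t • x)) * g))
      (evalAt g (vf x 0 p * q - p * vf x 0 q) / evalAt g (q ^ 2)) 0 := by
  refine hasDerivAt_extendByZero hpq g hg _ (by simp [expSL_zero]) _ _ fun i j => ?_
  have := (hasDerivAt_exp_entry (-x) (g : SL(2, ℂ)) i j).1
  simpa [coe_expSL] using this

theorem hasDerivAt_right (x : sl2) {ψ : bigCell → ℂ} {p q : MvPolynomial (Fin 2 × Fin 2) ℂ}
    (hpq : ∀ k : bigCell, evalAt k q ≠ 0 → ψ k = evalAt k p / evalAt k q)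
    (g : bigCell) (hg : evalAt g q ≠ 0) :
    HasDerivAt (fun t : ℂ => extendByZero ψ (g * expSL (t • x)))
      (evalAt g (vf 0 x p * q - p * vf 0 x q) / evalAt g (q ^ 2)) 0 := by
  refine hasDerivAt_extendByZero hpq g hg _ (by simp [expSL_zero]) _ _ fun i j => ?_
  have := (hasDerivAt_exp_entry x (g : SL(2, ℂ)) i j).2
  simpa [coe_expSL] using this

/-- The pair `(x, y)` acts by `π_l(x) + π_r(y)`. -/
noncomputable def regAct (a : sl2 × sl2) (ψ : bigCell → ℂ) : bigCell → ℂ :=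
  fun g => leftDeriv a.1 ψ g + rightDeriv a.2 ψ g

theorem regAct_eq (a : sl2 × sl2) {ψ : bigCell → ℂ} {p q : MvPolynomial (Fin 2 × Fin 2) ℂ}
    (hpq : ∀ k : bigCell, evalAt k q ≠ 0 → ψ k = evalAt k p / evalAt k q)
    (g : bigCell) (hg : evalAt g q ≠ 0) :
    regAct a ψ g =
      evalAt g (vf a.1 a.2 p * q - p * vf a.1 a.2 q) / evalAt g (q ^ 2) := by
  have hv : ∀ r, vf a.1 a.2 r = vf a.1 0 r + vf 0 a.2 r := by
    intro r
    have := vf_add (a.1 : Matrix (Fin 2) (Fin 2) ℂ) 0 0 (a.2 : Matrix (Fin 2) (Fin 2) ℂ)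
    rw [add_zero, zero_add] at this
    rw [this]; rfl
  rw [regAct, leftDeriv, rightDeriv, (hasDerivAt_left a.1 hpq g hg).deriv,
    (hasDerivAt_right a.2 hpq g hg).deriv, ← add_div, ← map_add, hv, hv]
  congr 2
  ring

theorem regAct_mem (a : sl2 × sl2) {ψ : bigCell → ℂ} (hψ : IsRegular ψ) :
    IsRegular (regAct a ψ) := by
  intro g
  obtain ⟨p, q, hq, hpq⟩ := hψ g
  refine ⟨_, q ^ 2, by rw [map_pow]; exact pow_ne_zero 2 hq, fun k hk => regAct_eq a hpq k ?_⟩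
  intro h0
  rw [map_pow, h0] at hk
  simp at hk

/-- The infinitesimal regular action of `g ⊕ g` on `R(G₀)`. -/
noncomputable instance : LieRingModule (sl2 × sl2) regularFunctions where
  bracket a ψ := ⟨regAct a ψ, regAct_mem a ψ.2⟩
  add_lie a b ψ := by
    apply Subtype.ext
    funext g
    obtain ⟨p, q, hq, hpq⟩ := ψ.2 g
    have h1 : ∀ r, vf ((a + b).1 : sl2) ((a + b).2 : sl2) r = vf a.1 a.2 r + vf b.1 b.2 r := by
      intro r
      rw [← Derivation.add_apply, ← vf_add]; rfl
    change regAct (a + b) ψ g = regAct a ψ g + regAct b ψ g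
    rw [regAct_eq _ hpq g hq, regAct_eq _ hpq g hq, regAct_eq _ hpq g hq, ← add_div, ← map_add,
      h1, h1]
    congr 2
    ring
  lie_add a φ ψ := by
    apply Subtype.ext
    funext g
    obtain ⟨p, q, hq, hpq⟩ := φ.2 g
    obtain ⟨r, s, hs, hrs⟩ := ψ.2 g
    have hsum : ∀ k : bigCell, evalAt k (q * s) ≠ 0 →
        ((φ + ψ : regularFunctions) : bigCell → ℂ) k =
          evalAt k (p * s + q * r) / evalAt k (q * s) := by
      intro k hk
      rw [map_mul, mul_ne_zero_iff] at hk
      have : ((φ + ψ : regularFunctions) : bigCell → ℂ) k = φ.1 k + ψ.1 k := rfl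
      rw [this, hpq k hk.1, hrs k hk.2, div_add_div _ _ hk.1 hk.2]
      simp
    change regAct a (φ + ψ : regularFunctions) g = regAct a φ g + regAct a ψ g
    rw [regAct_eq _ hpq g hq, regAct_eq _ hrs g hs,
      regAct_eq _ hsum g (by simp [hq, hs])]
    simp only [Derivation.leibniz, map_add, map_mul, map_sub, map_pow, smul_eq_mul]
    field_simp
    ring
  leibniz_lie a b ψ := by
    apply Subtype.ext
    funext g
    obtain ⟨p, q, hq, hpq⟩ := ψ.2 g
    have hq2 : evalAt g (q ^ 2) ≠ 0 := by rw [map_pow]; exact pow_ne_zero 2 hq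
    have hder : ∀ c : sl2 × sl2, ∀ k : bigCell, evalAt k (q ^ 2) ≠ 0 →
        regAct c ψ k =
          evalAt k (vf c.1 c.2 p * q - p * vf c.1 c.2 q) / evalAt k (q ^ 2) := by
      intro c k hk
      refine regAct_eq c hpq k ?_
      intro h0
      rw [map_pow, h0] at hk
      simp at hk
    have hbr : ∀ r, vf (⁅a, b⁆.1 : sl2) (⁅a, b⁆.2 : sl2) r =
        vf a.1 a.2 (vf b.1 b.2 r) - vf b.1 b.2 (vf a.1 a.2 r) := fun r => vf_lie _ _ _ _ r
    change regAct a (regAct b ψ) g = regAct ⁅a, b⁆ ψ g + regAct b (regAct a ψ) g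
    rw [regAct_eq _ (hder b) g hq2, regAct_eq _ (hder a) g hq2, regAct_eq _ hpq g hq, hbr, hbr]
    simp only [Derivation.leibniz, Derivation.leibniz_pow, map_add, map_mul, map_sub, map_pow,
      smul_eq_mul, nsmul_eq_mul, Nat.cast_ofNat, map_ofNat, pow_one, Nat.add_one_sub_one]
    field_simp
    ring

instance : LieModule ℂ (sl2 × sl2) regularFunctions where
  smul_lie c a ψ := by
    apply Subtype.ext
    funext g
    obtain ⟨p, q, hq, hpq⟩ := ψ.2 g
    have h1 : ∀ r, vf ((c • a).1 : sl2) ((c • a).2 : sl2) r = c • vf a.1 a.2 r := by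
      intro r
      rw [← Derivation.smul_apply, ← vf_smul]; rfl
    change regAct (c • a) ψ g = c * regAct a ψ g
    rw [regAct_eq _ hpq g hq, regAct_eq _ hpq g hq, h1, h1, ← mul_div_assoc]
    congr 1
    simp [mul_sub]
  lie_smul c a ψ := by
    apply Subtype.ext
    funext g
    obtain ⟨p, q, hq, hpq⟩ := ψ.2 g
    have hc : ∀ k : bigCell, evalAt k q ≠ 0 →
        ((c • ψ : regularFunctions) : bigCell → ℂ) k = evalAt k (c • p) / evalAt k q := by
      intro k hk
      have : ((c • ψ : regularFunctions) : bigCell → ℂ) k = c * ψ.1 k := rfl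
      rw [this, hpq k hk, map_smul, smul_eq_mul, mul_div_assoc]
    change regAct a (c • ψ : regularFunctions) g = c * regAct a ψ g
    rw [regAct_eq _ hpq g hq, regAct_eq _ hc g hq, ← mul_div_assoc]
    congr 1
    simp [mul_sub]


open scoped TensorProduct

/-- The universal enveloping algebra of `g`. -/
abbrev Env : Type := UniversalEnvelopingAlgebra ℂ sl2

/-- The action of the enveloping algebra on a `g`-module. -/
noncomputable def enveloping (V : Type) [AddCommGroup V] [Module ℂ V] [LieRingModule sl2 V]
    [LieModule ℂ sl2 V] : Env →ₐ[ℂ] Module.End ℂ V :=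
  UniversalEnvelopingAlgebra.lift ℂ (LieModule.toEnd ℂ sl2 V)

/-- The canonical map from `g` to its enveloping algebra. -/
noncomputable def envι : sl2 →ₗ⁅ℂ⁆ Env := UniversalEnvelopingAlgebra.ι ℂ

theorem envι_lie (x y : sl2) : envι ⁅x, y⁆ = envι x * envι y - envι y * envι x := by
  rw [LieHom.map_lie, LieRing.of_associative_ring_bracket]

/-- The action of `g ⊕ g` on functionals on the enveloping algebra:
`(π_l(x) φ)(u) = φ(u x)` and `(π_r(y) φ)(u) = -φ(ω(y) u)`. -/
noncomputable def dualAct (a : sl2 × sl2) (φ : Module.Dual ℂ Env) : Module.Dual ℂ Env :=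
  φ ∘ₗ LinearMap.mulRight ℂ (envι a.1) - φ ∘ₗ LinearMap.mulLeft ℂ (envι (omega a.2))

theorem dualAct_apply (a : sl2 × sl2) (φ : Module.Dual ℂ Env) (u : Env) :
    dualAct a φ u = φ (u * envι a.1) - φ (envι (omega a.2) * u) := rfl

noncomputable instance : LieRingModule (sl2 × sl2) (Module.Dual ℂ Env) where
  bracket := dualAct
  add_lie a b φ := by
    ext u
    change dualAct (a + b) φ u = dualAct a φ u + dualAct b φ u
    simp only [dualAct_apply, Prod.fst_add, Prod.snd_add, map_add, mul_add, add_mul]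
    ring
  lie_add a φ χ := by
    ext u
    change dualAct a (φ + χ) u = dualAct a φ u + dualAct a χ u
    simp only [dualAct_apply, LinearMap.add_apply]
    ring
  leibniz_lie a b φ := by
    ext u
    change dualAct a (dualAct b φ) u = dualAct ⁅a, b⁆ φ u + dualAct b (dualAct a φ) u
    have h1 : ⁅a, b⁆.1 = ⁅a.1, b.1⁆ := rfl
    have h2 : ⁅a, b⁆.2 = ⁅a.2, b.2⁆ := rfl
    simp only [dualAct_apply, h1, h2, LieHom.map_lie omega, envι_lie, mul_sub, sub_mul, map_sub,
      mul_assoc]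
    ring

instance : LieModule ℂ (sl2 × sl2) (Module.Dual ℂ Env) where
  smul_lie c a φ := by
    ext u
    change dualAct (c • a) φ u = c * dualAct a φ u
    simp only [dualAct_apply, Prod.smul_fst, Prod.smul_snd, map_smul, mul_smul_comm,
      smul_mul_assoc, smul_eq_mul]
    ring
  lie_smul c a φ := by
    ext u
    change dualAct a (c • φ) u = c * dualAct a φ u
    simp only [dualAct_apply, LinearMap.smul_apply, smul_eq_mul]
    ring

section Modules

variable (V : Type) [AddCommGroup V] [Module ℂ V] [LieRingModule sl2 V] [LieModule ℂ sl2 V]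

/-- The weight space `V[μ]`: eigenvectors of `h`. -/
def hWeightSpace (μ : ℂ) : Submodule ℂ V where
  carrier := {v | ⁅sl2H, v⁆ = μ • v}
  add_mem' := by
    intro v w hv hw
    simp only [Set.mem_ofPred_eq] at *
    rw [lie_add, hv, hw, smul_add]
  zero_mem' := by simp
  smul_mem' := by
    intro c v hv
    simp only [Set.mem_ofPred_eq] at *
    rw [lie_smul, hv, smul_comm]

/-- The Bernstein-Gelfand-Gelfand category `O`: finitely generated modules with a weight space
decomposition that are locally `n₊`-nilpotent. (Such modules have countable dimension, so `Type`
contains all of them up to isomorphism.) -/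
structure InCategoryO : Prop where
  finitelyGenerated : ∃ s : Finset V, LieSubmodule.lieSpan ℂ sl2 (s : Set V) = ⊤
  weightDecomposition : DirectSum.IsInternal (hWeightSpace V)
  locallyNilpotent : ∀ v : V, ∃ n : ℕ, ((LieModule.toEnd ℂ sl2 V sl2E) ^ n) v = 0

/-- `V` is (isomorphic to) the irreducible module `V_lam` of highest weight `lam`. -/
def IsSimpleOfHighestWeight (lam : ℂ) : Prop :=
  LieModule.IsIrreducible ℂ sl2 V ∧ ∃ v : V, v ≠ 0 ∧ ⁅sl2E, v⁆ = 0 ∧ ⁅sl2H, v⁆ = lam • v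

/-- `V` is a projective object of category `O`. -/
def IsProjectiveInO : Prop :=
  InCategoryO V ∧
  ∀ (M N : Type) [AddCommGroup M] [Module ℂ M] [LieRingModule sl2 M] [LieModule ℂ sl2 M]
    [AddCommGroup N] [Module ℂ N] [LieRingModule sl2 N] [LieModule ℂ sl2 N],
    InCategoryO M → InCategoryO N →
    ∀ (p : M →ₗ⁅ℂ,sl2⁆ N) (k : V →ₗ⁅ℂ,sl2⁆ N), Function.Surjective p →
      ∃ k' : V →ₗ⁅ℂ,sl2⁆ M, p.comp k' = k

/-- `V` is (isomorphic to) the projective cover `P_lam` in category `O` of the irreducible module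
`V_lam`: it is projective and maps onto `V_lam` with superfluous kernel. -/
def IsProjectiveCover (lam : ℂ) : Prop :=
  IsProjectiveInO V ∧
  ∃ (S : Type) (_ : AddCommGroup S) (_ : Module ℂ S) (_ : LieRingModule sl2 S)
    (_ : LieModule ℂ sl2 S) (p : V →ₗ⁅ℂ,sl2⁆ S),
    IsSimpleOfHighestWeight S lam ∧ Function.Surjective p ∧
      ∀ N : LieSubmodule ℂ sl2 V, N ⊔ p.ker = ⊤ → N = ⊤

theorem hWeightSpace_e {μ : ℂ} {v : V} (hv : v ∈ hWeightSpace V μ) :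
    ⁅sl2E, v⁆ ∈ hWeightSpace V (μ + 2) := by
  change ⁅sl2H, v⁆ = μ • v at hv
  change ⁅sl2H, ⁅sl2E, v⁆⁆ = (μ + 2) • ⁅sl2E, v⁆
  rw [leibniz_lie, lie_h_e, hv, smul_lie, lie_smul, add_smul, add_comm]

theorem hWeightSpace_f {μ : ℂ} {v : V} (hv : v ∈ hWeightSpace V μ) :
    ⁅sl2F, v⁆ ∈ hWeightSpace V (μ - 2) := by
  change ⁅sl2H, v⁆ = μ • v at hv
  change ⁅sl2H, ⁅sl2F, v⁆⁆ = (μ - 2) • ⁅sl2F, v⁆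
  rw [leibniz_lie, lie_h_f, hv, smul_lie, lie_smul, sub_smul, neg_smul]
  abel

theorem eq_combination (x : sl2) : x = x.1 0 1 • sl2E + x.1 0 0 • sl2H + x.1 1 0 • sl2F := by
  have htr : x.1 0 0 + x.1 1 1 = 0 := by
    have := (mem_sl2_iff _).1 x.2
    simpa [Matrix.trace_fin_two] using this
  ext i j
  fin_cases i <;> fin_cases j <;> simp [sl2E, sl2H, sl2F]
  linear_combination htr

/-- The weights `μ` such that `k` does not vanish on `V[μ]`. -/
def hSupport (k : Module.Dual ℂ V) : Set ℂ := {μ | ∃ v ∈ hWeightSpace V μ, k v ≠ 0}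

/-- The restricted dual: functionals that vanish on all but finitely many weight spaces. For a
module with weight space decomposition this is `⨁_μ V[μ]'`. -/
def restrictedDualSubmodule : Submodule ℂ (Module.Dual ℂ V) where
  carrier := {k | (hSupport V k).Finite}
  add_mem' := by
    intro k l hk hl
    refine (hk.union hl).subset ?_
    rintro μ ⟨v, hv, hne⟩
    by_cases h1 : k v = 0
    · refine Or.inr ⟨v, hv, fun h2 => hne ?_⟩
      rw [LinearMap.add_apply, h1, h2, add_zero]
    · exact Or.inl ⟨v, hv, h1⟩
  zero_mem' := by
    refine Set.finite_empty.subset ?_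
    rintro μ ⟨v, -, hne⟩
    exact (hne rfl).elim
  smul_mem' := by
    intro c k hk
    refine hk.subset ?_
    rintro μ ⟨v, hv, hne⟩
    refine ⟨v, hv, fun h1 => hne ?_⟩
    rw [LinearMap.smul_apply, h1, smul_zero]

/-- The `g`-action `⟨x k, v⟩ = -⟨k, ω(x) v⟩` on functionals. -/
def starAct (x : sl2) (k : Module.Dual ℂ V) : Module.Dual ℂ V :=
  -(k ∘ₗ (LieModule.toEnd ℂ sl2 V (omega x)))

theorem starAct_apply (x : sl2) (k : Module.Dual ℂ V) (v : V) :
    starAct V x k v = -k ⁅omega x, v⁆ := rfl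

theorem starAct_mem (x : sl2) {k : Module.Dual ℂ V} (hk : k ∈ restrictedDualSubmodule V) :
    starAct V x k ∈ restrictedDualSubmodule V := by
  have hk' : (hSupport V k).Finite := hk
  refine ((hk'.union (hk'.image (fun μ => μ - 2))).union (hk'.image (fun μ => μ + 2))).subset ?_
  rintro μ ⟨v, hv, hne⟩
  by_contra hcon
  simp only [Set.mem_union, Set.mem_image, not_or, not_exists, not_and] at hcon
  obtain ⟨⟨h0, h1⟩, h2⟩ := hcon
  apply hne
  have z1 : k ⁅sl2E, v⁆ = 0 := by
    by_contra h3
    exact h1 _ ⟨_, hWeightSpace_e V hv, h3⟩ (by ring)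
  have z2 : k ⁅sl2F, v⁆ = 0 := by
    by_contra h3
    exact h2 _ ⟨_, hWeightSpace_f V hv, h3⟩ (by ring)
  have z3 : k ⁅sl2H, v⁆ = 0 := by
    by_contra h3
    refine h0 ⟨v, hv, fun h4 => h3 ?_⟩
    have : ⁅sl2H, v⁆ = μ • v := hv
    rw [this, map_smul, h4, smul_zero]
  rw [starAct_apply, eq_combination (omega x)]
  simp only [add_lie, smul_lie, map_add, map_smul, z1, z2, z3]
  simp

/-- The dual module `V^⋆`: the restricted dual with the action `⟨x k, v⟩ = -⟨k, ω(x) v⟩`. -/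
def RestrictedDual : Type := restrictedDualSubmodule V

instance : AddCommGroup (RestrictedDual V) :=
  inferInstanceAs (AddCommGroup (restrictedDualSubmodule V))

instance : Module ℂ (RestrictedDual V) :=
  inferInstanceAs (Module ℂ (restrictedDualSubmodule V))

/-- The underlying functional of an element of the restricted dual. -/
def RestrictedDual.toDual : RestrictedDual V →ₗ[ℂ] Module.Dual ℂ V :=
  (restrictedDualSubmodule V).subtype

theorem RestrictedDual.ext {k l : RestrictedDual V}
    (hkl : ∀ v, RestrictedDual.toDual V k v = RestrictedDual.toDual V l v) : k = l :=
  Subtype.ext (LinearMap.ext hkl)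

instance : Bracket sl2 (RestrictedDual V) where
  bracket x k := ⟨starAct V x k.1, starAct_mem V x k.2⟩

theorem RestrictedDual.lie_apply (x : sl2) (k : RestrictedDual V) (v : V) :
    RestrictedDual.toDual V ⁅x, k⁆ v = -RestrictedDual.toDual V k ⁅omega x, v⁆ := rfl

instance : LieRingModule sl2 (RestrictedDual V) where
  add_lie x y k := by
    apply RestrictedDual.ext
    intro v
    simp only [RestrictedDual.lie_apply, map_add, LinearMap.add_apply, add_lie]
    ring
  lie_add x k l := by
    apply RestrictedDual.ext
    intro v
    simp only [RestrictedDual.lie_apply, map_add, LinearMap.add_apply]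
    ring
  leibniz_lie x y k := by
    apply RestrictedDual.ext
    intro v
    simp only [RestrictedDual.lie_apply, map_add, LinearMap.add_apply, LieHom.map_lie, lie_lie,
      map_sub]
    ring

instance : LieModule ℂ sl2 (RestrictedDual V) where
  smul_lie c x k := by
    apply RestrictedDual.ext
    intro v
    simp only [RestrictedDual.lie_apply, map_smul, LinearMap.smul_apply, smul_lie, smul_eq_mul]
    ring
  lie_smul c x k := by
    apply RestrictedDual.ext
    intro v
    simp only [RestrictedDual.lie_apply, map_smul, LinearMap.smul_apply, smul_eq_mul]
    ring

/-- The matrix element `φ_{v,k}(u) = ⟨k, u v⟩` on the enveloping algebra. -/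
noncomputable def matrixElement (v : V) (k : RestrictedDual V) : Module.Dual ℂ Env :=
  (RestrictedDual.toDual V k) ∘ₗ (LinearMap.applyₗ v) ∘ₗ (enveloping V).toLinearMap

theorem matrixElement_apply (v : V) (k : RestrictedDual V) (u : Env) :
    matrixElement V v k u = RestrictedDual.toDual V k (enveloping V u v) := rfl

/-- The space `M(V)` spanned by all matrix elements of `V`. -/
noncomputable def matrixElements : Submodule ℂ (Module.Dual ℂ Env) :=
  Submodule.span ℂ {φ | ∃ (v : V) (k : RestrictedDual V), φ = matrixElement V v k}

theorem enveloping_envι (x : sl2) (v : V) : enveloping V (envι x) v = ⁅x, v⁆ := by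
  unfold enveloping envι
  rw [UniversalEnvelopingAlgebra.lift_ι_apply]
  rfl

end Modules

section Outer

variable (V W : Type) [AddCommGroup V] [Module ℂ V] [LieRingModule sl2 V] [LieModule ℂ sl2 V]
  [AddCommGroup W] [Module ℂ W] [LieRingModule sl2 W] [LieModule ℂ sl2 W]

/-- The outer tensor product of two `g`-modules, a `g ⊕ g`-module. -/
def OuterTensor : Type := V ⊗[ℂ] W

noncomputable instance : AddCommGroup (OuterTensor V W) :=
  inferInstanceAs (AddCommGroup (V ⊗[ℂ] W))

noncomputable instance : Module ℂ (OuterTensor V W) :=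
  inferInstanceAs (Module ℂ (V ⊗[ℂ] W))

variable {V W} in
def OuterTensor.tmul (v : V) (w : W) : OuterTensor V W := v ⊗ₜ[ℂ] w

noncomputable def outerAct (a : sl2 × sl2) : V ⊗[ℂ] W →ₗ[ℂ] V ⊗[ℂ] W :=
  (LieModule.toEnd ℂ sl2 V a.1).rTensor W + (LieModule.toEnd ℂ sl2 W a.2).lTensor V

theorem outerAct_tmul (a : sl2 × sl2) (v : V) (w : W) :
    outerAct V W a (v ⊗ₜ w) = ⁅a.1, v⁆ ⊗ₜ w + v ⊗ₜ ⁅a.2, w⁆ := rfl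

theorem outerAct_add (a b : sl2 × sl2) : outerAct V W (a + b) = outerAct V W a + outerAct V W b := by
  apply TensorProduct.ext'
  intro v w
  simp only [LinearMap.add_apply, outerAct_tmul, Prod.fst_add, Prod.snd_add, add_lie,
    TensorProduct.add_tmul, TensorProduct.tmul_add]
  abel

theorem outerAct_smul (c : ℂ) (a : sl2 × sl2) : outerAct V W (c • a) = c • outerAct V W a := by
  apply TensorProduct.ext'
  intro v w
  simp only [LinearMap.smul_apply, outerAct_tmul, Prod.smul_fst, Prod.smul_snd, smul_lie,
    TensorProduct.smul_tmul', TensorProduct.tmul_smul, smul_add]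

theorem outerAct_lie (a b : sl2 × sl2) : outerAct V W a ∘ₗ outerAct V W b =
    outerAct V W ⁅a, b⁆ + outerAct V W b ∘ₗ outerAct V W a := by
  apply TensorProduct.ext'
  intro v w
  have h1 : ⁅a, b⁆.1 = ⁅a.1, b.1⁆ := rfl
  have h2 : ⁅a, b⁆.2 = ⁅a.2, b.2⁆ := rfl
  simp only [LinearMap.comp_apply, LinearMap.add_apply, outerAct_tmul, map_add, h1, h2,
    lie_lie, TensorProduct.sub_tmul, TensorProduct.tmul_sub]
  abel

/-- `g ⊕ g` acts on the outer tensor product by `(x, y)(v ⊗ w) = xv ⊗ w + v ⊗ yw`. -/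
noncomputable instance : LieRingModule (sl2 × sl2) (OuterTensor V W) where
  bracket a t := outerAct V W a t
  add_lie a b t := LinearMap.congr_fun (outerAct_add V W a b) t
  lie_add a s t := (outerAct V W a).map_add s t
  leibniz_lie a b t := LinearMap.congr_fun (outerAct_lie V W a b) t

instance : LieModule ℂ (sl2 × sl2) (OuterTensor V W) where
  smul_lie c a t := LinearMap.congr_fun (outerAct_smul V W c a) t
  lie_smul c a t := (outerAct V W a).map_smul c t

noncomputable def matrixElementBilin : V →ₗ[ℂ] RestrictedDual V →ₗ[ℂ] Module.Dual ℂ Env :=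
  LinearMap.mk₂ ℂ (matrixElement V)
    (fun v w k => by ext u; simp [matrixElement_apply])
    (fun c v k => by ext u; simp [matrixElement_apply])
    (fun v k l => by ext u; simp [matrixElement_apply])
    (fun c v k => by ext u; simp [matrixElement_apply])

/-- The `g ⊕ g`-homomorphism `V ⊗ V^⋆ → U(g)'` with `v ⊗ k ↦ φ_{v,k}`. -/
noncomputable def matrixElementMap :
    OuterTensor V (RestrictedDual V) →ₗ⁅ℂ,sl2 × sl2⁆ Module.Dual ℂ Env where
  toLinearMap := TensorProduct.lift (matrixElementBilin V)
  map_lie' := by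
    intro a t
    change TensorProduct.lift (matrixElementBilin V) (outerAct V (RestrictedDual V) a t) =
      dualAct a (TensorProduct.lift (matrixElementBilin V) t)
    induction t using TensorProduct.induction_on with
    | zero => ext u; simp [dualAct_apply]
    | add s t hs ht =>
      rw [map_add, map_add, hs, ht, map_add]
      ext u
      simp only [dualAct_apply, LinearMap.add_apply]
      ring
    | tmul v k =>
      rw [outerAct_tmul, map_add, TensorProduct.lift.tmul, TensorProduct.lift.tmul,
        TensorProduct.lift.tmul]
      ext u
      change matrixElement V ⁅a.1, v⁆ k u + matrixElement V v ⁅a.2, k⁆ u =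
        dualAct a (matrixElement V v k) u
      simp only [dualAct_apply, matrixElement_apply, map_mul, Module.End.mul_apply,
        enveloping_envι, RestrictedDual.lie_apply]
      ring

theorem matrixElementMap_tmul (v : V) (k : RestrictedDual V) :
    matrixElementMap V (OuterTensor.tmul v k) = matrixElement V v k := rfl

/-- The sub-bimodule of `V ⊗ V^⋆` of identically vanishing matrix elements. -/
noncomputable def vanishing : LieSubmodule ℂ (sl2 × sl2) (OuterTensor V (RestrictedDual V)) :=
  (matrixElementMap V).ker

end Outer

/-- The extension of the left infinitesimal action on `R(G₀)` to the enveloping algebra. -/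
noncomputable def leftRegular : Env →ₐ[ℂ] Module.End ℂ regularFunctions :=
  UniversalEnvelopingAlgebra.lift ℂ
    ((LieModule.toEnd ℂ (sl2 × sl2) regularFunctions).comp (LieHom.inl ℂ sl2 sl2))

/-- A regular function as a functional on the enveloping algebra: `u ↦ (π_l(u) ψ)(w₀)`. -/
noncomputable def vartheta : regularFunctions →ₗ[ℂ] Module.Dual ℂ Env where
  toFun ψ :=
    { toFun := fun u => (leftRegular u ψ : bigCell → ℂ) ⟨w0, w0_mem⟩
      map_add' := fun u u' => by simp
      map_smul' := fun c u => by simp }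
  map_add' ψ χ := by ext u; simp
  map_smul' c ψ := by ext u; simp

/-- The strictly anti-dominant integral weights `-(P⁺ + ρ) = {-1, -2, …}`. -/
def strictlyAntidominant : Set ℤ := {l | ∃ n : ℕ, l = -((n : ℤ) + 1)}

end BigCell

/-!
Let `a, c, d` be matrix entries of `g`, with `c` invertible on the big cell. The monomials
`a ^ i * d ^ j * c ^ n` with `i, j ∈ ℕ` and `n ∈ ℤ` span the regular functions; the left and the
right `𝐞` lower `i` and `j`, and both `𝐡` act diagonally. Hence a nonzero submodule of functions
contains a nonzero weight vector killed by `𝐞` on both sides. Such a function is determined by its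
value `ψ(w₀) = (ϑ ψ)(1)`, so `ϑ` is injective. A functional on `𝓤(𝔤)` killed by `𝐞` on both sides
is likewise determined by its weight and its value at `1`. Since `𝐞` is surjective on functions from
both sides, the image of `ϑ` therefore consists of all sums of integral weight vectors on which `𝐞`
is locally nilpotent on both sides.

Matrix elements of `P_λ`, `λ = -m - 1`, are of this kind. They lie in the generalised eigenspace of
the Casimir element `Ω` for the eigenvalue `m ^ 2`; this gives directness of the sum. For the
converse, `P_λ` is the cyclic module `𝓤(𝔤) / (𝐞 ^ (m + 1), 𝐡 + m + 1, (Ω - m ^ 2) ^ 2)`.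
A functional of weight `-m - 1` in the block of `m ^ 2` is the image of the generator under a
homomorphism, and evaluation at `1` turns it into a matrix element. Weights below `-m - 1` reduce to
this one, because `𝐟 𝐞` is invertible on their part of the block, and every monomial is obtained by
applying powers of `𝐞` to monomials of weight low enough for all their Casimir components.
-/

namespace BigCell

attribute [local instance 100] LieRing.ofAssociativeRing

open scoped Matrix MatrixGroups TensorProduct

open Polynomial (aeval X C)

open LieModule (toEnd)

/-! ### Linear algebra -/

section Lattice

variable {α ι : Type*} [CompleteLattice α] [IsModularLattice α]

theorem iSup_inf_eq_of_iSupIndep {A B : ι → α} (hA : iSupIndep A) (hBA : B ≤ A) (i : ι) :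
    (⨆ j, B j) ⊓ A i = B i := by
  have hdisj : Disjoint (A i) (⨆ (j) (_ : j ≠ i), B j) :=
    (hA i).mono_right (iSup₂_mono fun j _ => hBA j)
  rw [iSup_split_single B i, sup_inf_assoc_of_le _ (hBA i), inf_comm, hdisj.eq_bot, sup_bot_eq]

end Lattice

section Intertwiner

variable {R M N : Type*} [CommRing R] [AddCommGroup M] [Module R M] [AddCommGroup N] [Module R N]

theorem map_aeval_apply {φ : M →ₗ[R] N} {f : Module.End R M} {g : Module.End R N}
    (h : φ ∘ₗ f = g ∘ₗ φ) (p : Polynomial R) (x : M) : φ (aeval f p x) = aeval g p (φ x) := by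
  induction p using Polynomial.induction_on' with
  | add p q hp hq => simp only [map_add, LinearMap.add_apply, hp, hq]
  | monomial n a =>
    simp only [Polynomial.aeval_monomial, Module.End.mul_apply, Module.algebraMap_end_apply,
      map_smul]
    exact congrArg (a • ·)
      (LinearMap.congr_fun (Module.End.commute_pow_left_of_commute h.symm n) x).symm

theorem map_mem_maxGenEigenspace {φ : M →ₗ[R] N} {f : Module.End R M} {g : Module.End R N}
    (h : φ ∘ₗ f = g ∘ₗ φ) {c : R} {x : M} (hx : x ∈ f.maxGenEigenspace c) :
    φ x ∈ g.maxGenEigenspace c := by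
  obtain ⟨n, hn⟩ := (Module.End.mem_maxGenEigenspace f c x).1 hx
  refine (Module.End.mem_maxGenEigenspace g c _).2 ⟨n, ?_⟩
  have hcomm : φ ∘ₗ (f - c • 1) = (g - c • 1) ∘ₗ φ := by
    simp only [LinearMap.comp_sub, LinearMap.sub_comp, h]
    congr 1
    ext y
    exact φ.map_smul c y
  exact (LinearMap.congr_fun (Module.End.commute_pow_left_of_commute hcomm.symm n) x).trans
    ((congrArg φ hn).trans φ.map_zero)

end Intertwiner

section GeneralizedEigenspaces

variable {K V : Type*} [Field K] [AddCommGroup V] [Module K V] {f : Module.End K V}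

theorem exists_aeval_mul_apply_eq_self {c : K} {p : Polynomial K} (hp : p.eval c ≠ 0) {x : V}
    (hx : x ∈ f.maxGenEigenspace c) : ∃ q : Polynomial K, aeval f (q * p) x = x := by
  obtain ⟨n, hn⟩ := (Module.End.mem_maxGenEigenspace f c x).1 hx
  have hcop : IsCoprime p ((X - C c) ^ n) := by
    refine (IsCoprime.pow_left ?_).symm
    rwa [(Polynomial.irreducible_X_sub_C c).coprime_iff_not_dvd, Polynomial.dvd_iff_isRoot]
  obtain ⟨q, r, hqr⟩ := hcop
  have hzero : aeval f ((X - C c) ^ n) x = 0 := by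
    rw [map_pow, map_sub, Polynomial.aeval_X, Polynomial.aeval_C]
    exact hn
  refine ⟨q, ?_⟩
  calc aeval f (q * p) x = aeval f (q * p + r * (X - C c) ^ n) x := by
        rw [map_add, LinearMap.add_apply, map_mul _ r, Module.End.mul_apply, hzero, map_zero,
          add_zero]
    _ = x := by rw [hqr, map_one, Module.End.one_apply]

theorem eq_zero_of_aeval_apply_eq_zero {c : K} {p : Polynomial K} (hp : p.eval c ≠ 0) {x : V}
    (hx : x ∈ f.maxGenEigenspace c) (hpx : aeval f p x = 0) : x = 0 := by
  obtain ⟨q, hq⟩ := exists_aeval_mul_apply_eq_self hp hx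
  rw [← hq, map_mul, Module.End.mul_apply, hpx, map_zero]

theorem aeval_apply_eq_zero_of_dvd {p q : Polynomial K} (hpq : p ∣ q) {x : V}
    (hpx : aeval f p x = 0) : aeval f q x = 0 := by
  obtain ⟨r, rfl⟩ := hpq
  rw [mul_comm, map_mul, Module.End.mul_apply, hpx, map_zero]

theorem mem_iSup_inf_maxGenEigenspace [IsAlgClosed K] {Y : Submodule K V} (hY : Y ≤ Y.comap f)
    {p : Polynomial K} (hp : p ≠ 0) {x : V} (hx : x ∈ Y) (hpx : aeval f p x = 0) :
    x ∈ ⨆ c, Y ⊓ f.maxGenEigenspace c := by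
  induction p using UniqueFactorizationMonoid.induction_on_coprime generalizing x with
  | h0 => exact absurd rfl hp
  | h1 hu =>
    have hx0 : aeval f 1 x = 0 := aeval_apply_eq_zero_of_dvd hu.dvd hpx
    rw [map_one, Module.End.one_apply] at hx0
    exact hx0 ▸ zero_mem _
  | @hpr q n hq =>
    obtain ⟨c, hc⟩ :=
      IsAlgClosed.exists_root q (Polynomial.degree_pos_of_irreducible hq.irreducible).ne'
    have hassoc : Associated (X - C c) q :=
      (Polynomial.irreducible_X_sub_C c).associated_of_dvd hq.irreducible
        (Polynomial.dvd_iff_isRoot.2 hc)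
    have hzero : aeval f ((X - C c) ^ n) x = 0 :=
      aeval_apply_eq_zero_of_dvd (hassoc.pow_pow (n := n)).symm.dvd hpx
    rw [map_pow, map_sub, Polynomial.aeval_X, Polynomial.aeval_C] at hzero
    exact Submodule.mem_iSup_of_mem c
      ⟨hx, (Module.End.mem_maxGenEigenspace f c x).2 ⟨n, hzero⟩⟩
  | @hcp q r hqr ihq ihr =>
    obtain ⟨hq, hr⟩ := mul_ne_zero_iff.1 hp
    obtain ⟨a, b, hab⟩ := hqr.isCoprime
    have hsum : x = aeval f (a * q) x + aeval f (b * r) x := by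
      rw [← LinearMap.add_apply, ← map_add, hab, map_one, Module.End.one_apply]
    have hmem (s : Polynomial K) : aeval f s x ∈ Y :=
      Polynomial.aeval_apply_smul_mem_of_le_comap hx s f hY
    rw [hsum]
    refine add_mem (ihr hr (hmem _) ?_) (ihq hq (hmem _) ?_) <;>
      rw [← Module.End.mul_apply, ← map_mul]
    exacts [aeval_apply_eq_zero_of_dvd ⟨a, by ring⟩ hpx,
      aeval_apply_eq_zero_of_dvd ⟨b, by ring⟩ hpx]

theorem mem_iSup_inf_eigenspace {ι : Type*} {c : ι → K} (hc : Function.Injective c)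
    {Y : Submodule K V} (hY : Y ≤ Y.comap f) {x : V} (hx : x ∈ Y)
    (hxf : x ∈ ⨆ i, f.eigenspace (c i)) : x ∈ ⨆ i, Y ⊓ f.eigenspace (c i) := by
  classical
  obtain ⟨y, hy, hsum⟩ := (Submodule.mem_iSup_iff_exists_finsupp _ x).1 hxf
  have hproj (i : ι) (hi : i ∈ y.support) : aeval f (Lagrange.basis y.support c i) x = y i := by
    have heval (j : ι) : aeval f (Lagrange.basis y.support c i) (y j) =
        (Lagrange.basis y.support c i).eval (c j) • y j :=
      Module.End.aeval_apply_of_mem_apply_eq_smul (Module.End.mem_eigenspace_iff.1 (hy j))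
    rw [← hsum, Finsupp.sum, map_sum, Finset.sum_eq_single_of_mem i hi, heval,
      Lagrange.eval_basis_self hc.injOn hi, one_smul]
    intro j hj hji
    rw [heval, Lagrange.eval_basis_of_ne hji.symm hj, zero_smul]
  rw [← hsum]
  refine Submodule.sum_mem _ fun i hi => Submodule.mem_iSup_of_mem i ⟨?_, hy i⟩
  rw [← hproj i hi]
  exact Polynomial.aeval_apply_smul_mem_of_le_comap hx _ f hY

theorem mem_maxGenEigenspace_zero_of_apply_mem {x : V} (hx : f x ∈ f.maxGenEigenspace 0) :
    x ∈ f.maxGenEigenspace 0 := by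
  rw [Module.End.mem_maxGenEigenspace, zero_smul, sub_zero] at hx ⊢
  obtain ⟨n, hn⟩ := hx
  exact ⟨n + 1, by rw [pow_succ, Module.End.mul_apply, hn]⟩

theorem inf_le_comap_inf {A B : Submodule K V} (hA : A ≤ A.comap f) (hB : B ≤ B.comap f) :
    A ⊓ B ≤ (A ⊓ B).comap f :=
  (inf_le_inf hA hB).trans (Submodule.comap_inf A B f).ge

/-- Removing a preimage under `f` of `f x` from `x` leaves an element of the kernel, so elements
killed by a power of `f` are reached by induction on the exponent. -/
theorem inf_maxGenEigenspace_zero_le {S U : Submodule K V} (hS : S ≤ S.comap f) (hUS : U ≤ S)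
    (hU : U ≤ U.map f) (hker : S ⊓ LinearMap.ker f ≤ U) : S ⊓ f.maxGenEigenspace 0 ≤ U := by
  have hpow (n : ℕ) {x : V} (hx : x ∈ S) (hn : (f ^ n) x = 0) : x ∈ U := by
    induction n generalizing x with
    | zero =>
      rw [pow_zero, Module.End.one_apply] at hn
      exact hn ▸ U.zero_mem
    | succ n ih =>
      rw [pow_succ, Module.End.mul_apply] at hn
      obtain ⟨y, hy, hyx⟩ := hU (ih (hS hx) hn)
      have hxy : x - y ∈ U :=
        hker ⟨sub_mem hx (hUS hy), LinearMap.mem_ker.2 (by rw [map_sub, hyx, sub_self])⟩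
      simpa only [sub_add_cancel] using add_mem hxy hy
  rintro x ⟨hx, hxn⟩
  obtain ⟨n, hn⟩ := (Module.End.mem_maxGenEigenspace f 0 x).1 hxn
  rw [zero_smul, sub_zero] at hn
  exact hpow n hx hn

end GeneralizedEigenspaces

section Graded

variable {R M N ι : Type*} [Ring R] [AddCommGroup M] [Module R M] [AddCommGroup N] [Module R N]

theorem exists_mem_map_eq_of_mem_iSup {A : ι → Submodule R M} {B : ι → Submodule R N}
    (hB : iSupIndep B) (p : M →ₗ[R] N) (hp : ∀ i, ∀ x ∈ A i, p x ∈ B i) {x : M}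
    (hx : x ∈ ⨆ i, A i) {j : ι} (hxj : p x ∈ B j) : ∃ y ∈ A j, p y = p x := by
  have hle : (fun i => (A i).map p) ≤ B := fun i => Submodule.map_le_iff_le_comap.2 (hp i)
  have hmem : p x ∈ (⨆ i, (A i).map p) ⊓ B j :=
    ⟨Submodule.map_iSup p A ▸ Submodule.mem_map_of_mem hx, hxj⟩
  rwa [iSup_inf_eq_of_iSupIndep hB hle] at hmem

end Graded

section Cyclic

variable {R L M N P : Type*} [CommRing R] [LieRing L] [AddCommGroup M] [Module R M]
  [LieRingModule L M] [AddCommGroup N] [Module R N] [LieRingModule L N] [AddCommGroup P]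
  [Module R P] [LieRingModule L P]

theorem eq_top_of_mem_of_lieSpan_eq_top {v : M} (hgen : LieSubmodule.lieSpan R L {v} = ⊤)
    {N : LieSubmodule R L M} (hv : v ∈ N) : N = ⊤ :=
  eq_top_iff.2 (hgen ▸ LieSubmodule.lieSpan_le.2 (Set.singleton_subset_iff.2 hv))

theorem lieSpan_singleton_mk_eq_top (v : M) : LieSubmodule.lieSpan R L
    {(⟨v, LieSubmodule.subset_lieSpan rfl⟩ : LieSubmodule.lieSpan R L {v})} = ⊤ := by
  set w : LieSubmodule.lieSpan R L {v} := ⟨v, LieSubmodule.subset_lieSpan rfl⟩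
  have hle : LieSubmodule.lieSpan R L {v} ≤
      (LieSubmodule.lieSpan R L {w}).map (LieSubmodule.lieSpan R L {v}).incl :=
    LieSubmodule.lieSpan_le.2 <| Set.singleton_subset_iff.2 <|
      (LieSubmodule.mem_map _).2 ⟨w, LieSubmodule.subset_lieSpan rfl, rfl⟩
  refine eq_top_iff.2 fun x _ => ?_
  obtain ⟨y, hy, hyx⟩ := (LieSubmodule.mem_map _).1 (hle x.2)
  exact Subtype.ext hyx ▸ hy

theorem hom_ext_of_lieSpan_eq_top [LieAlgebra R L] [LieModule R L N] {v : M}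
    (hgen : LieSubmodule.lieSpan R L {v} = ⊤) {p q : M →ₗ⁅R,L⁆ N} (h : p v = q v) : p = q := by
  have hker : (p - q).ker = ⊤ := eq_top_of_mem_of_lieSpan_eq_top hgen <| by
    rw [LieModuleHom.mem_ker, LieModuleHom.sub_apply, h, sub_self]
  ext x
  have hx : x ∈ (p - q).ker := hker ▸ LieSubmodule.mem_top x
  rwa [LieModuleHom.mem_ker, LieModuleHom.sub_apply, sub_eq_zero] at hx

theorem range_sup_ker_eq_top {f : M →ₗ⁅R,L⁆ N} {p : N →ₗ⁅R,L⁆ P}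
    (h : Function.Surjective (p ∘ f)) : f.range ⊔ p.ker = ⊤ := by
  refine eq_top_iff.2 fun x _ => ?_
  obtain ⟨y, hy⟩ := h (p x)
  refine (LieSubmodule.mem_sup _ _ x).2 ⟨f y, ⟨y, rfl⟩, x - f y, ?_, add_sub_cancel _ _⟩
  rw [LieModuleHom.mem_ker, map_sub, ← hy, Function.comp_apply, sub_self]

end Cyclic

section LieActions

variable {R L M : Type*} [CommRing R] [LieRing L] [LieAlgebra R L] [AddCommGroup M] [Module R M]
  [LieRingModule L M] [LieModule R L M]

theorem ker_toEnd_le_comap_toEnd {a b : L} {c : R} (h : ⁅b, a⁆ = c • b) :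
    LinearMap.ker (toEnd R L M b) ≤ (LinearMap.ker (toEnd R L M b)).comap (toEnd R L M a) := by
  intro x hx
  have hbx : ⁅b, x⁆ = 0 := hx
  change ⁅b, ⁅a, x⁆⁆ = 0
  rw [leibniz_lie, h, smul_lie, hbx, smul_zero, lie_zero, add_zero]

theorem prodMk_zero_lie_zero_prodMk (x y : L) : ⁅((x, 0) : L × L), ((0, y) : L × L)⁆ = 0 :=
  Prod.ext (lie_zero x) (zero_lie y)

end LieActions

/-! ### Weights and the Casimir operator -/

section WeightVectors

theorem lie_e_lie_f {V : Type*} [AddCommGroup V] [LieRingModule sl2 V] (x : V) :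
    ⁅sl2E, ⁅sl2F, x⁆⁆ = ⁅sl2H, x⁆ + ⁅sl2F, ⁅sl2E, x⁆⁆ := by
  rw [leibniz_lie, lie_e_f]

theorem lie_mem_of_lie_e_h_f_mem {V : Type*} [AddCommGroup V] [Module ℂ V] [LieRingModule sl2 V]
    [LieModule ℂ sl2 V] {Y : Submodule ℂ V} {x : V} (he : ⁅sl2E, x⁆ ∈ Y) (hh : ⁅sl2H, x⁆ ∈ Y)
    (hf : ⁅sl2F, x⁆ ∈ Y) (y : sl2) : ⁅y, x⁆ ∈ Y := by
  rw [eq_combination y, add_lie, add_lie, smul_lie, smul_lie, smul_lie]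
  exact add_mem (add_mem (Y.smul_mem _ he) (Y.smul_mem _ hh)) (Y.smul_mem _ hf)

variable {V W : Type} [AddCommGroup V] [Module ℂ V] [LieRingModule sl2 V] [LieModule ℂ sl2 V]
  [AddCommGroup W] [Module ℂ W] [LieRingModule sl2 W] [LieModule ℂ sl2 W]

theorem hWeightSpace_eq_eigenspace : hWeightSpace V = (toEnd ℂ sl2 V sl2H).eigenspace := by
  ext μ x
  rw [Module.End.mem_eigenspace_iff]
  rfl

theorem iSupIndep_hWeightSpace : iSupIndep (hWeightSpace V) :=
  hWeightSpace_eq_eigenspace (V := V) ▸ Module.End.eigenspaces_iSupIndep _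

theorem map_mem_hWeightSpace (p : V →ₗ⁅ℂ,sl2⁆ W) {μ : ℂ} {x : V} (hx : x ∈ hWeightSpace V μ) :
    p x ∈ hWeightSpace W μ := by
  change ⁅sl2H, x⁆ = μ • x at hx
  change ⁅sl2H, p x⁆ = μ • p x
  rw [← LieModuleHom.map_lie, hx, map_smul]

theorem toEnd_pow_succ_apply (y : sl2) (n : ℕ) (x : V) :
    (toEnd ℂ sl2 V y ^ (n + 1)) x = ⁅y, (toEnd ℂ sl2 V y ^ n) x⁆ := by
  rw [pow_succ', Module.End.mul_apply, LieModule.toEnd_apply_apply]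

theorem map_toEnd_pow (p : V →ₗ⁅ℂ,sl2⁆ W) (y : sl2) (n : ℕ) (x : V) :
    p ((toEnd ℂ sl2 V y ^ n) x) = (toEnd ℂ sl2 W y ^ n) (p x) := by
  induction n with
  | zero => rfl
  | succ n ih => rw [toEnd_pow_succ_apply, LieModuleHom.map_lie, ih, toEnd_pow_succ_apply]

theorem toEnd_pow_mem (N : LieSubmodule ℂ sl2 V) (y : sl2) (n : ℕ) {x : V} (hx : x ∈ N) :
    (toEnd ℂ sl2 V y ^ n) x ∈ N := by
  induction n with
  | zero => exact hx
  | succ n ih => exact toEnd_pow_succ_apply y n x ▸ N.lie_mem ih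

theorem e_pow_mem_hWeightSpace {μ : ℂ} {x : V} (hx : x ∈ hWeightSpace V μ) (n : ℕ) :
    (toEnd ℂ sl2 V sl2E ^ n) x ∈ hWeightSpace V (μ + 2 * n) := by
  induction n with
  | zero => simpa using hx
  | succ n ih =>
    rw [toEnd_pow_succ_apply, show μ + 2 * ((n + 1 : ℕ) : ℂ) = μ + 2 * n + 2 by push_cast; ring]
    exact hWeightSpace_e V ih

theorem f_pow_mem_hWeightSpace {μ : ℂ} {x : V} (hx : x ∈ hWeightSpace V μ) (n : ℕ) :
    (toEnd ℂ sl2 V sl2F ^ n) x ∈ hWeightSpace V (μ - 2 * n) := by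
  induction n with
  | zero => simpa using hx
  | succ n ih =>
    rw [toEnd_pow_succ_apply, show μ - 2 * ((n + 1 : ℕ) : ℂ) = μ - 2 * n - 2 by push_cast; ring]
    exact hWeightSpace_f V ih

end WeightVectors

section Casimir

variable (V : Type) [AddCommGroup V] [Module ℂ V] [LieRingModule sl2 V] [LieModule ℂ sl2 V]

/-- The Casimir operator, normalised as `4fe + (h + 1)²`, so that it acts by `(μ + 1)²` on the
vectors of weight `μ` killed by `e`. -/
def casimir : Module.End ℂ V :=
  (4 : ℂ) • (toEnd ℂ sl2 V sl2F * toEnd ℂ sl2 V sl2E) + (toEnd ℂ sl2 V sl2H + 1) ^ 2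

variable {V} {W : Type} [AddCommGroup W] [Module ℂ W] [LieRingModule sl2 W] [LieModule ℂ sl2 W]

theorem casimir_apply (x : V) :
    casimir V x = (4 : ℂ) • ⁅sl2F, ⁅sl2E, x⁆⁆ + ⁅sl2H, ⁅sl2H, x⁆⁆ + (2 : ℂ) • ⁅sl2H, x⁆ + x := by
  simp only [casimir, sq, LinearMap.add_apply, LinearMap.smul_apply, Module.End.mul_apply,
    LieModule.toEnd_apply_apply, Module.End.one_apply, lie_add]
  module

theorem casimir_lie (y : sl2) (x : V) : casimir V ⁅y, x⁆ = ⁅y, casimir V x⁆ := by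
  have heh (x : V) : ⁅sl2E, ⁅sl2H, x⁆⁆ = ⁅sl2H, ⁅sl2E, x⁆⁆ - (2 : ℂ) • ⁅sl2E, x⁆ := by
    rw [leibniz_lie, ← lie_skew, lie_h_e, neg_lie, smul_lie]; abel
  have hhf (x : V) : ⁅sl2H, ⁅sl2F, x⁆⁆ = ⁅sl2F, ⁅sl2H, x⁆⁆ - (2 : ℂ) • ⁅sl2F, x⁆ := by
    rw [leibniz_lie, lie_h_f, smul_lie, neg_smul]; abel
  rw [eq_combination y]
  simp only [casimir_apply, add_lie, smul_lie, lie_add, lie_sub, lie_smul, lie_e_lie_f, heh, hhf]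
  module

theorem toEnd_comp_casimir (y : sl2) :
    toEnd ℂ sl2 V y ∘ₗ casimir V = casimir V ∘ₗ toEnd ℂ sl2 V y :=
  LinearMap.ext fun x => (casimir_lie y x).symm

theorem map_comp_casimir (p : V →ₗ⁅ℂ,sl2⁆ W) :
    (p : V →ₗ[ℂ] W) ∘ₗ casimir V = casimir W ∘ₗ (p : V →ₗ[ℂ] W) := by
  ext x
  simp only [LinearMap.comp_apply, LieModuleHom.coe_toLinearMap, casimir_apply, map_add, map_smul,
    LieModuleHom.map_lie]

theorem aeval_casimir_lie (q : Polynomial ℂ) (y : sl2) (x : V) :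
    aeval (casimir V) q ⁅y, x⁆ = ⁅y, aeval (casimir V) q x⁆ :=
  (map_aeval_apply (toEnd_comp_casimir y) q x).symm

theorem map_aeval_casimir (p : V →ₗ⁅ℂ,sl2⁆ W) (q : Polynomial ℂ) (x : V) :
    p (aeval (casimir V) q x) = aeval (casimir W) q (p x) :=
  map_aeval_apply (map_comp_casimir p) q x

theorem aeval_casimir_toEnd_pow (q : Polynomial ℂ) (y : sl2) (n : ℕ) (x : V) :
    aeval (casimir V) q ((toEnd ℂ sl2 V y ^ n) x) = (toEnd ℂ sl2 V y ^ n) (aeval (casimir V) q x) :=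
  (map_aeval_apply (Module.End.commute_pow_left_of_commute (toEnd_comp_casimir y) n) q x).symm

theorem aeval_casimir_mem (N : LieSubmodule ℂ sl2 V) (q : Polynomial ℂ) {x : V} (hx : x ∈ N) :
    aeval (casimir V) q x ∈ N := by
  refine Polynomial.aeval_apply_smul_mem_of_le_comap (q := (N : Submodule ℂ V)) hx q _ ?_
  intro y hy
  rw [Submodule.mem_comap, casimir_apply]
  exact add_mem (add_mem (add_mem (N.smul_mem _ (N.lie_mem (N.lie_mem hy)))
    (N.lie_mem (N.lie_mem hy))) (N.smul_mem _ (N.lie_mem hy))) hy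

theorem casimir_of_mem_hWeightSpace {μ : ℂ} {x : V} (hx : x ∈ hWeightSpace V μ) :
    casimir V x = (4 : ℂ) • ⁅sl2F, ⁅sl2E, x⁆⁆ + (μ + 1) ^ 2 • x := by
  change ⁅sl2H, x⁆ = μ • x at hx
  simp only [casimir_apply, hx, lie_smul]
  module

theorem hWeightSpace_le_comap_casimir (μ : ℂ) :
    hWeightSpace V μ ≤ (hWeightSpace V μ).comap (casimir V) := by
  intro x hx
  change ⁅sl2H, x⁆ = μ • x at hx
  change ⁅sl2H, casimir V x⁆ = μ • casimir V x
  rw [← casimir_lie, hx, map_smul]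

theorem aeval_casimir_mem_hWeightSpace (q : Polynomial ℂ) {μ : ℂ} {x : V}
    (hx : x ∈ hWeightSpace V μ) : aeval (casimir V) q x ∈ hWeightSpace V μ :=
  Polynomial.aeval_apply_smul_mem_of_le_comap hx q _ (hWeightSpace_le_comap_casimir μ)

theorem lie_f_lie_e_of_mem_hWeightSpace {μ : ℂ} {x : V} (hx : x ∈ hWeightSpace V μ) :
    ⁅sl2F, ⁅sl2E, x⁆⁆ = (4 : ℂ)⁻¹ • (casimir V x - (μ + 1) ^ 2 • x) := by
  rw [casimir_of_mem_hWeightSpace hx]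
  module

theorem lie_e_lie_f_of_mem_hWeightSpace {μ : ℂ} {x : V} (hx : x ∈ hWeightSpace V μ) :
    ⁅sl2E, ⁅sl2F, x⁆⁆ = (4 : ℂ)⁻¹ • (casimir V x - (μ - 1) ^ 2 • x) := by
  have hx' : ⁅sl2H, x⁆ = μ • x := hx
  rw [lie_e_lie_f, lie_f_lie_e_of_mem_hWeightSpace hx, hx']
  module

variable (V) in
/-- The block of `V` with generalized infinitesimal character `c`: the generalized eigenspace of
the Casimir operator. -/
def casimirBlock (c : ℂ) : LieSubmodule ℂ sl2 V where
  __ := (casimir V).maxGenEigenspace c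
  lie_mem {y _} hx := map_mem_maxGenEigenspace (toEnd_comp_casimir y) hx

theorem map_mem_casimirBlock (p : V →ₗ⁅ℂ,sl2⁆ W) {c : ℂ} {x : V} (hx : x ∈ casimirBlock V c) :
    p x ∈ casimirBlock W c :=
  map_mem_maxGenEigenspace (map_comp_casimir p) hx

theorem mem_casimirBlock_of_aeval_apply_eq_zero {c : ℂ} {n : ℕ} {x : V}
    (hx : aeval (casimir V) ((X - C c) ^ n) x = 0) : x ∈ casimirBlock V c := by
  rw [map_pow, map_sub, Polynomial.aeval_X, Polynomial.aeval_C] at hx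
  exact (Module.End.mem_maxGenEigenspace _ _ _).2 ⟨n, hx⟩

/-- The polynomial in the Casimir operator killing the vectors of weight `μ` on which `e ^ n`
vanishes. Its roots are the eigenvalues of the Casimir operator on the highest weight vectors of
weights `μ`, `μ + 2`, …, `μ + 2 * (n - 1)`. -/
noncomputable def casimirPolynomial (μ : ℂ) (n : ℕ) : Polynomial ℂ :=
  ∏ j ∈ Finset.range n, (X - C ((μ + 1 + 2 * (j : ℂ)) ^ 2))

theorem casimirPolynomial_ne_zero (μ : ℂ) (n : ℕ) : casimirPolynomial μ n ≠ 0 :=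
  Finset.prod_ne_zero_iff.2 fun _ _ => Polynomial.X_sub_C_ne_zero _

theorem casimirPolynomial_succ (μ : ℂ) (n : ℕ) : casimirPolynomial μ (n + 1) =
    casimirPolynomial (μ + 2) n * (X - C ((μ + 1) ^ 2)) := by
  rw [casimirPolynomial, Finset.prod_range_succ', casimirPolynomial]
  congr 1
  · refine Finset.prod_congr rfl fun j _ => ?_
    rw [show μ + 1 + 2 * ((j + 1 : ℕ) : ℂ) = μ + 2 + 1 + 2 * j by push_cast; ring]
  · simp

theorem aeval_casimirPolynomial_apply_eq_zero {μ : ℂ} {n : ℕ} {x : V} (hx : x ∈ hWeightSpace V μ)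
    (hn : (toEnd ℂ sl2 V sl2E ^ n) x = 0) : aeval (casimir V) (casimirPolynomial μ n) x = 0 := by
  induction n generalizing μ x with
  | zero => simpa [casimirPolynomial] using hn
  | succ n ih =>
    have hfe : aeval (casimir V) (X - C ((μ + 1) ^ 2)) x = (4 : ℂ) • ⁅sl2F, ⁅sl2E, x⁆⁆ := by
      rw [map_sub, Polynomial.aeval_X, Polynomial.aeval_C, LinearMap.sub_apply,
        Module.algebraMap_end_apply, casimir_of_mem_hWeightSpace hx, add_sub_cancel_right]
    have he : aeval (casimir V) (casimirPolynomial (μ + 2) n) ⁅sl2E, x⁆ = 0 := by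
      refine ih (hWeightSpace_e V hx) ?_
      rwa [pow_succ, Module.End.mul_apply] at hn
    rw [casimirPolynomial_succ, map_mul, Module.End.mul_apply, hfe, map_smul, aeval_casimir_lie,
      he, lie_zero, smul_zero]

theorem exists_eq_sq_of_mem_casimirBlock {μ c : ℂ} {n : ℕ} {x : V} (hx0 : x ≠ 0)
    (hx : x ∈ hWeightSpace V μ) (hn : (toEnd ℂ sl2 V sl2E ^ n) x = 0)
    (hc : x ∈ casimirBlock V c) : ∃ j < n, c = (μ + 1 + 2 * (j : ℂ)) ^ 2 := by
  have hroot : (casimirPolynomial μ n).eval c = 0 := by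
    by_contra h
    exact hx0 (eq_zero_of_aeval_apply_eq_zero h hc (aeval_casimirPolynomial_apply_eq_zero hx hn))
  simpa only [casimirPolynomial, Polynomial.eval_prod, Finset.prod_eq_zero_iff, Finset.mem_range,
    Polynomial.eval_sub, Polynomial.eval_X, Polynomial.eval_C, sub_eq_zero] using hroot

theorem e_pow_apply_eq_zero_of_mem_casimirBlock {m n : ℕ} {x : V}
    (hx : x ∈ hWeightSpace V (-(m : ℂ) - 1)) (hn : (toEnd ℂ sl2 V sl2E ^ n) x = 0)
    (hc : x ∈ casimirBlock V ((m : ℂ) ^ 2)) : (toEnd ℂ sl2 V sl2E ^ (m + 1)) x = 0 := by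
  by_contra h0
  have hn' : (toEnd ℂ sl2 V sl2E ^ n) ((toEnd ℂ sl2 V sl2E ^ (m + 1)) x) = 0 := by
    rw [← Module.End.mul_apply, ← pow_add, add_comm, pow_add, Module.End.mul_apply, hn, map_zero]
  obtain ⟨j, -, hj⟩ := exists_eq_sq_of_mem_casimirBlock h0 (e_pow_mem_hWeightSpace hx _) hn'
    (toEnd_pow_mem _ _ _ hc)
  have hsq : m ^ 2 = (m + 2 + 2 * j) ^ 2 := by
    refine Nat.cast_injective (R := ℂ) ?_
    push_cast at hj ⊢
    rw [hj]
    ring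
  have := Nat.pow_left_injective two_ne_zero hsq
  omega

theorem eq_zero_or_eq_of_sq_eq_sq {m j : ℕ}
    (h : (-(m : ℂ) - 1 + 1 + 2 * (j : ℂ)) ^ 2 = (m : ℂ) ^ 2) : j = 0 ∨ j = m := by
  have hmul : (j : ℂ) * (j - m) = 0 := by linear_combination h / 4
  rcases mul_eq_zero.1 hmul with hj | hj
  · exact Or.inl (Nat.cast_eq_zero.1 hj)
  · exact Or.inr (Nat.cast_injective (sub_eq_zero.1 hj))

theorem aeval_casimir_sq_apply_eq_zero {m n : ℕ} {x : V}
    (hx : x ∈ hWeightSpace V (-(m : ℂ) - 1)) (hn : (toEnd ℂ sl2 V sl2E ^ n) x = 0)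
    (hc : x ∈ casimirBlock V ((m : ℂ) ^ 2)) :
    aeval (casimir V) ((X - C ((m : ℂ) ^ 2)) ^ 2) x = 0 := by
  classical
  let r (j : ℕ) : ℂ := (-(m : ℂ) - 1 + 1 + 2 * (j : ℂ)) ^ 2
  let s := (Finset.range n).filter fun j => r j = (m : ℂ) ^ 2
  let q := ∏ j ∈ (Finset.range n).filter fun j => r j ≠ (m : ℂ) ^ 2, (X - C (r j))
  have hs : s ⊆ {0, m} := fun j hj => by
    simpa using eq_zero_or_eq_of_sq_eq_sq (Finset.mem_filter.1 hj).2
  have hfactor : casimirPolynomial (-(m : ℂ) - 1) n = q * (X - C ((m : ℂ) ^ 2)) ^ s.card := by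
    rw [casimirPolynomial, ← Finset.prod_filter_not_mul_prod_filter _ (fun j => r j = (m : ℂ) ^ 2)]
    congr 1
    exact Finset.prod_eq_pow_card fun j hj => by
      rw [show (-(m : ℂ) - 1 + 1 + 2 * (j : ℂ)) ^ 2 = (m : ℂ) ^ 2 from (Finset.mem_filter.1 hj).2]
  have hq : q.eval ((m : ℂ) ^ 2) ≠ 0 := by
    rw [Polynomial.eval_prod, Finset.prod_ne_zero_iff]
    intro j hj
    rw [Polynomial.eval_sub, Polynomial.eval_X, Polynomial.eval_C, sub_ne_zero]
    exact (Finset.mem_filter.1 hj).2.symm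
  have hzero : aeval (casimir V) ((X - C ((m : ℂ) ^ 2)) ^ s.card) x = 0 := by
    refine eq_zero_of_aeval_apply_eq_zero hq (aeval_casimir_mem _ _ hc) ?_
    rw [← Module.End.mul_apply, ← map_mul, ← hfactor]
    exact aeval_casimirPolynomial_apply_eq_zero hx hn
  exact aeval_apply_eq_zero_of_dvd
    (pow_dvd_pow _ ((Finset.card_le_card hs).trans Finset.card_le_two)) hzero

end Casimir

/-! ### Category O and cyclic modules -/

section CategoryO

variable (V : Type) [AddCommGroup V] [Module ℂ V] [LieRingModule sl2 V] [LieModule ℂ sl2 V]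

/-- The sum of the weight spaces. -/
def weightSum : LieSubmodule ℂ sl2 V where
  __ := ⨆ μ, hWeightSpace V μ
  lie_mem {y x} hx := by
    suffices h : ⨆ μ, hWeightSpace V μ ≤ (⨆ μ, hWeightSpace V μ).comap (toEnd ℂ sl2 V y) from h hx
    refine iSup_le fun μ x hx => Submodule.mem_comap.2 (lie_mem_of_lie_e_h_f_mem ?_ ?_ ?_ y)
    · exact Submodule.mem_iSup_of_mem _ (hWeightSpace_e V hx)
    · change ⁅sl2H, x⁆ = μ • x at hx
      exact hx ▸ Submodule.smul_mem _ _ (Submodule.mem_iSup_of_mem μ hx)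
    · exact Submodule.mem_iSup_of_mem _ (hWeightSpace_f V hx)

theorem mem_maxGenEigenspace_ad_e (y : sl2) :
    y ∈ (toEnd ℂ sl2 sl2 sl2E).maxGenEigenspace 0 := by
  refine (Module.End.mem_maxGenEigenspace _ _ _).2 ⟨3, ?_⟩
  have hhe : ⁅sl2E, sl2H⁆ = (-2 : ℂ) • sl2E := by rw [← lie_skew, lie_h_e, neg_smul]
  rw [zero_smul, sub_zero, eq_combination y]
  simp only [pow_succ, pow_zero, one_mul, Module.End.mul_apply, LieModule.toEnd_apply_apply,
    lie_add, lie_smul, lie_self, lie_zero, hhe, lie_e_f, smul_zero, add_zero]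

/-- The locally `e`-nilpotent part of a module. -/
def eNilpotentPart : LieSubmodule ℂ sl2 V where
  __ := (toEnd ℂ sl2 V sl2E).maxGenEigenspace 0
  lie_mem {y x} hx := by
    have h := LieModule.lie_mem_maxGenEigenspace_toEnd (mem_maxGenEigenspace_ad_e y) hx
    rwa [add_zero] at h

variable {V} {W : Type} [AddCommGroup W] [Module ℂ W] [LieRingModule sl2 W] [LieModule ℂ sl2 W]

theorem mem_eNilpotentPart_iff {x : V} :
    x ∈ eNilpotentPart V ↔ ∃ n : ℕ, (toEnd ℂ sl2 V sl2E ^ n) x = 0 := by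
  refine (Module.End.mem_maxGenEigenspace _ _ _).trans ?_
  rw [zero_smul, sub_zero]

theorem InCategoryO.iSup_hWeightSpace (h : InCategoryO V) : ⨆ μ, hWeightSpace V μ = ⊤ :=
  h.weightDecomposition.submodule_iSup_eq_top

theorem inCategoryO_of_lieSpan_eq_top {μ : ℂ} {n : ℕ} {v : V} (hv : v ∈ hWeightSpace V μ)
    (hn : (toEnd ℂ sl2 V sl2E ^ n) v = 0) (hgen : LieSubmodule.lieSpan ℂ sl2 {v} = ⊤) :
    InCategoryO V where
  finitelyGenerated := ⟨{v}, by rwa [Finset.coe_singleton]⟩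
  weightDecomposition := by
    refine DirectSum.isInternal_submodule_of_iSupIndep_of_iSup_eq_top iSupIndep_hWeightSpace ?_
    have htop : weightSum V = ⊤ :=
      eq_top_of_mem_of_lieSpan_eq_top hgen (Submodule.mem_iSup_of_mem μ hv)
    exact congrArg LieSubmodule.toSubmodule htop
  locallyNilpotent x := by
    have htop : eNilpotentPart V = ⊤ :=
      eq_top_of_mem_of_lieSpan_eq_top hgen (mem_eNilpotentPart_iff.2 ⟨n, hn⟩)
    exact mem_eNilpotentPart_iff.1 (htop ▸ LieSubmodule.mem_top x)

theorem mem_iSup_inf_hWeightSpace (hV : ⨆ μ, hWeightSpace V μ = ⊤) (N : LieSubmodule ℂ sl2 V)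
    {x : V} (hx : x ∈ N) : x ∈ ⨆ μ, (N : Submodule ℂ V) ⊓ hWeightSpace V μ := by
  rw [hWeightSpace_eq_eigenspace] at hV ⊢
  exact mem_iSup_inf_eigenspace Function.injective_id (fun _ hy => N.lie_mem hy) hx
    (hV ▸ Submodule.mem_top)

theorem exists_add_eq_of_mem_sup (hV : ⨆ μ, hWeightSpace V μ = ⊤) {N K : LieSubmodule ℂ sl2 V}
    {μ : ℂ} {x : V} (hx : x ∈ N ⊔ K) (hxμ : x ∈ hWeightSpace V μ) :
    ∃ y ∈ N, ∃ z ∈ K, y ∈ hWeightSpace V μ ∧ z ∈ hWeightSpace V μ ∧ y + z = x := by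
  let part (M : LieSubmodule ℂ sl2 V) (ν : ℂ) : Submodule ℂ V :=
    (M : Submodule ℂ V) ⊓ hWeightSpace V ν
  have hsum : x ∈ ⨆ ν, (part N ν ⊔ part K ν) := by
    obtain ⟨y, hy, z, hz, rfl⟩ := (LieSubmodule.mem_sup N K x).1 hx
    rw [iSup_sup_eq]
    exact Submodule.add_mem_sup (mem_iSup_inf_hWeightSpace hV N hy)
      (mem_iSup_inf_hWeightSpace hV K hz)
  have hpart : x ∈ part N μ ⊔ part K μ := by
    rw [← iSup_inf_eq_of_iSupIndep iSupIndep_hWeightSpace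
      (fun ν => sup_le inf_le_right inf_le_right : (fun ν => part N ν ⊔ part K ν) ≤ _)]
    exact ⟨hsum, hxμ⟩
  obtain ⟨y, hy, z, hz, hyz⟩ := Submodule.mem_sup.1 hpart
  exact ⟨y, hy.1, z, hz.1, hy.2, hz.2, hyz⟩

theorem exists_mem_hWeightSpace_of_map_eq (hV : ⨆ μ, hWeightSpace V μ = ⊤) {p : V →ₗ⁅ℂ,sl2⁆ W}
    (hp : Function.Surjective p) {μ : ℂ} {y : W} (hy : y ∈ hWeightSpace W μ) :
    ∃ x ∈ hWeightSpace V μ, p x = y := by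
  obtain ⟨x, rfl⟩ := hp y
  refine exists_mem_map_eq_of_mem_iSup iSupIndep_hWeightSpace (p : V →ₗ[ℂ] W)
    (fun _ _ => map_mem_hWeightSpace p) ?_ hy
  exact hV ▸ Submodule.mem_top

end CategoryO

section CyclicModules

variable {V : Type} [AddCommGroup V] [Module ℂ V] [LieRingModule sl2 V] [LieModule ℂ sl2 V]

/-- The span of the `C ^ k v`, where `C` is the Casimir operator. -/
noncomputable def casimirSpan (v : V) : Submodule ℂ V :=
  LinearMap.range (LinearMap.applyₗ v ∘ₗ (aeval (casimir V)).toLinearMap)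

/-- The part of weight `μ + 2 * i` of the module generated by a vector `v` of weight `μ`: by
the Casimir relation it suffices to apply a power of `e` (of `f`, for `i < 0`) to the `C ^ k v`. -/
noncomputable def ladder (v : V) : ℤ → Submodule ℂ V
  | .ofNat n => (casimirSpan v).map (toEnd ℂ sl2 V sl2E ^ n)
  | .negSucc n => (casimirSpan v).map (toEnd ℂ sl2 V sl2F ^ (n + 1))

theorem ladder_neg_natCast (v : V) (n : ℕ) :
    ladder v (-n) = (casimirSpan v).map (toEnd ℂ sl2 V sl2F ^ n) := by
  cases n with
  | zero => rfl
  | succ n => rfl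

theorem ladder_le_hWeightSpace {μ : ℂ} {v : V} (hv : v ∈ hWeightSpace V μ) (i : ℤ) :
    ladder v i ≤ hWeightSpace V (μ + 2 * i) := by
  obtain ⟨n, rfl | rfl⟩ := i.eq_nat_or_neg
  · rintro _ ⟨_, ⟨q, rfl⟩, rfl⟩
    exact e_pow_mem_hWeightSpace (aeval_casimir_mem_hWeightSpace q hv) n
  · rw [ladder_neg_natCast]
    rintro _ ⟨_, ⟨q, rfl⟩, rfl⟩
    rw [Int.cast_neg, Int.cast_natCast, mul_neg, ← sub_eq_add_neg]
    exact f_pow_mem_hWeightSpace (aeval_casimir_mem_hWeightSpace q hv) n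

theorem casimir_mem_ladder {v x : V} {i : ℤ} (hx : x ∈ ladder v i) :
    casimir V x ∈ ladder v i := by
  have hmap (y : sl2) (n : ℕ) {x : V} (hx : x ∈ (casimirSpan v).map (toEnd ℂ sl2 V y ^ n)) :
      casimir V x ∈ (casimirSpan v).map (toEnd ℂ sl2 V y ^ n) := by
    obtain ⟨_, ⟨q, rfl⟩, rfl⟩ := hx
    refine ⟨aeval (casimir V) (X * q) v, ⟨X * q, rfl⟩, ?_⟩
    rw [← aeval_casimir_toEnd_pow, map_mul, Polynomial.aeval_X]
    exact congrArg (casimir V) (aeval_casimir_toEnd_pow q y n v)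
  cases i with
  | ofNat n => exact hmap _ _ hx
  | negSucc n => exact hmap _ _ hx

theorem lie_e_mem_ladder {μ : ℂ} {v x : V} (hv : v ∈ hWeightSpace V μ) {i : ℤ}
    (hx : x ∈ ladder v i) : ⁅sl2E, x⁆ ∈ ladder v (i + 1) := by
  cases i with
  | ofNat n =>
    obtain ⟨y, hy, rfl⟩ := hx
    exact ⟨y, hy, toEnd_pow_succ_apply _ _ _⟩
  | negSucc n =>
    rw [show Int.negSucc n + 1 = -(n : ℤ) by omega, ladder_neg_natCast]
    obtain ⟨y, hy, rfl⟩ := hx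
    have hmem : (toEnd ℂ sl2 V sl2F ^ n) y ∈ ladder v (-n) := ladder_neg_natCast v n ▸ ⟨y, hy, rfl⟩
    rw [toEnd_pow_succ_apply, lie_e_lie_f_of_mem_hWeightSpace (ladder_le_hWeightSpace hv _ hmem),
      ← ladder_neg_natCast]
    exact Submodule.smul_mem _ _
      (sub_mem (casimir_mem_ladder hmem) (Submodule.smul_mem _ _ hmem))

theorem lie_f_mem_ladder {μ : ℂ} {v x : V} (hv : v ∈ hWeightSpace V μ) {i : ℤ}
    (hx : x ∈ ladder v i) : ⁅sl2F, x⁆ ∈ ladder v (i - 1) := by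
  obtain ⟨n, rfl⟩ | ⟨n, rfl⟩ : (∃ n : ℕ, i = (n + 1 : ℕ)) ∨ ∃ n : ℕ, i = -n := by
    rcases i with (_ | n) | n
    exacts [Or.inr ⟨0, rfl⟩, Or.inl ⟨n, rfl⟩, Or.inr ⟨n + 1, rfl⟩]
  · rw [Nat.cast_succ, add_sub_cancel_right]
    obtain ⟨y, hy, rfl⟩ := hx
    have hmem : (toEnd ℂ sl2 V sl2E ^ n) y ∈ ladder v n := ⟨y, hy, rfl⟩
    rw [toEnd_pow_succ_apply, lie_f_lie_e_of_mem_hWeightSpace (ladder_le_hWeightSpace hv _ hmem)]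
    exact Submodule.smul_mem _ _
      (sub_mem (casimir_mem_ladder hmem) (Submodule.smul_mem _ _ hmem))
  · rw [ladder_neg_natCast] at hx
    obtain ⟨y, hy, rfl⟩ := hx
    rw [← neg_add', ← Nat.cast_succ, ladder_neg_natCast]
    exact ⟨y, hy, toEnd_pow_succ_apply _ _ _⟩

theorem lieSpan_singleton_le_iSup_ladder {μ : ℂ} {v : V} (hv : v ∈ hWeightSpace V μ) :
    (LieSubmodule.lieSpan ℂ sl2 {v} : Submodule ℂ V) ≤ ⨆ i, ladder v i := by
  have hstable (y : sl2) : ⨆ i, ladder v i ≤ (⨆ i, ladder v i).comap (toEnd ℂ sl2 V y) := by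
    refine iSup_le fun i x hx => Submodule.mem_comap.2 (lie_mem_of_lie_e_h_f_mem ?_ ?_ ?_ y)
    · exact Submodule.mem_iSup_of_mem _ (lie_e_mem_ladder hv hx)
    · have hh : ⁅sl2H, x⁆ = (μ + 2 * i) • x := ladder_le_hWeightSpace hv i hx
      exact hh ▸ Submodule.smul_mem _ _ (Submodule.mem_iSup_of_mem i hx)
    · exact Submodule.mem_iSup_of_mem _ (lie_f_mem_ladder hv hx)
  let N : LieSubmodule ℂ sl2 V :=
    { (⨆ i, ladder v i : Submodule ℂ V) with lie_mem := fun {y _} hx => hstable y hx }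
  have hvN : v ∈ N := Submodule.mem_iSup_of_mem 0 ⟨v, ⟨1, by simp⟩, rfl⟩
  exact (LieSubmodule.lieSpan_le (N := N)).2 (Set.singleton_subset_iff.2 hvN)

theorem iSup_ladder_eq_top {μ : ℂ} {v : V} (hv : v ∈ hWeightSpace V μ)
    (hgen : LieSubmodule.lieSpan ℂ sl2 {v} = ⊤) : ⨆ i, ladder v i = ⊤ :=
  top_unique <| le_of_eq_of_le (congrArg LieSubmodule.toSubmodule hgen).symm
    (lieSpan_singleton_le_iSup_ladder hv)

theorem exists_eq_add_of_mem_hWeightSpace {μ ν : ℂ} {v x : V} (hv : v ∈ hWeightSpace V μ)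
    (hgen : LieSubmodule.lieSpan ℂ sl2 {v} = ⊤) (hx : x ∈ hWeightSpace V ν) (hx0 : x ≠ 0) :
    ∃ i : ℤ, ν = μ + 2 * i := by
  by_contra! hne
  have hle : ⨆ i, ladder v i ≤ ⨆ (ρ) (_ : ρ ≠ ν), hWeightSpace V ρ :=
    iSup_le fun i => (ladder_le_hWeightSpace hv i).trans
      (le_iSup₂_of_le (μ + 2 * i) (hne i).symm le_rfl)
  rw [iSup_ladder_eq_top hv hgen] at hle
  exact hx0 (Submodule.disjoint_def.1 (iSupIndep_hWeightSpace ν) x hx (hle Submodule.mem_top))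

theorem hWeightSpace_eq_ladder {μ : ℂ} {v : V} (hv : v ∈ hWeightSpace V μ)
    (hgen : LieSubmodule.lieSpan ℂ sl2 {v} = ⊤) (i : ℤ) :
    hWeightSpace V (μ + 2 * i) = ladder v i := by
  have hinj : Function.Injective fun i : ℤ => μ + 2 * (i : ℂ) := fun i j hij => by simpa using hij
  have h := iSup_inf_eq_of_iSupIndep (iSupIndep_hWeightSpace.comp hinj)
    (ladder_le_hWeightSpace hv) i
  rwa [iSup_ladder_eq_top hv hgen, top_inf_eq] at h

theorem exists_aeval_casimir_apply_eq {μ : ℂ} {v x : V} (hv : v ∈ hWeightSpace V μ)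
    (hgen : LieSubmodule.lieSpan ℂ sl2 {v} = ⊤) (hx : x ∈ hWeightSpace V μ) :
    ∃ q : Polynomial ℂ, aeval (casimir V) q v = x := by
  have h0 : x ∈ ladder v 0 := by
    rw [← hWeightSpace_eq_ladder hv hgen]
    simpa using hx
  obtain ⟨y, hy, rfl⟩ := h0
  exact hy

end CyclicModules

/-! ### Big projective modules -/

section Enveloping

theorem env_induction {p : Env → Prop} (hc : ∀ c : ℂ, p (algebraMap ℂ Env c))
    (hι : ∀ x, p (envι x)) (hmul : ∀ u w, p u → p w → p (u * w))
    (hadd : ∀ u w, p u → p w → p (u + w)) (u : Env) : p u := by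
  let A : Subalgebra ℂ Env :=
    { carrier := {u | p u}
      mul_mem' := fun {u w} hu hw => hmul u w hu hw
      add_mem' := fun {u w} hu hw => hadd u w hu hw
      algebraMap_mem' := hc }
  let g : sl2 →ₗ⁅ℂ⁆ A :=
    { toFun := fun x => ⟨envι x, hι x⟩
      map_add' := fun x y => Subtype.ext (map_add envι x y)
      map_smul' := fun c x => Subtype.ext (map_smul envι c x)
      map_lie' := fun {x y} => Subtype.ext (envι_lie x y) }
  have hid : A.val.comp (UniversalEnvelopingAlgebra.lift ℂ g) = AlgHom.id ℂ Env := by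
    ext x
    exact congrArg A.val (UniversalEnvelopingAlgebra.lift_ι_apply ℂ g x)
  have hu : (UniversalEnvelopingAlgebra.lift ℂ g u : Env) = u := AlgHom.congr_fun hid u
  exact hu ▸ (UniversalEnvelopingAlgebra.lift ℂ g u).2

variable {V : Type} [AddCommGroup V] [Module ℂ V] [LieRingModule sl2 V] [LieModule ℂ sl2 V]

theorem enveloping_envι_eq_toEnd (x : sl2) : enveloping V (envι x) = toEnd ℂ sl2 V x :=
  LinearMap.ext fun v => enveloping_envι V x v

theorem enveloping_mem (N : LieSubmodule ℂ sl2 V) (u : Env) {v : V} (hv : v ∈ N) :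
    enveloping V u v ∈ N := by
  induction u using env_induction generalizing v with
  | hc c =>
    rw [AlgHom.commutes, Module.algebraMap_end_apply]
    exact N.smul_mem c hv
  | hι x =>
    rw [enveloping_envι]
    exact N.lie_mem hv
  | hmul u w hu hw =>
    rw [map_mul]
    exact hu (hw hv)
  | hadd u w hu hw =>
    rw [map_add]
    exact add_mem (hu hv) (hw hv)

/-- The Casimir element, normalised as `4fe + (h + 1)²`. -/
noncomputable def casimirElement : Env :=
  (4 : ℂ) • (envι sl2F * envι sl2E) + (envι sl2H + 1) ^ 2

theorem enveloping_casimirElement : enveloping V casimirElement = casimir V := by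
  simp only [casimirElement, casimir, map_add, map_smul, map_mul, map_pow, map_one,
    enveloping_envι_eq_toEnd]

end Enveloping

section BigProjective

/-- The relations imposed on the generator of a big projective module. -/
noncomputable def bigRelations (m : ℕ) : Set Env :=
  {envι sl2E ^ (m + 1), envι sl2H - algebraMap ℂ Env (-(m : ℂ) - 1),
    aeval casimirElement ((X - C ((m : ℂ) ^ 2)) ^ 2)}

/-- The projective cover in category `O` of the irreducible module of highest weight `-m - 1`,
presented by a generator of weight `-m - 1` killed by `e ^ (m + 1)` and by the square of `C - m²`,
where `C` is the Casimir element. -/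
def BigProjective (m : ℕ) : Type := Env ⧸ Submodule.span Env (bigRelations m)

variable (m : ℕ)

noncomputable instance : AddCommGroup (BigProjective m) :=
  inferInstanceAs (AddCommGroup (Env ⧸ Submodule.span Env (bigRelations m)))

noncomputable instance : Module Env (BigProjective m) :=
  inferInstanceAs (Module Env (Env ⧸ Submodule.span Env (bigRelations m)))

noncomputable instance : Module ℂ (BigProjective m) :=
  inferInstanceAs (Module ℂ (Env ⧸ Submodule.span Env (bigRelations m)))

instance : IsScalarTower ℂ Env (BigProjective m) :=
  inferInstanceAs (IsScalarTower ℂ Env (Env ⧸ Submodule.span Env (bigRelations m)))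

noncomputable instance : LieRingModule sl2 (BigProjective m) where
  bracket x z := envι x • z
  add_lie x y z := by rw [map_add, add_smul]
  lie_add x z w := smul_add _ z w
  leibniz_lie x y z := by
    change envι x • envι y • z = envι ⁅x, y⁆ • z + envι y • envι x • z
    rw [envι_lie, sub_smul, mul_smul, mul_smul, sub_add_cancel]

theorem bigProjective_lie_def (x : sl2) (z : BigProjective m) : ⁅x, z⁆ = envι x • z := rfl

instance : LieModule ℂ sl2 (BigProjective m) where
  smul_lie c x z := by rw [bigProjective_lie_def, map_smul, smul_assoc, bigProjective_lie_def]
  lie_smul c x z := by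
    rw [bigProjective_lie_def, bigProjective_lie_def, ← algebraMap_smul Env c z,
      ← algebraMap_smul Env c (envι x • z), ← mul_smul, ← mul_smul, Algebra.commutes]

/-- The canonical generator of the big projective module. -/
noncomputable def bigGenerator : BigProjective m :=
  (Submodule.span Env (bigRelations m)).mkQ 1

theorem enveloping_bigProjective_apply (u : Env) (z : BigProjective m) :
    enveloping (BigProjective m) u z = u • z := by
  induction u using env_induction generalizing z with
  | hc c => rw [AlgHom.commutes, Module.algebraMap_end_apply, algebraMap_smul]
  | hι x => rw [enveloping_envι, bigProjective_lie_def]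
  | hmul a b ha hb => rw [map_mul, Module.End.mul_apply, hb, ha, mul_smul]
  | hadd a b ha hb => rw [map_add, LinearMap.add_apply, hb, ha, add_smul]

theorem smul_bigGenerator (u : Env) :
    u • bigGenerator m = (Submodule.span Env (bigRelations m)).mkQ u := by
  rw [bigGenerator]
  refine (map_smul (Submodule.span Env (bigRelations m)).mkQ u 1).symm.trans ?_
  rw [smul_eq_mul, mul_one]

theorem lieSpan_bigGenerator : LieSubmodule.lieSpan ℂ sl2 {bigGenerator m} = ⊤ := by
  refine eq_top_iff.2 fun z _ => ?_
  obtain ⟨u, rfl⟩ := Submodule.mkQ_surjective (Submodule.span Env (bigRelations m)) z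
  rw [← smul_bigGenerator, ← enveloping_bigProjective_apply]
  exact enveloping_mem _ u (LieSubmodule.subset_lieSpan rfl)

variable {m}

theorem enveloping_bigGenerator_eq_zero {u : Env} (hu : u ∈ bigRelations m) :
    enveloping (BigProjective m) u (bigGenerator m) = 0 := by
  rw [enveloping_bigProjective_apply, smul_bigGenerator]
  exact (Submodule.Quotient.mk_eq_zero _).2 (Submodule.subset_span hu)

variable (m)

theorem bigGenerator_mem_hWeightSpace :
    bigGenerator m ∈ hWeightSpace (BigProjective m) (-(m : ℂ) - 1) := by
  have h := enveloping_bigGenerator_eq_zero (m := m) (Set.mem_insert_of_mem _ (.inl rfl))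
  rwa [map_sub, LinearMap.sub_apply, AlgHom.commutes, enveloping_envι,
    Module.algebraMap_end_apply, sub_eq_zero] at h

theorem e_pow_bigGenerator :
    (toEnd ℂ sl2 (BigProjective m) sl2E ^ (m + 1)) (bigGenerator m) = 0 := by
  have h := enveloping_bigGenerator_eq_zero (m := m) (Set.mem_insert _ _)
  rwa [map_pow, enveloping_envι_eq_toEnd] at h

theorem aeval_casimir_bigGenerator :
    aeval (casimir (BigProjective m)) ((X - C ((m : ℂ) ^ 2)) ^ 2) (bigGenerator m) = 0 := by
  have h := enveloping_bigGenerator_eq_zero (m := m)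
    (Set.mem_insert_of_mem _ (Set.mem_insert_of_mem _ rfl))
  rwa [← Polynomial.aeval_algHom_apply, enveloping_casimirElement] at h

variable {m} {V : Type} [AddCommGroup V] [Module ℂ V] [LieRingModule sl2 V] [LieModule ℂ sl2 V]

theorem enveloping_apply_eq_zero_of_mem_bigRelations {x : V}
    (hx : x ∈ hWeightSpace V (-(m : ℂ) - 1)) (he : (toEnd ℂ sl2 V sl2E ^ (m + 1)) x = 0)
    (hc : aeval (casimir V) ((X - C ((m : ℂ) ^ 2)) ^ 2) x = 0) {u : Env}
    (hu : u ∈ bigRelations m) : enveloping V u x = 0 := by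
  rcases hu with rfl | rfl | rfl
  · rw [map_pow, enveloping_envι_eq_toEnd, he]
  · have hx' : ⁅sl2H, x⁆ = (-(m : ℂ) - 1) • x := hx
    rw [map_sub, LinearMap.sub_apply, AlgHom.commutes, enveloping_envι,
      Module.algebraMap_end_apply, hx', sub_self]
  · rw [← Polynomial.aeval_algHom_apply, enveloping_casimirElement, hc]

theorem exists_hom_bigProjective {x : V} (hx : x ∈ hWeightSpace V (-(m : ℂ) - 1))
    (he : (toEnd ℂ sl2 V sl2E ^ (m + 1)) x = 0)
    (hc : aeval (casimir V) ((X - C ((m : ℂ) ^ 2)) ^ 2) x = 0) :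
    ∃ p : BigProjective m →ₗ⁅ℂ,sl2⁆ V, p (bigGenerator m) = x := by
  let : Module Env V := Module.compHom V (enveloping V).toRingHom
  have hsmul (u : Env) (y : V) : u • y = enveloping V u y := rfl
  let g : BigProjective m →ₗ[Env] V :=
    (Submodule.span Env (bigRelations m)).liftQ (LinearMap.toSpanSingleton Env V x)
      (Submodule.span_le.2 fun _ hu =>
        enveloping_apply_eq_zero_of_mem_bigRelations hx he hc hu)
  refine ⟨{ g with map_smul' := fun c z => ?_, map_lie' := fun {y z} => ?_ }, one_smul Env x⟩
  · change g (c • z) = c • g z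
    rw [← algebraMap_smul Env c z, map_smul, hsmul, AlgHom.commutes, Module.algebraMap_end_apply]
  · change g (envι y • z) = ⁅y, g z⁆
    rw [map_smul, hsmul, enveloping_envι]

end BigProjective

/-! ### Projective covers -/

section ProjectiveObjects

variable {P Q S : Type} [AddCommGroup P] [Module ℂ P] [LieRingModule sl2 P] [LieModule ℂ sl2 P]
  [AddCommGroup Q] [Module ℂ Q] [LieRingModule sl2 Q] [LieModule ℂ sl2 Q] [AddCommGroup S]
  [Module ℂ S] [LieRingModule sl2 S] [LieModule ℂ sl2 S]

theorem nonempty_equiv_of_superfluous (hP : IsProjectiveInO P) (hQ : IsProjectiveInO Q)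
    (hS : InCategoryO S) {p : P →ₗ⁅ℂ,sl2⁆ S} {q : Q →ₗ⁅ℂ,sl2⁆ S} (hp : Function.Surjective p)
    (hq : Function.Surjective q) (hpsup : ∀ N : LieSubmodule ℂ sl2 P, N ⊔ p.ker = ⊤ → N = ⊤)
    (hqsup : ∀ N : LieSubmodule ℂ sl2 Q, N ⊔ q.ker = ⊤ → N = ⊤) :
    Nonempty (Q ≃ₗ⁅ℂ,sl2⁆ P) := by
  obtain ⟨g, hg⟩ := hQ.2 P S hP.1 hS p q hp
  have hpg (x : Q) : p (g x) = q x := LieModuleHom.congr_fun hg x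
  have hgsurj : Function.Surjective g := by
    refine (LieModuleHom.range_eq_top g).1 (hpsup _ (range_sup_ker_eq_top fun y => ?_))
    obtain ⟨x, rfl⟩ := hq y
    exact ⟨x, hpg x⟩
  obtain ⟨s, hs⟩ := hP.2 Q P hQ.1 hP.1 g LieModuleHom.id hgsurj
  have hgs (y : P) : g (s y) = y := LieModuleHom.congr_fun hs y
  have hssurj : Function.Surjective s := by
    refine (LieModuleHom.range_eq_top s).1 (hqsup _ (range_sup_ker_eq_top fun y => ?_))
    obtain ⟨x, rfl⟩ := hp y
    exact ⟨x, by rw [Function.comp_apply, ← hpg, hgs]⟩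
  refine ⟨{ g with invFun := s, left_inv := fun x => ?_, right_inv := hgs }⟩
  obtain ⟨y, rfl⟩ := hssurj x
  exact congrArg s (hgs y)

end ProjectiveObjects

section HighestWeightVectors

variable {V W : Type} [AddCommGroup V] [Module ℂ V] [LieRingModule sl2 V] [LieModule ℂ sl2 V]
  [AddCommGroup W] [Module ℂ W] [LieRingModule sl2 W] [LieModule ℂ sl2 W]

theorem exists_lie_e_eq_zero_of_ne_bot (hV : InCategoryO V) {N : LieSubmodule ℂ sl2 V}
    (hN : N ≠ ⊥) : ∃ x ∈ N, x ≠ 0 ∧ ⁅sl2E, x⁆ = 0 ∧ ∃ μ, x ∈ hWeightSpace V μ := by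
  obtain ⟨μ, hμ⟩ : ∃ μ, (N : Submodule ℂ V) ⊓ hWeightSpace V μ ≠ ⊥ := by
    by_contra! h
    refine hN ((LieSubmodule.eq_bot_iff N).2 fun x hx => ?_)
    have hx' := mem_iSup_inf_hWeightSpace hV.iSup_hWeightSpace N hx
    rwa [iSup_eq_bot.2 h] at hx'
  obtain ⟨x, ⟨hxN, hxμ⟩, hx0⟩ := Submodule.exists_mem_ne_zero_of_ne_bot hμ
  obtain ⟨n, hn⟩ := hV.locallyNilpotent x
  induction n generalizing x μ with
  | zero => exact absurd hn hx0
  | succ n ih =>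
    by_cases he : ⁅sl2E, x⁆ = 0
    · exact ⟨x, hxN, hx0, he, μ, hxμ⟩
    · have hmem : ⁅sl2E, x⁆ ∈ (N : Submodule ℂ V) ⊓ hWeightSpace V (μ + 2) :=
        ⟨N.lie_mem hxN, hWeightSpace_e V hxμ⟩
      rw [pow_succ, Module.End.mul_apply] at hn
      exact ih _ (Submodule.ne_bot_iff _ |>.2 ⟨_, hmem, he⟩) _ he hmem.1 hmem.2 hn

theorem casimir_of_lie_e_eq_zero {μ : ℂ} {x : V} (hx : x ∈ hWeightSpace V μ)
    (he : ⁅sl2E, x⁆ = 0) : casimir V x = (μ + 1) ^ 2 • x := by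
  rw [casimir_of_mem_hWeightSpace hx, he, lie_zero, smul_zero, zero_add]

theorem mem_casimirBlock_of_lie_e_eq_zero {m : ℕ} {x : V}
    (hx : x ∈ hWeightSpace V (-(m : ℂ) - 1)) (he : ⁅sl2E, x⁆ = 0) :
    x ∈ casimirBlock V ((m : ℂ) ^ 2) := by
  have hcas := casimir_of_lie_e_eq_zero hx he
  rw [sub_add_cancel, neg_sq] at hcas
  exact Module.End.eigenspace_le_maxGenEigenspace (Module.End.mem_eigenspace_iff.2 hcas)

theorem aeval_casimir_of_lie_e_eq_zero {μ : ℂ} {x : V} (hx : x ∈ hWeightSpace V μ)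
    (he : ⁅sl2E, x⁆ = 0) (q : Polynomial ℂ) :
    aeval (casimir V) q x = q.eval ((μ + 1) ^ 2) • x := by
  rcases eq_or_ne x 0 with rfl | hx0
  · rw [map_zero, smul_zero]
  · exact Module.End.aeval_apply_of_hasEigenvector
      ⟨Module.End.mem_eigenspace_iff.2 (casimir_of_lie_e_eq_zero hx he), hx0⟩

theorem ladder_eq_bot_of_lie_e_eq_zero {v : V} (he : ⁅sl2E, v⁆ = 0) (n : ℕ) :
    ladder v (n + 1 : ℕ) = ⊥ := by
  refine (Submodule.eq_bot_iff _).2 ?_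
  rintro _ ⟨_, ⟨q, rfl⟩, rfl⟩
  change (toEnd ℂ sl2 V sl2E ^ (n + 1)) (aeval (casimir V) q v) = 0
  rw [pow_succ, Module.End.mul_apply, LieModule.toEnd_apply_apply, ← aeval_casimir_lie, he,
    map_zero, map_zero]

theorem weight_eq_of_lie_e_eq_zero {m : ℕ} {v x : V} {μ : ℂ}
    (hv : v ∈ hWeightSpace V (-(m : ℂ) - 1)) (hev : ⁅sl2E, v⁆ = 0)
    (hgen : LieSubmodule.lieSpan ℂ sl2 {v} = ⊤) (hx : x ∈ hWeightSpace V μ)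
    (hex : ⁅sl2E, x⁆ = 0) (hx0 : x ≠ 0) : μ = -(m : ℂ) - 1 := by
  have hblock : casimirBlock V ((m : ℂ) ^ 2) = ⊤ :=
    eq_top_of_mem_of_lieSpan_eq_top hgen (mem_casimirBlock_of_lie_e_eq_zero hv hev)
  obtain ⟨i, rfl⟩ := exists_eq_add_of_mem_hWeightSpace hv hgen hx hx0
  obtain ⟨j, hj, hsq⟩ := exists_eq_sq_of_mem_casimirBlock (n := 1) hx0 hx
    ((pow_one (toEnd ℂ sl2 V sl2E)).symm ▸ hex) (hblock ▸ LieSubmodule.mem_top x)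
  obtain rfl : j = 0 := by omega
  have hi0 : i ≤ 0 := by
    by_contra! hi
    obtain ⟨n, rfl⟩ : ∃ n : ℕ, i = (n + 1 : ℕ) := ⟨(i - 1).toNat, by omega⟩
    rw [hWeightSpace_eq_ladder hv hgen, ladder_eq_bot_of_lie_e_eq_zero hev] at hx
    exact hx0 hx
  have hmul : (i : ℂ) * (i - m) = 0 := by push_cast at hsq; linear_combination -hsq / 4
  obtain rfl : i = 0 := by
    rcases mul_eq_zero.1 (show i * (i - m) = 0 by exact_mod_cast hmul) with hi | hi <;> omega
  simp

theorem isIrreducible_of_lie_e_eq_zero {m : ℕ} {v : V} (hv0 : v ≠ 0)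
    (hv : v ∈ hWeightSpace V (-(m : ℂ) - 1)) (hev : ⁅sl2E, v⁆ = 0)
    (hgen : LieSubmodule.lieSpan ℂ sl2 {v} = ⊤) : LieModule.IsIrreducible ℂ sl2 V := by
  have : Nontrivial V := ⟨v, 0, hv0⟩
  have hO : InCategoryO V :=
    inCategoryO_of_lieSpan_eq_top (n := 1) hv ((pow_one (toEnd ℂ sl2 V sl2E)).symm ▸ hev) hgen
  refine LieModule.IsIrreducible.mk fun N hN => eq_top_of_mem_of_lieSpan_eq_top hgen ?_
  obtain ⟨x, hxN, hx0, hex, μ, hx⟩ := exists_lie_e_eq_zero_of_ne_bot hO hN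
  obtain rfl := weight_eq_of_lie_e_eq_zero hv hev hgen hx hex hx0
  obtain ⟨q, rfl⟩ := exists_aeval_casimir_apply_eq hv hgen hx
  rw [aeval_casimir_of_lie_e_eq_zero hv hev] at hxN hx0
  exact ((N : Submodule ℂ V).smul_mem_iff (left_ne_zero_of_smul hx0)).1 hxN

theorem exists_mem_casimirBlock_of_map_mem (p : V →ₗ⁅ℂ,sl2⁆ W) {μ c : ℂ} {n : ℕ} {x : V}
    (hx : x ∈ hWeightSpace V μ) (hn : (toEnd ℂ sl2 V sl2E ^ n) x = 0)
    (hpx : p x ∈ casimirBlock W c) :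
    ∃ y ∈ hWeightSpace V μ, y ∈ casimirBlock V c ∧ p y = p x := by
  obtain ⟨y, ⟨hyμ, hyc⟩, hy⟩ := exists_mem_map_eq_of_mem_iSup
    (A := fun c => hWeightSpace V μ ⊓ (casimir V).maxGenEigenspace c)
    (casimir W).independent_maxGenEigenspace (p : V →ₗ[ℂ] W)
    (fun _ _ hz => map_mem_casimirBlock p hz.2)
    (mem_iSup_inf_maxGenEigenspace (hWeightSpace_le_comap_casimir μ)
      (casimirPolynomial_ne_zero μ n) hx (aeval_casimirPolynomial_apply_eq_zero hx hn)) hpx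
  exact ⟨y, hyμ, hyc, hy⟩

end HighestWeightVectors

section BigProjectiveCover

variable {V : Type} [AddCommGroup V] [Module ℂ V] [LieRingModule sl2 V] [LieModule ℂ sl2 V]

theorem casimirBlock_bigProjective (m : ℕ) : casimirBlock (BigProjective m) ((m : ℂ) ^ 2) = ⊤ :=
  eq_top_of_mem_of_lieSpan_eq_top (lieSpan_bigGenerator m)
    (mem_casimirBlock_of_aeval_apply_eq_zero (aeval_casimir_bigGenerator m))

theorem exists_hom_bigProjective_of_mem_casimirBlock {m n : ℕ} {x : V}
    (hx : x ∈ hWeightSpace V (-(m : ℂ) - 1)) (hn : (toEnd ℂ sl2 V sl2E ^ n) x = 0)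
    (hc : x ∈ casimirBlock V ((m : ℂ) ^ 2)) :
    ∃ p : BigProjective m →ₗ⁅ℂ,sl2⁆ V, p (bigGenerator m) = x :=
  exists_hom_bigProjective hx (e_pow_apply_eq_zero_of_mem_casimirBlock hx hn hc)
    (aeval_casimir_sq_apply_eq_zero hx hn hc)

theorem exists_hom_bigProjective_of_lie_e_eq_zero {m : ℕ} {x : V}
    (hx : x ∈ hWeightSpace V (-(m : ℂ) - 1)) (he : ⁅sl2E, x⁆ = 0) :
    ∃ p : BigProjective m →ₗ⁅ℂ,sl2⁆ V, p (bigGenerator m) = x :=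
  exists_hom_bigProjective_of_mem_casimirBlock (n := 1) hx
    ((pow_one (toEnd ℂ sl2 V sl2E)).symm ▸ he) (mem_casimirBlock_of_lie_e_eq_zero hx he)

theorem bigProjective_inCategoryO (m : ℕ) : InCategoryO (BigProjective m) :=
  inCategoryO_of_lieSpan_eq_top (bigGenerator_mem_hWeightSpace m) (e_pow_bigGenerator m)
    (lieSpan_bigGenerator m)

theorem bigProjective_isProjectiveInO (m : ℕ) : IsProjectiveInO (BigProjective m) := by
  refine ⟨bigProjective_inCategoryO m, ?_⟩
  intro M N _ _ _ _ _ _ _ _ hM _ p k hp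
  obtain ⟨x, hx, hpx⟩ := exists_mem_hWeightSpace_of_map_eq hM.iSup_hWeightSpace hp
    (map_mem_hWeightSpace k (bigGenerator_mem_hWeightSpace m))
  have hkc : k (bigGenerator m) ∈ casimirBlock N ((m : ℂ) ^ 2) :=
    map_mem_casimirBlock k (casimirBlock_bigProjective m ▸ LieSubmodule.mem_top _)
  obtain ⟨n, hn⟩ := hM.locallyNilpotent x
  obtain ⟨y, hy, hyc, hpy⟩ := exists_mem_casimirBlock_of_map_mem p hx hn (hpx ▸ hkc)
  obtain ⟨n, hn⟩ := hM.locallyNilpotent y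
  obtain ⟨k', hk'⟩ := exists_hom_bigProjective_of_mem_casimirBlock hy hn hyc
  refine ⟨k', hom_ext_of_lieSpan_eq_top (lieSpan_bigGenerator m) ?_⟩
  rw [LieModuleHom.comp_apply, hk', hpy, hpx]

theorem bigProjective_superfluous {m : ℕ} (q : BigProjective m →ₗ⁅ℂ,sl2⁆ V)
    (hne : q (bigGenerator m) ≠ 0) (he : ⁅sl2E, q (bigGenerator m)⁆ = 0)
    (N : LieSubmodule ℂ sl2 (BigProjective m)) (hN : N ⊔ q.ker = ⊤) : N = ⊤ := by
  have hv := bigGenerator_mem_hWeightSpace m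
  obtain ⟨x, hx, y, hy, hxw, -, hxy⟩ := exists_add_eq_of_mem_sup
    (bigProjective_inCategoryO m).iSup_hWeightSpace
    (hN ▸ LieSubmodule.mem_top (bigGenerator m)) hv
  obtain ⟨r, rfl⟩ := exists_aeval_casimir_apply_eq hv (lieSpan_bigGenerator m) hxw
  have hqx : q (bigGenerator m) = r.eval ((m : ℂ) ^ 2) • q (bigGenerator m) := by
    have heval := aeval_casimir_of_lie_e_eq_zero (map_mem_hWeightSpace q hv) he r
    rw [sub_add_cancel, neg_sq] at heval
    rw [← heval, ← map_aeval_casimir]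
    conv_lhs => rw [← hxy, map_add, LieModuleHom.mem_ker.1 hy, add_zero]
  have hr : r.eval ((m : ℂ) ^ 2) ≠ 0 := left_ne_zero_of_smul (hqx ▸ hne)
  obtain ⟨s, hs⟩ := exists_aeval_mul_apply_eq_self hr
    (casimirBlock_bigProjective m ▸ LieSubmodule.mem_top (bigGenerator m) :
      bigGenerator m ∈ casimirBlock _ ((m : ℂ) ^ 2))
  rw [map_mul, Module.End.mul_apply] at hs
  exact eq_top_of_mem_of_lieSpan_eq_top (lieSpan_bigGenerator m)
    (hs ▸ aeval_casimir_mem N s hx)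

theorem isProjectiveCover_bigProjective {m : ℕ} {v : V} (hv0 : v ≠ 0)
    (hv : v ∈ hWeightSpace V (-(m : ℂ) - 1)) (hev : ⁅sl2E, v⁆ = 0) :
    IsProjectiveCover (BigProjective m) (-(m : ℂ) - 1) := by
  let S := LieSubmodule.lieSpan ℂ sl2 {v}
  let z : S := ⟨v, LieSubmodule.subset_lieSpan rfl⟩
  have hz0 : z ≠ 0 := fun h => hv0 (congrArg Subtype.val h)
  have hz : z ∈ hWeightSpace S (-(m : ℂ) - 1) := Subtype.ext hv
  have hez : ⁅sl2E, z⁆ = 0 := Subtype.ext hev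
  have hgen : LieSubmodule.lieSpan ℂ sl2 {z} = ⊤ := lieSpan_singleton_mk_eq_top v
  obtain ⟨q, hq⟩ := exists_hom_bigProjective_of_lie_e_eq_zero hz hez
  refine ⟨bigProjective_isProjectiveInO m, S, _, _, _, inferInstance, q,
    ⟨isIrreducible_of_lie_e_eq_zero hz0 hz hez hgen, z, hz0, hez, hz⟩, ?_,
    bigProjective_superfluous q (hq ▸ hz0) (hq ▸ hez)⟩
  exact (LieModuleHom.range_eq_top q).1 (eq_top_of_mem_of_lieSpan_eq_top hgen ⟨_, hq⟩)

theorem nonempty_equiv_bigProjective {m : ℕ} (hV : IsProjectiveCover V (-(m : ℂ) - 1)) :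
    Nonempty (BigProjective m ≃ₗ⁅ℂ,sl2⁆ V) := by
  obtain ⟨hproj, S, _, _, _, _, p, ⟨hirr, z, hz0, hez, hz⟩, hp, hsup⟩ := hV
  obtain ⟨q, hq⟩ := exists_hom_bigProjective_of_lie_e_eq_zero hz hez
  have htop {N : LieSubmodule ℂ sl2 S} (hN : z ∈ N) : N = ⊤ := by
    refine (IsSimpleOrder.eq_bot_or_eq_top N).resolve_left ?_
    rintro rfl
    exact hz0 ((LieSubmodule.mem_bot z).1 hN)
  have hS : InCategoryO S :=
    inCategoryO_of_lieSpan_eq_top (n := 1) hz ((pow_one (toEnd ℂ sl2 S sl2E)).symm ▸ hez)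
      (htop (LieSubmodule.subset_lieSpan rfl))
  exact nonempty_equiv_of_superfluous hproj (bigProjective_isProjectiveInO m) hS hp
    ((LieModuleHom.range_eq_top q).1 (htop ⟨bigGenerator m, hq⟩)) hsup
    (bigProjective_superfluous q (hq ▸ hz0) (hq ▸ hez))

end BigProjectiveCover

/-! ### Regular functions on the big cell -/

section RegularFunctions

theorem evalAt_X (g : SL(2, ℂ)) (ij : Fin 2 × Fin 2) :
    evalAt g (MvPolynomial.X ij) = g ij.1 ij.2 :=
  MvPolynomial.aeval_X _ ij

theorem det_eq_one (g : SL(2, ℂ)) : g 0 0 * g 1 1 - g 0 1 * g 1 0 = 1 :=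
  (Matrix.det_fin_two g.1).symm.trans g.det_coe

theorem lowerLeft_ne_zero (g : bigCell) : (g : SL(2, ℂ)) 1 0 ≠ 0 := (mem_bigCell_iff _).1 g.2

theorem evalAt_lowerLeft_pow_ne_zero (N : ℕ) (g : bigCell) :
    evalAt g (MvPolynomial.X (1, 0) ^ N) ≠ 0 := by
  rw [map_pow, evalAt_X]
  exact pow_ne_zero N (lowerLeft_ne_zero g)

theorem isRegular_of_div {ψ : bigCell → ℂ} {p q : MvPolynomial (Fin 2 × Fin 2) ℂ}
    (hq : ∀ k : bigCell, evalAt k q ≠ 0)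
    (hpq : ∀ k : bigCell, ψ k = evalAt k p / evalAt k q) : IsRegular ψ :=
  fun g => ⟨p, q, hq g, fun k _ => hpq k⟩

/-- The function `a^i d^j c^n` on the big cell, where `a`, `c`, `d` are the upper left, lower left
and lower right matrix entries; `c` is invertible there, so `n` may be negative. -/
noncomputable def monomialFun (i j : ℕ) (n : ℤ) (g : bigCell) : ℂ :=
  (g : SL(2, ℂ)) 0 0 ^ i * (g : SL(2, ℂ)) 1 1 ^ j * (g : SL(2, ℂ)) 1 0 ^ n

theorem monomialFun_eq_div (i j k N : ℕ) (g : bigCell) :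
    monomialFun i j ((k : ℤ) - N) g =
      evalAt g (MvPolynomial.X (0, 0) ^ i * MvPolynomial.X (1, 1) ^ j *
        MvPolynomial.X (1, 0) ^ k) / evalAt g (MvPolynomial.X (1, 0) ^ N) := by
  simp only [monomialFun, map_mul, map_pow, evalAt_X]
  rw [zpow_sub₀ (lowerLeft_ne_zero g), zpow_natCast, zpow_natCast]
  ring

theorem exists_eq_natCast_sub_natCast (n : ℤ) : ∃ k N : ℕ, n = (k : ℤ) - N :=
  ⟨n.toNat, (-n).toNat, by omega⟩

/-- The function `a^i d^j c^n` as an element of `R(G₀)`. -/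
noncomputable def monomialReg (i j : ℕ) (n : ℤ) : regularFunctions :=
  ⟨monomialFun i j n, by
    obtain ⟨k, N, rfl⟩ := exists_eq_natCast_sub_natCast n
    exact isRegular_of_div (evalAt_lowerLeft_pow_ne_zero N) (monomialFun_eq_div i j k N)⟩

theorem monomialReg_apply (i j : ℕ) (n : ℤ) (g : bigCell) :
    (monomialReg i j n : bigCell → ℂ) g =
      (g : SL(2, ℂ)) 0 0 ^ i * (g : SL(2, ℂ)) 1 1 ^ j * (g : SL(2, ℂ)) 1 0 ^ n := rfl

/-- The velocity at `t = 0` of the curve `exp (-t x) g exp (t y)`, where `a = (x, y)`. -/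
def velocity (a : sl2 × sl2) (g : SL(2, ℂ)) : Matrix (Fin 2) (Fin 2) ℂ :=
  -((a.1 : Matrix (Fin 2) (Fin 2) ℂ) * g.1) + g.1 * (a.2 : Matrix (Fin 2) (Fin 2) ℂ)

theorem lie_monomialReg_apply (x : sl2 × sl2) (i j : ℕ) (n : ℤ) (g : bigCell) :
    (⁅x, monomialReg i j n⁆ : regularFunctions).1 g =
      i * velocity x g 0 0 * (monomialReg (i - 1) j n : bigCell → ℂ) g +
      j * velocity x g 1 1 * (monomialReg i (j - 1) n : bigCell → ℂ) g +
      n * velocity x g 1 0 * (monomialReg i j (n - 1) : bigCell → ℂ) g := by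
  obtain ⟨k, N, rfl⟩ := exists_eq_natCast_sub_natCast n
  refine (regAct_eq x (fun g _ => monomialFun_eq_div i j k N g) g
    (evalAt_lowerLeft_pow_ne_zero N g)).trans ?_
  simp only [Derivation.leibniz, Derivation.leibniz_pow, smul_eq_mul, nsmul_eq_mul, map_add,
    map_mul, map_sub, map_pow, map_natCast, evalAt_vf_X, evalAt_X, monomialReg_apply]
  have hc := lowerLeft_ne_zero g
  rw [zpow_sub_one₀ hc, zpow_sub₀ hc, zpow_natCast, zpow_natCast, ← velocity]
  generalize velocity x g = D
  generalize (g : SL(2, ℂ)) 1 0 = c at *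
  push_cast
  rcases k with _ | k <;> rcases N with _ | N <;>
    simp only [Nat.add_sub_cancel, Nat.zero_sub, Nat.cast_zero, Nat.cast_add, Nat.cast_one,
      pow_zero] <;> field_simp <;> ring

theorem velocity_e_left (g : SL(2, ℂ)) : velocity (sl2E, 0) g = !![-g 1 0, -g 1 1; 0, 0] := by
  ext i j
  fin_cases i <;> fin_cases j <;> simp [velocity, sl2E, Matrix.vecMul, dotProduct]

theorem velocity_h_left (g : SL(2, ℂ)) :
    velocity (sl2H, 0) g = !![-g 0 0, -g 0 1; g 1 0, g 1 1] := by
  ext i j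
  fin_cases i <;> fin_cases j <;> simp [velocity, sl2H, Matrix.vecMul, dotProduct]

theorem velocity_e_right (g : SL(2, ℂ)) : velocity (0, sl2E) g = !![0, g 0 0; 0, g 1 0] := by
  ext i j
  fin_cases i <;> fin_cases j <;> simp [velocity, sl2E, Matrix.mul_apply, Fin.sum_univ_two]

theorem velocity_h_right (g : SL(2, ℂ)) :
    velocity (0, sl2H) g = !![g 0 0, -g 0 1; g 1 0, -g 1 1] := by
  ext i j
  fin_cases i <;> fin_cases j <;> simp [velocity, sl2H, Matrix.mul_apply, Fin.sum_univ_two]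

theorem natCast_mul_pow_sub_one_mul (n : ℕ) (x : ℂ) : (n : ℂ) * (x ^ (n - 1) * x) = n * x ^ n := by
  rcases n with _ | n
  · simp
  · rw [Nat.add_sub_cancel, pow_succ]

theorem lie_e_monomialReg (i j : ℕ) (n : ℤ) :
    ⁅((sl2E, 0) : sl2 × sl2), monomialReg i j n⁆ = (-(i : ℂ)) • monomialReg (i - 1) j (n + 1) := by
  ext g
  refine (lie_monomialReg_apply _ i j n g).trans ?_
  rw [velocity_e_left]
  simp [monomialReg_apply, zpow_add_one₀ (lowerLeft_ne_zero g)]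
  ring

theorem lie_h_monomialReg (i j : ℕ) (n : ℤ) :
    ⁅((sl2H, 0) : sl2 × sl2), monomialReg i j n⁆ = ((n : ℂ) + j - i) • monomialReg i j n := by
  ext g
  refine (lie_monomialReg_apply _ i j n g).trans ?_
  have hc := lowerLeft_ne_zero g
  simp only [velocity_h_left, Matrix.of_apply, Matrix.cons_val', Matrix.cons_val_zero,
    Matrix.cons_val_one, Matrix.cons_val_fin_one, SetLike.val_smul, Pi.smul_apply, smul_eq_mul,
    monomialReg_apply, zpow_sub_one₀ hc]
  linear_combination
    (-g.1 1 1 ^ j * g.1 1 0 ^ n) * natCast_mul_pow_sub_one_mul i (g.1 0 0) +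
    (g.1 0 0 ^ i * g.1 1 0 ^ n) * natCast_mul_pow_sub_one_mul j (g.1 1 1) +
    (n * g.1 0 0 ^ i * g.1 1 1 ^ j * g.1 1 0 ^ n) * mul_inv_cancel₀ hc

theorem lie_e_monomialReg_right (i j : ℕ) (n : ℤ) :
    ⁅((0, sl2E) : sl2 × sl2), monomialReg i j n⁆ = (j : ℂ) • monomialReg i (j - 1) (n + 1) := by
  ext g
  refine (lie_monomialReg_apply _ i j n g).trans ?_
  rw [velocity_e_right]
  simp [monomialReg_apply, zpow_add_one₀ (lowerLeft_ne_zero g)]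
  ring

theorem lie_h_monomialReg_right (i j : ℕ) (n : ℤ) :
    ⁅((0, sl2H) : sl2 × sl2), monomialReg i j n⁆ = ((n : ℂ) + i - j) • monomialReg i j n := by
  ext g
  refine (lie_monomialReg_apply _ i j n g).trans ?_
  have hc := lowerLeft_ne_zero g
  simp only [velocity_h_right, Matrix.of_apply, Matrix.cons_val', Matrix.cons_val_zero,
    Matrix.cons_val_one, Matrix.cons_val_fin_one, SetLike.val_smul, Pi.smul_apply, smul_eq_mul,
    monomialReg_apply, zpow_sub_one₀ hc]
  linear_combination
    (g.1 1 1 ^ j * g.1 1 0 ^ n) * natCast_mul_pow_sub_one_mul i (g.1 0 0) +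
    (-g.1 0 0 ^ i * g.1 1 0 ^ n) * natCast_mul_pow_sub_one_mul j (g.1 1 1) +
    (n * g.1 0 0 ^ i * g.1 1 1 ^ j * g.1 1 0 ^ n) * mul_inv_cancel₀ hc

/-- The ideal of the polynomials that are global denominators of `ψ`. -/
def denominatorIdeal (ψ : bigCell → ℂ) : Ideal (MvPolynomial (Fin 2 × Fin 2) ℂ) where
  carrier := {s | ∃ p, ∀ g : bigCell, evalAt g s * ψ g = evalAt g p}
  add_mem' := by
    rintro s t ⟨p, hp⟩ ⟨q, hq⟩
    exact ⟨p + q, fun g => by rw [map_add, map_add, add_mul, hp, hq]⟩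
  zero_mem' := ⟨0, fun g => by rw [map_zero, zero_mul]⟩
  smul_mem' := by
    rintro r s ⟨p, hp⟩
    exact ⟨r * p, fun g => by rw [smul_eq_mul, map_mul, map_mul, mul_assoc, hp]⟩

theorem det_sub_one_mem_denominatorIdeal (ψ : bigCell → ℂ) :
    MvPolynomial.X (0, 0) * MvPolynomial.X (1, 1) -
      MvPolynomial.X (0, 1) * MvPolynomial.X (1, 0) - 1 ∈ denominatorIdeal ψ :=
  ⟨0, fun g => by
    simp only [map_sub, map_mul, evalAt_X, map_one, map_zero]
    rw [det_eq_one, sub_self, zero_mul]⟩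

theorem sq_mem_denominatorIdeal {ψ : bigCell → ℂ} {p q : MvPolynomial (Fin 2 × Fin 2) ℂ}
    (hpq : ∀ k : bigCell, evalAt k q ≠ 0 → ψ k = evalAt k p / evalAt k q) :
    q ^ 2 ∈ denominatorIdeal ψ := by
  refine ⟨p * q, fun k => ?_⟩
  rw [map_pow, map_mul]
  by_cases hk : evalAt k q = 0
  · rw [hk]
    ring
  · rw [hpq k hk]
    field_simp

/-- By the Nullstellensatz: the zero locus of the denominator ideal lies in `SL(2, ℂ)`, and misses
the big cell since every point there has a local denominator. -/
theorem lowerLeft_mem_radical_denominatorIdeal {ψ : bigCell → ℂ} (hψ : IsRegular ψ) :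
    MvPolynomial.X (1, 0) ∈ (denominatorIdeal ψ).radical := by
  rw [← MvPolynomial.vanishingIdeal_zeroLocus_eq_radical (K := ℂ),
    MvPolynomial.mem_vanishingIdeal_iff]
  intro x hx
  rw [MvPolynomial.mem_zeroLocus_iff] at hx
  rw [MvPolynomial.aeval_X]
  by_contra hne
  have hdet : x (0, 0) * x (1, 1) - x (0, 1) * x (1, 0) = 1 := by
    simpa [sub_eq_zero] using hx _ (det_sub_one_mem_denominatorIdeal ψ)
  let g : SL(2, ℂ) := ⟨Matrix.of fun i j => x (i, j), (Matrix.det_fin_two _).trans hdet⟩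
  obtain ⟨p, q, hq, hpq⟩ := hψ ⟨g, (mem_bigCell_iff g).2 hne⟩
  have hq2 : evalAt g (q ^ 2) = 0 := hx _ (sq_mem_denominatorIdeal hpq)
  rw [map_pow] at hq2
  exact hq (pow_eq_zero_iff two_ne_zero |>.1 hq2)

theorem exists_pow_mul_eq_evalAt {ψ : bigCell → ℂ} (hψ : IsRegular ψ) :
    ∃ (p : MvPolynomial (Fin 2 × Fin 2) ℂ) (N : ℕ),
      ∀ g : bigCell, (g : SL(2, ℂ)) 1 0 ^ N * ψ g = evalAt g p := by
  obtain ⟨N, p, hp⟩ := lowerLeft_mem_radical_denominatorIdeal hψ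
  exact ⟨p, N, fun g => by rw [← hp g, map_pow, evalAt_X]⟩

/-- The matrix entries as elements of `R(G₀)`. -/
def entry (ij : Fin 2 × Fin 2) : regularFunctions :=
  ⟨fun g => (g : SL(2, ℂ)) ij.1 ij.2,
    isRegular_of_div (p := MvPolynomial.X ij) (q := 1) (by simp) (by simp [evalAt_X])⟩

theorem entry_apply (ij : Fin 2 × Fin 2) (g : bigCell) :
    (entry ij : bigCell → ℂ) g = (g : SL(2, ℂ)) ij.1 ij.2 := rfl

theorem aeval_entry_apply (p : MvPolynomial (Fin 2 × Fin 2) ℂ) (g : bigCell) :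
    (MvPolynomial.aeval entry p : bigCell → ℂ) g = evalAt g p := by
  let ev : regularFunctions →ₐ[ℂ] ℂ := (Pi.evalAlgHom ℂ (fun _ => ℂ) g).comp regularFunctions.val
  exact DFunLike.congr_fun (MvPolynomial.comp_aeval entry ev) p

theorem entry_mul_monomialReg_mem_span (ij : Fin 2 × Fin 2) (i j : ℕ) (n : ℤ) :
    entry ij * monomialReg i j n ∈
      Submodule.span ℂ (Set.range fun t : ℕ × ℕ × ℤ => monomialReg t.1 t.2.1 t.2.2) := by
  have hmem (i j n) : monomialReg i j n ∈ Submodule.span ℂ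
      (Set.range fun t : ℕ × ℕ × ℤ => monomialReg t.1 t.2.1 t.2.2) :=
    Submodule.subset_span ⟨(i, j, n), rfl⟩
  match ij with
  | (0, 0) =>
    convert hmem (i + 1) j n
    ext g
    rw [Subalgebra.coe_mul, Pi.mul_apply, entry_apply,
      monomialReg_apply, monomialReg_apply, pow_succ]
    ring
  | (0, 1) =>
    convert sub_mem (hmem (i + 1) (j + 1) (n - 1)) (hmem i j (n - 1))
    ext g
    have hc := lowerLeft_ne_zero g
    simp only [Subalgebra.coe_mul, Subalgebra.coe_sub, Pi.mul_apply, Pi.sub_apply,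
      entry_apply, monomialReg_apply, zpow_sub_one₀ hc]
    field_simp
    linear_combination (-((g : SL(2, ℂ)) 0 0 ^ i * (g : SL(2, ℂ)) 1 1 ^ j)) * det_eq_one g
  | (1, 0) =>
    convert hmem i j (n + 1)
    ext g
    rw [Subalgebra.coe_mul, Pi.mul_apply, entry_apply,
      monomialReg_apply, monomialReg_apply, zpow_add_one₀ (lowerLeft_ne_zero g)]
    ring
  | (1, 1) =>
    convert hmem i (j + 1) n
    ext g
    rw [Subalgebra.coe_mul, Pi.mul_apply, entry_apply,
      monomialReg_apply, monomialReg_apply, pow_succ]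
    ring

theorem span_monomialReg :
    Submodule.span ℂ (Set.range fun t : ℕ × ℕ × ℤ => monomialReg t.1 t.2.1 t.2.2) = ⊤ := by
  let S := Submodule.span ℂ (Set.range fun t : ℕ × ℕ × ℤ => monomialReg t.1 t.2.1 t.2.2)
  have hentry (ij : Fin 2 × Fin 2) : S ≤ S.comap (LinearMap.mulLeft ℂ (entry ij)) := by
    refine Submodule.span_le.2 ?_
    rintro _ ⟨t, rfl⟩
    exact entry_mul_monomialReg_mem_span ij _ _ _
  have hpoly (p : MvPolynomial (Fin 2 × Fin 2) ℂ) {ψ} (hψ : ψ ∈ S) :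
      MvPolynomial.aeval entry p * ψ ∈ S := by
    induction p using MvPolynomial.induction_on with
    | C a => rw [MvPolynomial.aeval_C, ← Algebra.smul_def]; exact S.smul_mem a hψ
    | add p q hp hq => rw [map_add, add_mul]; exact S.add_mem hp hq
    | mul_X p ij hp =>
      rw [mul_comm p, map_mul, MvPolynomial.aeval_X, mul_assoc]
      exact hentry ij hp
  refine eq_top_iff.2 fun ψ _ => ?_
  obtain ⟨p, N, hp⟩ := exists_pow_mul_eq_evalAt ψ.2
  convert hpoly p (Submodule.subset_span ⟨(0, 0, -(N : ℤ)), rfl⟩)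
  ext g
  have hc := lowerLeft_ne_zero g
  rw [Subalgebra.coe_mul, Pi.mul_apply, aeval_entry_apply, ← hp, monomialReg_apply, pow_zero,
    pow_zero, zpow_neg, zpow_natCast]
  field_simp

theorem eq_top_of_forall_monomialReg_mem {S : Submodule ℂ regularFunctions}
    (hS : ∀ i j n, monomialReg i j n ∈ S) : S = ⊤ := by
  rw [eq_top_iff, ← span_monomialReg, Submodule.span_le]
  rintro _ ⟨t, rfl⟩
  exact hS _ _ _

theorem monomialReg_mem_maxGenEigenspace_e_left (i j : ℕ) (n : ℤ) :
    monomialReg i j n ∈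
      (toEnd ℂ (sl2 × sl2) regularFunctions (sl2E, 0)).maxGenEigenspace 0 := by
  induction i generalizing n with
  | zero =>
    refine mem_maxGenEigenspace_zero_of_apply_mem ?_
    rw [LieModule.toEnd_apply_apply, lie_e_monomialReg, Nat.cast_zero, neg_zero, zero_smul]
    exact zero_mem _
  | succ i ih =>
    refine mem_maxGenEigenspace_zero_of_apply_mem ?_
    rw [LieModule.toEnd_apply_apply, lie_e_monomialReg]
    exact Submodule.smul_mem _ _ (ih _)

theorem monomialReg_mem_maxGenEigenspace_e_right (i j : ℕ) (n : ℤ) :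
    monomialReg i j n ∈
      (toEnd ℂ (sl2 × sl2) regularFunctions (0, sl2E)).maxGenEigenspace 0 := by
  induction j generalizing n with
  | zero =>
    refine mem_maxGenEigenspace_zero_of_apply_mem ?_
    rw [LieModule.toEnd_apply_apply, lie_e_monomialReg_right, Nat.cast_zero, zero_smul]
    exact zero_mem _
  | succ j ih =>
    refine mem_maxGenEigenspace_zero_of_apply_mem ?_
    rw [LieModule.toEnd_apply_apply, lie_e_monomialReg_right]
    exact Submodule.smul_mem _ _ (ih _)

end RegularFunctions

/-! ### The map to functionals on the enveloping algebra -/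

section Vartheta

/-- The left action of `sl2` on `𝓤(𝔤)'`, so that the results on `sl2`-modules apply to it. -/
noncomputable instance dualLieRingModule : LieRingModule sl2 (Module.Dual ℂ Env) :=
  LieRingModule.compLieHom _ (LieHom.inl ℂ sl2 sl2)

instance dualLieModule : LieModule ℂ sl2 (Module.Dual ℂ Env) :=
  LieModule.compLieHom _ (LieHom.inl ℂ sl2 sl2)

theorem lie_left_eq (x : sl2) (φ : Module.Dual ℂ Env) : ⁅((x, 0) : sl2 × sl2), φ⁆ = ⁅x, φ⁆ := rfl

theorem lie_left_apply (x : sl2) (φ : Module.Dual ℂ Env) (u : Env) :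
    ⁅x, φ⁆ u = φ (u * envι x) := by
  change dualAct (x, 0) φ u = _
  rw [dualAct_apply]
  simp

theorem lie_right_apply (y : sl2) (φ : Module.Dual ℂ Env) (u : Env) :
    ⁅((0, y) : sl2 × sl2), φ⁆ u = -φ (envι (omega y) * u) := by
  change dualAct (0, y) φ u = _
  rw [dualAct_apply]
  simp

theorem lie_right_lie_left (x y : sl2) (φ : Module.Dual ℂ Env) :
    ⁅((0, y) : sl2 × sl2), ⁅x, φ⁆⁆ = ⁅x, ⁅((0, y) : sl2 × sl2), φ⁆⁆ := by
  ext u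
  rw [lie_right_apply, lie_left_apply, lie_left_apply, lie_right_apply, mul_assoc]

theorem enveloping_dual_apply (u w : Env) (φ : Module.Dual ℂ Env) :
    enveloping (Module.Dual ℂ Env) u φ w = φ (w * u) := by
  induction u using env_induction generalizing φ w with
  | hc c =>
    rw [AlgHom.commutes, Module.algebraMap_end_apply, LinearMap.smul_apply, ← map_smul,
      Algebra.smul_def, Algebra.commutes]
  | hι x => rw [enveloping_envι, lie_left_apply]
  | hmul a b ha hb => rw [map_mul, Module.End.mul_apply, ha, hb, mul_assoc]
  | hadd a b ha hb =>
    rw [map_add, LinearMap.add_apply, LinearMap.add_apply, ha, hb, mul_add, map_add]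

theorem vartheta_apply (ψ : regularFunctions) (u : Env) :
    vartheta ψ u = (leftRegular u ψ : bigCell → ℂ) ⟨w0, w0_mem⟩ := rfl

theorem vartheta_apply_one (ψ : regularFunctions) :
    vartheta ψ 1 = (ψ : bigCell → ℂ) ⟨w0, w0_mem⟩ := by
  rw [vartheta_apply, map_one, Module.End.one_apply]

theorem leftRegular_envι (x : sl2) (ψ : regularFunctions) :
    leftRegular (envι x) ψ = ⁅((x, 0) : sl2 × sl2), ψ⁆ := by
  unfold leftRegular envι
  rw [UniversalEnvelopingAlgebra.lift_ι_apply]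
  rfl

theorem leftRegular_lie_right (u : Env) (y : sl2) (ψ : regularFunctions) :
    leftRegular u ⁅((0, y) : sl2 × sl2), ψ⁆ = ⁅((0, y) : sl2 × sl2), leftRegular u ψ⁆ := by
  induction u using env_induction generalizing ψ with
  | hc c =>
    rw [AlgHom.commutes, Module.algebraMap_end_apply, Module.algebraMap_end_apply, lie_smul]
  | hι x =>
    rw [leftRegular_envι, leftRegular_envι, leibniz_lie, prodMk_zero_lie_zero_prodMk, zero_lie,
      zero_add]
  | hmul a b ha hb => rw [map_mul, Module.End.mul_apply, Module.End.mul_apply, hb, ha]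
  | hadd a b ha hb => rw [map_add, LinearMap.add_apply, LinearMap.add_apply, ha, hb, lie_add]

theorem w0_mul (y : sl2) :
    (w0 : Matrix (Fin 2) (Fin 2) ℂ) * y.1 = (omega y).1 * (w0 : Matrix (Fin 2) (Fin 2) ℂ) := by
  have htr : y.1 1 1 = -y.1 0 0 :=
    eq_neg_of_add_eq_zero_right ((Matrix.trace_fin_two y.1).symm.trans ((mem_sl2_iff _).1 y.2))
  have homega (k l : Fin 2) : (omega y).1 k l = -y.1 l k := rfl
  have hw0 : (w0 : Matrix (Fin 2) (Fin 2) ℂ) = !![0, -1; 1, 0] := rfl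
  ext i j
  rw [Matrix.mul_apply, Matrix.mul_apply, Fin.sum_univ_two, Fin.sum_univ_two, homega, homega, hw0]
  fin_cases i <;> fin_cases j <;> simp [htr]

theorem evalAt_w0_vf (y : sl2) (p : MvPolynomial (Fin 2 × Fin 2) ℂ) :
    evalAt w0 (vf 0 y p) = -evalAt w0 (vf (omega y) 0 p) := by
  induction p using MvPolynomial.induction_on with
  | C c => simp only [MvPolynomial.derivation_C, map_zero, neg_zero]
  | add p q hp hq =>
    rw [map_add, map_add, map_add, map_add, hp, hq, neg_add]
  | mul_X p ij hp =>
    have hX : evalAt w0 (vf 0 y (MvPolynomial.X ij)) =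
        -evalAt w0 (vf (omega y) 0 (MvPolynomial.X ij)) := by
      simp only [evalAt_vf_X, w0_mul, zero_mul, mul_zero, neg_zero, zero_add, add_zero,
        Matrix.neg_apply, neg_neg]
    simp only [Derivation.leibniz, smul_eq_mul, map_add, map_mul, hX, hp]
    ring

theorem regAct_w0 (y : sl2) (ψ : regularFunctions) :
    (⁅((0, y) : sl2 × sl2), ψ⁆ : regularFunctions).1 ⟨w0, w0_mem⟩ =
      -(⁅((omega y, 0) : sl2 × sl2), ψ⁆ : regularFunctions).1 ⟨w0, w0_mem⟩ := by
  obtain ⟨p, q, hq, hpq⟩ := ψ.2 ⟨w0, w0_mem⟩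
  change regAct (0, y) ψ.1 _ = -regAct (omega y, 0) ψ.1 _
  rw [regAct_eq _ hpq _ hq, regAct_eq _ hpq _ hq, ← neg_div]
  congr 1
  simp only [map_sub, map_mul, ZeroMemClass.coe_zero, evalAt_w0_vf]
  ring

theorem vartheta_lie (a : sl2 × sl2) (ψ : regularFunctions) :
    vartheta ⁅a, ψ⁆ = ⁅a, vartheta ψ⁆ := by
  have hl (x : sl2) : vartheta ⁅((x, 0) : sl2 × sl2), ψ⁆ = ⁅((x, 0) : sl2 × sl2), vartheta ψ⁆ := by
    ext u
    rw [lie_left_eq, lie_left_apply, vartheta_apply, vartheta_apply, map_mul,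
      Module.End.mul_apply, leftRegular_envι]
  have hr (y : sl2) : vartheta ⁅((0, y) : sl2 × sl2), ψ⁆ = ⁅((0, y) : sl2 × sl2), vartheta ψ⁆ := by
    ext u
    rw [lie_right_apply, vartheta_apply, vartheta_apply, leftRegular_lie_right, regAct_w0,
      map_mul, Module.End.mul_apply, leftRegular_envι]
  have ha : a = (a.1, 0) + (0, a.2) := by simp
  rw [ha, add_lie, add_lie, map_add, hl, hr]

end Vartheta

/-! ### Injectivity: integration along the Bruhat coordinates -/

section Injectivity

theorem hasDerivAt_along (a : sl2 × sl2) (ψ : regularFunctions) {γ : ℂ → bigCell} {t : ℂ}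
    (hγ : ∀ i j, HasDerivAt (fun s => (γ s : SL(2, ℂ)) i j) (velocity a (γ t) i j) t) :
    HasDerivAt (fun s => ψ.1 (γ s)) ((⁅a, ψ⁆ : regularFunctions).1 (γ t)) t := by
  obtain ⟨p, q, hq, hpq⟩ := ψ.2 (γ t)
  have hshift : HasDerivAt (fun s => extendByZero ψ.1 (γ (t + s)))
      ((⁅a, ψ⁆ : regularFunctions).1 (γ t)) 0 := by
    refine (hasDerivAt_extendByZero hpq (γ t) hq (fun s => γ (t + s)) (by rw [add_zero])
      a.1 a.2 fun i j => ?_).congr_deriv (regAct_eq a hpq (γ t) hq).symm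
    rw [add_zero]
    exact HasDerivAt.comp_const_add t 0 (by rw [add_zero]; exact hγ i j)
  have hext (s : ℂ) : extendByZero ψ.1 (γ s) = ψ.1 (γ s) := dif_pos (γ s).2
  simp only [hext] at hshift
  have h := HasDerivAt.comp_sub_const t t (by rwa [sub_self])
    (f := fun s => ψ.1 (γ (t + s)))
  simpa only [add_sub_cancel] using h

/-- The point of the big cell with Bruhat coordinates `x`, `z`, `y`. -/
noncomputable def cell (x y : ℂ) (z : ℂˣ) : bigCell :=
  ⟨unip x * w0 * torus z * unip y, x, y, z, rfl⟩

theorem cell_apply (x y : ℂ) (z : ℂˣ) (i j : Fin 2) :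
    (cell x y z : SL(2, ℂ)) i j = !![x * z, x * y * z - (z : ℂ)⁻¹; (z : ℂ), y * z] i j :=
  congr_fun₂ (coe_cell x y z) i j

theorem exists_eq_cell (g : bigCell) : ∃ x y z, g = cell x y z := by
  obtain ⟨x, y, z, hg⟩ := g.2
  exact ⟨x, y, z, Subtype.ext hg⟩

theorem cell_zero_zero_one : cell 0 0 1 = ⟨w0, w0_mem⟩ := by
  ext i j
  rw [cell_apply]
  fin_cases i <;> fin_cases j <;> simp [w0]

theorem apply_cell_of_lie_e_left_eq_zero {ψ : regularFunctions}
    (hψ : ⁅((sl2E, 0) : sl2 × sl2), ψ⁆ = 0) (x y : ℂ) (z : ℂˣ) :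
    ψ.1 (cell x y z) = ψ.1 (cell 0 y z) := by
  have hderiv (s : ℂ) : HasDerivAt (fun s => ψ.1 (cell (-s) y z)) 0 s := by
    refine (hasDerivAt_along (sl2E, 0) ψ fun i j => ?_).congr_deriv (by rw [hψ]; rfl)
    simp only [velocity_e_left, cell_apply]
    fin_cases i <;> fin_cases j
    · simpa using (hasDerivAt_id s).neg.mul_const (z : ℂ)
    · simpa using (((hasDerivAt_id s).neg.mul_const y).mul_const (z : ℂ)).sub_const (z : ℂ)⁻¹
    · simpa using hasDerivAt_const s (z : ℂ)
    · simpa using hasDerivAt_const s (y * z)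
  have hconst := is_const_of_deriv_eq_zero (fun s => (hderiv s).differentiableAt)
    (fun s => (hderiv s).deriv) (-x) 0
  simpa only [neg_neg, neg_zero] using hconst

theorem apply_cell_of_lie_e_right_eq_zero {ψ : regularFunctions}
    (hψ : ⁅((0, sl2E) : sl2 × sl2), ψ⁆ = 0) (y : ℂ) (z : ℂˣ) :
    ψ.1 (cell 0 y z) = ψ.1 (cell 0 0 z) := by
  have hderiv (s : ℂ) : HasDerivAt (fun s => ψ.1 (cell 0 s z)) 0 s := by
    refine (hasDerivAt_along (0, sl2E) ψ fun i j => ?_).congr_deriv (by rw [hψ]; rfl)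
    simp only [velocity_e_right, cell_apply]
    fin_cases i <;> fin_cases j
    · simpa using hasDerivAt_const s (0 : ℂ)
    · simpa using hasDerivAt_const s (-(z : ℂ)⁻¹)
    · simpa using hasDerivAt_const s (z : ℂ)
    · simpa using (hasDerivAt_id s).mul_const (z : ℂ)
  exact is_const_of_deriv_eq_zero (fun s => (hderiv s).differentiableAt)
    (fun s => (hderiv s).deriv) y 0

theorem apply_torus_of_lie_h_left {ψ : regularFunctions} {μ : ℂ}
    (hψ : ⁅((sl2H, 0) : sl2 × sl2), ψ⁆ = μ • ψ) (s : ℂ) :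
    ψ.1 (cell 0 0 (Units.mk0 (Complex.exp s) (Complex.exp_ne_zero s))) =
      Complex.exp (μ * s) * ψ.1 ⟨w0, w0_mem⟩ := by
  let γ (s : ℂ) : bigCell := cell 0 0 (Units.mk0 (Complex.exp s) (Complex.exp_ne_zero s))
  have hγ0 : γ 0 = ⟨w0, w0_mem⟩ := by
    rw [← cell_zero_zero_one]
    exact congrArg (cell 0 0) (Units.ext Complex.exp_zero)
  have hderiv (s : ℂ) : HasDerivAt (fun s => ψ.1 (γ s)) (μ * ψ.1 (γ s)) s := by
    refine (hasDerivAt_along (sl2H, 0) ψ fun i j => ?_).congr_deriv (by rw [hψ]; rfl)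
    simp only [velocity_h_left, γ, cell_apply]
    fin_cases i <;> fin_cases j
    · simpa using hasDerivAt_const s (0 : ℂ)
    · simpa [← Complex.exp_neg] using (hasDerivAt_neg s).cexp.fun_neg
    · simpa using Complex.hasDerivAt_exp s
    · simpa using hasDerivAt_const s (0 : ℂ)
  have hquot (s : ℂ) : HasDerivAt (fun s => Complex.exp (-(μ * s)) * ψ.1 (γ s)) 0 s := by
    have hexp := (((hasDerivAt_id s).const_mul μ).neg).cexp
    exact (hexp.mul (hderiv s)).congr_deriv (by simp; ring)
  have hconst := is_const_of_deriv_eq_zero (fun s => (hquot s).differentiableAt)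
    (fun s => (hquot s).deriv) s 0
  rw [hγ0, mul_zero, neg_zero, Complex.exp_zero, one_mul] at hconst
  rw [← hconst, ← mul_assoc, ← Complex.exp_add, add_neg_cancel, Complex.exp_zero, one_mul]

theorem eq_zero_of_highestWeight_of_apply_w0_eq_zero {ψ : regularFunctions} {μ : ℂ}
    (hel : ⁅((sl2E, 0) : sl2 × sl2), ψ⁆ = 0) (her : ⁅((0, sl2E) : sl2 × sl2), ψ⁆ = 0)
    (hh : ⁅((sl2H, 0) : sl2 × sl2), ψ⁆ = μ • ψ) (h0 : ψ.1 ⟨w0, w0_mem⟩ = 0) : ψ = 0 := by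
  ext g
  obtain ⟨x, y, z, rfl⟩ := exists_eq_cell g
  have hz : z = Units.mk0 (Complex.exp (Complex.log z)) (Complex.exp_ne_zero _) :=
    Units.ext (Complex.exp_log z.ne_zero).symm
  rw [apply_cell_of_lie_e_left_eq_zero hel, apply_cell_of_lie_e_right_eq_zero her, hz,
    apply_torus_of_lie_h_left hh, h0, mul_zero]
  rfl

theorem ker_vartheta_le_comap (a : sl2 × sl2) :
    LinearMap.ker vartheta ≤
      (LinearMap.ker vartheta).comap (toEnd ℂ (sl2 × sl2) regularFunctions a) := by
  intro ψ hψ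
  change vartheta ⁅a, ψ⁆ = 0
  rw [vartheta_lie, LinearMap.mem_ker.1 hψ, lie_zero]

theorem ker_vartheta_inf_ker_inf_ker :
    LinearMap.ker vartheta ⊓ LinearMap.ker (toEnd ℂ (sl2 × sl2) regularFunctions (0, sl2E)) ⊓
      LinearMap.ker (toEnd ℂ (sl2 × sl2) regularFunctions (sl2E, 0)) = ⊥ := by
  have hH : ⨆ μ, (toEnd ℂ (sl2 × sl2) regularFunctions (sl2H, 0)).eigenspace μ = ⊤ :=
    eq_top_of_forall_monomialReg_mem fun i j n =>
      Submodule.mem_iSup_of_mem _ (Module.End.mem_eigenspace_iff.2 (lie_h_monomialReg i j n))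
  have hright := ker_toEnd_le_comap_toEnd (R := ℂ) (M := regularFunctions)
    (show ⁅((0, sl2E) : sl2 × sl2), ((sl2H, 0) : sl2 × sl2)⁆ = (0 : ℂ) • (0, sl2E) by
      rw [zero_smul, ← lie_skew, prodMk_zero_lie_zero_prodMk, neg_zero])
  have hleft := ker_toEnd_le_comap_toEnd (R := ℂ) (M := regularFunctions)
    (show ⁅((sl2E, 0) : sl2 × sl2), ((sl2H, 0) : sl2 × sl2)⁆ = (-2 : ℂ) • (sl2E, 0) by
      rw [← lie_skew, ← LieHom.inl_apply (R := ℂ), ← LieHom.inl_apply (R := ℂ), ← LieHom.map_lie,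
        lie_h_e, map_smul, neg_smul])
  have hstable := inf_le_comap_inf (inf_le_comap_inf (ker_vartheta_le_comap (sl2H, 0)) hright) hleft
  refine eq_bot_iff.2 fun ψ hψ => ?_
  have hsum := mem_iSup_inf_eigenspace Function.injective_id hstable hψ (hH ▸ Submodule.mem_top)
  refine (iSup_le fun μ => ?_ : _ ≤ (⊥ : Submodule ℂ regularFunctions)) hsum
  rintro χ ⟨⟨⟨hχ, her⟩, hel⟩, hμ⟩
  refine eq_zero_of_highestWeight_of_apply_w0_eq_zero hel her
    (Module.End.mem_eigenspace_iff.1 hμ) ?_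
  rw [← vartheta_apply_one, LinearMap.mem_ker.1 hχ, LinearMap.zero_apply]

theorem vartheta_injective : Function.Injective vartheta := by
  have hleft : (toEnd ℂ (sl2 × sl2) regularFunctions (sl2E, 0)).maxGenEigenspace 0 = ⊤ :=
    eq_top_of_forall_monomialReg_mem monomialReg_mem_maxGenEigenspace_e_left
  have hright : (toEnd ℂ (sl2 × sl2) regularFunctions (0, sl2E)).maxGenEigenspace 0 = ⊤ :=
    eq_top_of_forall_monomialReg_mem monomialReg_mem_maxGenEigenspace_e_right
  have hcomm := ker_toEnd_le_comap_toEnd (R := ℂ) (M := regularFunctions)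
    (show ⁅((0, sl2E) : sl2 × sl2), ((sl2E, 0) : sl2 × sl2)⁆ = (0 : ℂ) • (0, sl2E) by
      rw [zero_smul, ← lie_skew, prodMk_zero_lie_zero_prodMk, neg_zero])
  have hker := inf_maxGenEigenspace_zero_le
    (inf_le_comap_inf (ker_vartheta_le_comap (sl2E, 0)) hcomm) bot_le bot_le
    ker_vartheta_inf_ker_inf_ker.le
  rw [hleft, inf_top_eq] at hker
  have hbot := inf_maxGenEigenspace_zero_le (ker_vartheta_le_comap (0, sl2E)) bot_le bot_le hker
  rw [hright, inf_top_eq] at hbot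
  exact LinearMap.ker_eq_bot.1 (eq_bot_iff.2 hbot)

end Injectivity

/-! ### The image: integral weights and nilpotency under `e` on both sides -/

section Image

/-- The `ν`-eigenspace of the right action of `y`, a submodule for the left action. -/
noncomputable def rightEigenspace (y : sl2) (ν : ℂ) : LieSubmodule ℂ sl2 (Module.Dual ℂ Env) where
  __ := (toEnd ℂ (sl2 × sl2) (Module.Dual ℂ Env) (0, y)).eigenspace ν
  lie_mem {x φ} hφ := by
    have hφy : ⁅((0, y) : sl2 × sl2), φ⁆ = ν • φ := Module.End.mem_eigenspace_iff.1 hφ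
    refine Module.End.mem_eigenspace_iff.2 ?_
    rw [LieModule.toEnd_apply_apply, lie_right_lie_left, hφy, lie_smul]

theorem mem_rightEigenspace_iff {y : sl2} {ν : ℂ} {φ : Module.Dual ℂ Env} :
    φ ∈ rightEigenspace y ν ↔ ⁅((0, y) : sl2 × sl2), φ⁆ = ν • φ :=
  Module.End.mem_eigenspace_iff

theorem lie_e_right_apply (φ : Module.Dual ℂ Env) (u : Env) :
    ⁅((0, sl2E) : sl2 × sl2), φ⁆ u = φ (envι sl2F * u) := by
  rw [lie_right_apply, omega_e, map_neg, neg_mul, map_neg, neg_neg]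

theorem lie_h_right_apply (φ : Module.Dual ℂ Env) (u : Env) :
    ⁅((0, sl2H) : sl2 × sl2), φ⁆ u = φ (envι sl2H * u) := by
  rw [lie_right_apply, omega_h, map_neg, neg_mul, map_neg, neg_neg]

theorem lie_f_apply_one_of_lie_e_right_eq_zero {φ : Module.Dual ℂ Env}
    (hr : ⁅((0, sl2E) : sl2 × sl2), φ⁆ = 0) : ⁅sl2F, φ⁆ 1 = 0 := by
  rw [lie_left_apply, one_mul, ← mul_one (envι sl2F), ← lie_e_right_apply, hr,
    LinearMap.zero_apply]

theorem ladder_le_ker_apply_one {μ : ℂ} {φ : Module.Dual ℂ Env} (hφ : φ ∈ hWeightSpace _ μ)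
    (he : ⁅sl2E, φ⁆ = 0) (hr : ⁅((0, sl2E) : sl2 × sl2), φ⁆ = 0) (h1 : φ 1 = 0) (i : ℤ) :
    ladder φ i ≤ LinearMap.ker (LinearMap.applyₗ (R := ℂ) (M₂ := ℂ) (1 : Env)) := by
  match i with
  | .ofNat 0 =>
    rintro _ ⟨_, ⟨q, rfl⟩, rfl⟩
    change aeval (casimir _) q φ 1 = 0
    rw [aeval_casimir_of_lie_e_eq_zero hφ he, LinearMap.smul_apply, h1, smul_zero]
  | .ofNat (n + 1) => exact (ladder_eq_bot_of_lie_e_eq_zero he n).trans_le bot_le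
  | .negSucc n =>
    rintro _ ⟨_, ⟨q, rfl⟩, rfl⟩
    have hφr : φ ∈ rightEigenspace sl2E 0 := by rw [mem_rightEigenspace_iff, hr, zero_smul]
    have hpow := mem_rightEigenspace_iff.1
      (toEnd_pow_mem (rightEigenspace sl2E 0) sl2F n (aeval_casimir_mem _ q hφr))
    rw [zero_smul] at hpow
    rw [pow_succ', Module.End.mul_apply]
    exact lie_f_apply_one_of_lie_e_right_eq_zero hpow

theorem eq_zero_of_highestWeight_of_apply_one_eq_zero {μ : ℂ} {φ : Module.Dual ℂ Env}
    (hφ : φ ∈ hWeightSpace _ μ) (he : ⁅sl2E, φ⁆ = 0) (hr : ⁅((0, sl2E) : sl2 × sl2), φ⁆ = 0)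
    (h1 : φ 1 = 0) : φ = 0 := by
  ext u
  have hmem : enveloping (Module.Dual ℂ Env) u φ ∈ ⨆ i, ladder φ i :=
    lieSpan_singleton_le_iSup_ladder hφ (enveloping_mem _ u (LieSubmodule.subset_lieSpan rfl))
  have hzero := iSup_le (ladder_le_ker_apply_one hφ he hr h1) hmem
  rw [LinearMap.mem_ker, LinearMap.applyₗ_apply_apply, enveloping_dual_apply, one_mul] at hzero
  exact hzero

theorem vartheta_monomialReg_apply_one (n : ℤ) : vartheta (monomialReg 0 0 n) 1 = 1 := by
  rw [vartheta_apply_one, monomialReg_apply]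
  simp [w0]

theorem vartheta_monomialReg_mem_hWeightSpace (i j : ℕ) (n : ℤ) :
    vartheta (monomialReg i j n) ∈ hWeightSpace (Module.Dual ℂ Env) ((n + j - i : ℤ) : ℂ) := by
  change ⁅sl2H, vartheta (monomialReg i j n)⁆ = _
  rw [← lie_left_eq, ← vartheta_lie, lie_h_monomialReg, map_smul]
  push_cast
  rfl

theorem lie_e_vartheta_monomialReg (i j : ℕ) (n : ℤ) :
    ⁅sl2E, vartheta (monomialReg i j n)⁆ =
      (-(i : ℂ)) • vartheta (monomialReg (i - 1) j (n + 1)) := by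
  rw [← lie_left_eq, ← vartheta_lie, lie_e_monomialReg, map_smul]

theorem lie_e_right_vartheta_monomialReg (i j : ℕ) (n : ℤ) :
    ⁅((0, sl2E) : sl2 × sl2), vartheta (monomialReg i j n)⁆ =
      (j : ℂ) • vartheta (monomialReg i (j - 1) (n + 1)) := by
  rw [← vartheta_lie, lie_e_monomialReg_right, map_smul]

/-- The functionals that are sums of left weight vectors of integral weight. -/
noncomputable def integralWeightPart : Submodule ℂ (Module.Dual ℂ Env) :=
  ⨆ μ : ℤ, hWeightSpace (Module.Dual ℂ Env) (μ : ℂ)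

theorem integralWeightPart_le_comap_e_left :
    integralWeightPart ≤ integralWeightPart.comap (toEnd ℂ sl2 (Module.Dual ℂ Env) sl2E) := by
  refine iSup_le fun μ φ hφ => Submodule.mem_iSup_of_mem (μ + 2) ?_
  rw [Int.cast_add, Int.cast_ofNat]
  exact hWeightSpace_e _ hφ

theorem integralWeightPart_le_comap_e_right :
    integralWeightPart ≤
      integralWeightPart.comap (toEnd ℂ (sl2 × sl2) (Module.Dual ℂ Env) (0, sl2E)) := by
  refine iSup_le fun μ φ hφ => Submodule.mem_iSup_of_mem μ ?_
  change ⁅sl2H, ⁅((0, sl2E) : sl2 × sl2), φ⁆⁆ = _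
  rw [← lie_right_lie_left, (hφ : ⁅sl2H, φ⁆ = _), lie_smul]
  rfl

theorem vartheta_mem_integralWeightPart (ψ : regularFunctions) :
    vartheta ψ ∈ integralWeightPart := by
  have htop : integralWeightPart.comap vartheta = ⊤ :=
    eq_top_of_forall_monomialReg_mem fun i j n =>
      Submodule.mem_iSup_of_mem _ (vartheta_monomialReg_mem_hWeightSpace i j n)
  exact htop.ge trivial

theorem vartheta_mem_maxGenEigenspace_e_left (ψ : regularFunctions) :
    vartheta ψ ∈ (toEnd ℂ sl2 (Module.Dual ℂ Env) sl2E).maxGenEigenspace 0 := by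
  have htop := eq_top_of_forall_monomialReg_mem monomialReg_mem_maxGenEigenspace_e_left
  exact map_mem_maxGenEigenspace (LinearMap.ext fun χ => vartheta_lie (sl2E, 0) χ)
    (htop.ge (Submodule.mem_top (x := ψ)))

theorem vartheta_mem_maxGenEigenspace_e_right (ψ : regularFunctions) :
    vartheta ψ ∈ (toEnd ℂ (sl2 × sl2) (Module.Dual ℂ Env) (0, sl2E)).maxGenEigenspace 0 := by
  have htop := eq_top_of_forall_monomialReg_mem monomialReg_mem_maxGenEigenspace_e_right
  exact map_mem_maxGenEigenspace (LinearMap.ext fun χ => vartheta_lie (0, sl2E) χ)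
    (htop.ge (Submodule.mem_top (x := ψ)))

theorem ker_left_le_comap_right (x y : sl2) :
    LinearMap.ker (toEnd ℂ sl2 (Module.Dual ℂ Env) x) ≤
      (LinearMap.ker (toEnd ℂ sl2 (Module.Dual ℂ Env) x)).comap
        (toEnd ℂ (sl2 × sl2) (Module.Dual ℂ Env) (0, y)) := by
  intro φ hφ
  have hφx : ⁅x, φ⁆ = 0 := hφ
  change ⁅x, ⁅((0, y) : sl2 × sl2), φ⁆⁆ = 0
  rw [← lie_right_lie_left, hφx, lie_zero]

theorem ker_right_le_comap_left (x y : sl2) :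
    LinearMap.ker (toEnd ℂ (sl2 × sl2) (Module.Dual ℂ Env) (0, y)) ≤
      (LinearMap.ker (toEnd ℂ (sl2 × sl2) (Module.Dual ℂ Env) (0, y))).comap
        (toEnd ℂ sl2 (Module.Dual ℂ Env) x) := by
  intro φ hφ
  have hφy : ⁅((0, y) : sl2 × sl2), φ⁆ = 0 := hφ
  change ⁅((0, y) : sl2 × sl2), ⁅x, φ⁆⁆ = 0
  rw [lie_right_lie_left, hφy, lie_zero]

theorem vartheta_monomialReg_mem_ker_e_left (j : ℕ) (n : ℤ) :
    vartheta (monomialReg 0 j n) ∈ LinearMap.ker (toEnd ℂ sl2 (Module.Dual ℂ Env) sl2E) := by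
  rw [LinearMap.mem_ker, LieModule.toEnd_apply_apply, lie_e_vartheta_monomialReg, Nat.cast_zero,
    neg_zero, zero_smul]

theorem integralWeightPart_inf_ker_inf_ker_le :
    integralWeightPart ⊓ LinearMap.ker (toEnd ℂ sl2 (Module.Dual ℂ Env) sl2E) ⊓
        LinearMap.ker (toEnd ℂ (sl2 × sl2) (Module.Dual ℂ Env) (0, sl2E)) ≤
      Submodule.span ℂ (Set.range fun t : ℕ × ℤ => vartheta (monomialReg 0 t.1 t.2)) := by
  have hstable := inf_le_comap_inf
    (ker_toEnd_le_comap_toEnd (R := ℂ) (M := Module.Dual ℂ Env)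
      (show ⁅sl2E, sl2H⁆ = (-2 : ℂ) • sl2E by rw [← lie_skew, lie_h_e, neg_smul]))
    (ker_right_le_comap_left sl2H sl2E)
  rintro φ ⟨⟨hφ, he⟩, hr⟩
  simp only [integralWeightPart, hWeightSpace_eq_eigenspace] at hφ
  have hmem := mem_iSup_inf_eigenspace Int.cast_injective hstable ⟨he, hr⟩ hφ
  refine (iSup_le fun μ => ?_ : _ ≤ Submodule.span ℂ _) hmem
  rintro χ ⟨⟨hχe, hχr⟩, hχ⟩
  rw [← hWeightSpace_eq_eigenspace] at hχ
  have hmono := vartheta_monomialReg_mem_hWeightSpace 0 0 μ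
  rw [Nat.cast_zero, add_zero, sub_zero] at hmono
  have hzero : χ - χ 1 • vartheta (monomialReg 0 0 μ) = 0 := by
    refine eq_zero_of_highestWeight_of_apply_one_eq_zero
      (sub_mem hχ (Submodule.smul_mem _ _ hmono)) ?_ ?_ ?_
    · exact sub_mem hχe (Submodule.smul_mem _ _ (vartheta_monomialReg_mem_ker_e_left 0 μ))
    · rw [lie_sub, lie_smul, lie_e_right_vartheta_monomialReg, Nat.cast_zero, zero_smul, smul_zero,
        sub_zero]
      exact hχr
    · rw [LinearMap.sub_apply, LinearMap.smul_apply, vartheta_monomialReg_apply_one, smul_eq_mul,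
        mul_one, sub_self]
  rw [sub_eq_zero.1 hzero]
  exact Submodule.smul_mem _ _ (Submodule.subset_span ⟨(0, μ), rfl⟩)

theorem integralWeightPart_inf_ker_inf_maxGenEigenspace_le :
    integralWeightPart ⊓ LinearMap.ker (toEnd ℂ sl2 (Module.Dual ℂ Env) sl2E) ⊓
        (toEnd ℂ (sl2 × sl2) (Module.Dual ℂ Env) (0, sl2E)).maxGenEigenspace 0 ≤
      Submodule.span ℂ (Set.range fun t : ℕ × ℤ => vartheta (monomialReg 0 t.1 t.2)) := by
  refine inf_maxGenEigenspace_zero_le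
    (inf_le_comap_inf integralWeightPart_le_comap_e_right (ker_left_le_comap_right sl2E sl2E))
    (Submodule.span_le.2 ?_) (Submodule.span_le.2 ?_) integralWeightPart_inf_ker_inf_ker_le
  · rintro _ ⟨⟨j, n⟩, rfl⟩
    exact ⟨vartheta_mem_integralWeightPart _, vartheta_monomialReg_mem_ker_e_left j n⟩
  · rintro _ ⟨⟨j, n⟩, rfl⟩
    refine ⟨((j + 1 : ℕ) : ℂ)⁻¹ • vartheta (monomialReg 0 (j + 1) (n - 1)),
      Submodule.smul_mem _ _ (Submodule.subset_span ⟨(j + 1, n - 1), rfl⟩), ?_⟩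
    rw [map_smul, LieModule.toEnd_apply_apply, lie_e_right_vartheta_monomialReg,
      Nat.add_sub_cancel, sub_add_cancel, inv_smul_smul₀ (Nat.cast_ne_zero.2 j.succ_ne_zero)]

theorem monomialReg_mem_range_e_left (i j : ℕ) (n : ℤ) :
    monomialReg i j n ∈
      LinearMap.range (toEnd ℂ (sl2 × sl2) regularFunctions (sl2E, 0)) := by
  refine ⟨(-((i + 1 : ℕ) : ℂ))⁻¹ • monomialReg (i + 1) j (n - 1), ?_⟩
  rw [map_smul, LieModule.toEnd_apply_apply, lie_e_monomialReg, Nat.add_sub_cancel,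
    sub_add_cancel, inv_smul_smul₀ (neg_ne_zero.2 (Nat.cast_ne_zero.2 i.succ_ne_zero))]

theorem range_vartheta_le_map_e_left :
    LinearMap.range vartheta ≤
      (LinearMap.range vartheta).map (toEnd ℂ sl2 (Module.Dual ℂ Env) sl2E) := by
  rintro _ ⟨ψ, rfl⟩
  obtain ⟨χ, rfl⟩ := (eq_top_of_forall_monomialReg_mem monomialReg_mem_range_e_left).ge
    (Submodule.mem_top (x := ψ))
  exact ⟨vartheta χ, ⟨χ, rfl⟩, (vartheta_lie (sl2E, 0) χ).symm⟩

theorem range_vartheta :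
    LinearMap.range vartheta =
      integralWeightPart ⊓
        (toEnd ℂ (sl2 × sl2) (Module.Dual ℂ Env) (0, sl2E)).maxGenEigenspace 0 ⊓
        (toEnd ℂ sl2 (Module.Dual ℂ Env) sl2E).maxGenEigenspace 0 := by
  have hle : LinearMap.range vartheta ≤ integralWeightPart ⊓
      (toEnd ℂ (sl2 × sl2) (Module.Dual ℂ Env) (0, sl2E)).maxGenEigenspace 0 := by
    rintro _ ⟨ψ, rfl⟩
    exact ⟨vartheta_mem_integralWeightPart ψ, vartheta_mem_maxGenEigenspace_e_right ψ⟩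
  have hcomm : Commute (toEnd ℂ (sl2 × sl2) (Module.Dual ℂ Env) (0, sl2E))
      (toEnd ℂ sl2 (Module.Dual ℂ Env) sl2E) :=
    LinearMap.ext fun φ => lie_right_lie_left sl2E sl2E φ
  refine le_antisymm (le_inf hle ?_) (inf_maxGenEigenspace_zero_le
    (inf_le_comap_inf integralWeightPart_le_comap_e_left
      (Module.End.mapsTo_maxGenEigenspace_of_comm hcomm 0)) hle range_vartheta_le_map_e_left ?_)
  · rintro _ ⟨ψ, rfl⟩
    exact vartheta_mem_maxGenEigenspace_e_left ψ
  · rw [inf_right_comm]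
    refine integralWeightPart_inf_ker_inf_maxGenEigenspace_le.trans (Submodule.span_le.2 ?_)
    rintro _ ⟨t, rfl⟩
    exact ⟨_, rfl⟩

end Image

/-! ### Matrix elements of projective covers -/

section MatrixElements

variable {V : Type} [AddCommGroup V] [Module ℂ V] [LieRingModule sl2 V] [LieModule ℂ sl2 V]

/-- The matrix elements against a fixed vector of the restricted dual, as a homomorphism for the
left action. -/
noncomputable def matrixHom (k : RestrictedDual V) : V →ₗ⁅ℂ,sl2⁆ Module.Dual ℂ Env where
  __ := (matrixElementBilin V).flip k
  map_lie' {x v} := by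
    ext u
    change matrixElement V ⁅x, v⁆ k u = ⁅x, matrixElement V v k⁆ u
    rw [lie_left_apply, matrixElement_apply, matrixElement_apply, map_mul, Module.End.mul_apply,
      enveloping_envι]

theorem matrixHom_apply (k : RestrictedDual V) (v : V) : matrixHom k v = matrixElement V v k := rfl

theorem matrixElements_le {M : Submodule ℂ (Module.Dual ℂ Env)}
    (h : ∀ (k : RestrictedDual V) (v : V), matrixHom k v ∈ M) : matrixElements V ≤ M := by
  refine Submodule.span_le.2 ?_
  rintro _ ⟨v, k, rfl⟩
  exact h k v

theorem matrixHom_mem (k : RestrictedDual V) (v : V) : matrixHom k v ∈ matrixElements V :=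
  Submodule.subset_span ⟨v, k, rfl⟩

theorem matrixElements_le_comap_left (x : sl2) :
    matrixElements V ≤ (matrixElements V).comap (toEnd ℂ sl2 (Module.Dual ℂ Env) x) := by
  refine matrixElements_le fun k v => ?_
  rw [Submodule.mem_comap, LieModule.toEnd_apply_apply, ← LieModuleHom.map_lie]
  exact matrixHom_mem k _

theorem e_right_pow_apply (N : ℕ) (φ : Module.Dual ℂ Env) (u : Env) :
    (toEnd ℂ (sl2 × sl2) (Module.Dual ℂ Env) (0, sl2E) ^ N) φ u = φ (envι sl2F ^ N * u) := by
  induction N generalizing φ with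
  | zero => rw [pow_zero, pow_zero, Module.End.one_apply, one_mul]
  | succ N ih =>
    rw [pow_succ, Module.End.mul_apply, ih, LieModule.toEnd_apply_apply, lie_e_right_apply,
      pow_succ', mul_assoc]

theorem matrixHom_mem_integralWeightPart
    (hV : ∀ μ : ℂ, ∀ x ∈ hWeightSpace V μ, x ≠ 0 → ∃ z : ℤ, μ = z)
    (htop : ⨆ μ, hWeightSpace V μ = ⊤) (k : RestrictedDual V) (v : V) :
    matrixHom k v ∈ integralWeightPart := by
  have hle : ⨆ μ, hWeightSpace V μ ≤
      integralWeightPart.comap (matrixHom k : V →ₗ[ℂ] Module.Dual ℂ Env) := by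
    refine iSup_le fun μ x hx => ?_
    rcases eq_or_ne x 0 with rfl | hx0
    · exact zero_mem _
    · obtain ⟨z, rfl⟩ := hV μ x hx hx0
      exact Submodule.mem_iSup_of_mem z (map_mem_hWeightSpace (matrixHom k) hx)
  exact hle (htop ▸ Submodule.mem_top)

variable {m : ℕ}

theorem mem_casimirBlock_of_isProjectiveCover (hV : IsProjectiveCover V (-(m : ℂ) - 1)) (x : V) :
    x ∈ casimirBlock V ((m : ℂ) ^ 2) := by
  obtain ⟨g⟩ := nonempty_equiv_bigProjective hV
  rw [← g.apply_symm_apply x]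
  exact map_mem_casimirBlock g.toLieModuleHom ((casimirBlock_bigProjective m).ge trivial)

theorem matrixElements_le_casimirBlock (hV : IsProjectiveCover V (-(m : ℂ) - 1)) :
    matrixElements V ≤ casimirBlock (Module.Dual ℂ Env) ((m : ℂ) ^ 2) :=
  matrixElements_le fun k v =>
    map_mem_casimirBlock (matrixHom k) (mem_casimirBlock_of_isProjectiveCover hV v)

theorem weight_of_isProjectiveCover (hV : IsProjectiveCover V (-(m : ℂ) - 1)) {μ : ℂ} {x : V}
    (hx : x ∈ hWeightSpace V μ) (hx0 : x ≠ 0) : ∃ z : ℤ, μ = z ∧ z ≤ (m : ℤ) - 1 := by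
  obtain ⟨n, hn⟩ := hV.1.1.locallyNilpotent x
  obtain ⟨j, -, hj⟩ := exists_eq_sq_of_mem_casimirBlock hx0 hx hn
    (mem_casimirBlock_of_isProjectiveCover hV x)
  rcases sq_eq_sq_iff_eq_or_eq_neg.1 hj with h | h
  · refine ⟨m - 1 - 2 * j, ?_, by lia⟩
    push_cast
    linear_combination -h
  · refine ⟨-m - 1 - 2 * j, ?_, by lia⟩
    push_cast
    linear_combination h

theorem exists_f_pow_apply_eq_zero (hV : IsProjectiveCover V (-(m : ℂ) - 1))
    (k : RestrictedDual V) :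
    ∃ N : ℕ, ∀ x : V, RestrictedDual.toDual V k ((toEnd ℂ sl2 V sl2F ^ N) x) = 0 := by
  have hfin : (hSupport V (RestrictedDual.toDual V k)).Finite := k.2
  obtain ⟨b, hb⟩ := (hfin.image Complex.re).bddBelow
  obtain ⟨N, hN⟩ := exists_nat_gt ((m : ℝ) - 1 - b)
  refine ⟨N, fun x => ?_⟩
  have hle : ⨆ μ, hWeightSpace V μ ≤
      LinearMap.ker (RestrictedDual.toDual V k ∘ₗ toEnd ℂ sl2 V sl2F ^ N) := by
    refine iSup_le fun μ y hy => by_contra fun hne => ?_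
    rw [LinearMap.mem_ker, LinearMap.comp_apply] at hne
    have hy0 : y ≠ 0 := by
      rintro rfl
      exact hne (by rw [map_zero, map_zero])
    obtain ⟨z, rfl, hz⟩ := weight_of_isProjectiveCover hV hy hy0
    have hlower : b ≤ ((z : ℂ) - 2 * N).re :=
      hb (Set.mem_image_of_mem _ ⟨_, f_pow_mem_hWeightSpace hy N, hne⟩)
    have hre : ((z : ℂ) - 2 * N).re = z - 2 * N := by simp
    have hzm : (z : ℝ) ≤ m - 1 := by exact_mod_cast hz
    linarith [N.cast_nonneg (α := ℝ)]
  exact hle (hV.1.1.iSup_hWeightSpace ▸ Submodule.mem_top)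

theorem matrixElements_le_range_vartheta (hV : IsProjectiveCover V (-(m : ℂ) - 1)) :
    matrixElements V ≤ LinearMap.range vartheta := by
  rw [range_vartheta]
  refine matrixElements_le fun k v => ⟨⟨?_, ?_⟩, ?_⟩
  · refine matrixHom_mem_integralWeightPart (fun μ x hx hx0 => ?_) hV.1.1.iSup_hWeightSpace k v
    exact (weight_of_isProjectiveCover hV hx hx0).imp fun _ => And.left
  · obtain ⟨N, hN⟩ := exists_f_pow_apply_eq_zero hV k
    refine (Module.End.mem_maxGenEigenspace _ _ _).2 ⟨N, LinearMap.ext fun u => ?_⟩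
    rw [zero_smul, sub_zero, e_right_pow_apply, matrixHom_apply, matrixElement_apply, map_mul,
      Module.End.mul_apply, map_pow, enveloping_envι_eq_toEnd, hN, LinearMap.zero_apply]
  · obtain ⟨n, hn⟩ := hV.1.1.locallyNilpotent v
    refine (Module.End.mem_maxGenEigenspace _ _ _).2 ⟨n, ?_⟩
    rw [zero_smul, sub_zero, ← map_toEnd_pow, hn, map_zero]

theorem map_enveloping {W : Type} [AddCommGroup W] [Module ℂ W] [LieRingModule sl2 W]
    [LieModule ℂ sl2 W] (p : V →ₗ⁅ℂ,sl2⁆ W) (u : Env) (v : V) :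
    p (enveloping V u v) = enveloping W u (p v) := by
  induction u using env_induction generalizing v with
  | hc c =>
    rw [AlgHom.commutes, AlgHom.commutes, Module.algebraMap_end_apply,
      Module.algebraMap_end_apply, map_smul]
  | hι x => rw [enveloping_envι, enveloping_envι, LieModuleHom.map_lie]
  | hmul a b ha hb =>
    rw [map_mul, map_mul, Module.End.mul_apply, Module.End.mul_apply, ha, hb]
  | hadd a b ha hb => rw [map_add, map_add, LinearMap.add_apply, LinearMap.add_apply, map_add,
      ha, hb]

/-- Evaluation at `1` after a homomorphism to `U(g)'` whose image consists of right weight vectors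
of one weight `ν`. Left and right weights agree at `1`, so its weight support is `{ν}`. -/
noncomputable def evalOneComp {ν : ℂ} (p : V →ₗ⁅ℂ,sl2⁆ Module.Dual ℂ Env)
    (hp : ∀ x, p x ∈ rightEigenspace sl2H ν) : RestrictedDual V where
  val := LinearMap.applyₗ (1 : Env) ∘ₗ (p : V →ₗ[ℂ] Module.Dual ℂ Env)
  property := by
    refine (Set.finite_singleton ν).subset ?_
    rintro μ ⟨x, hx, hne⟩
    have hleft : ⁅sl2H, p x⁆ = μ • p x := map_mem_hWeightSpace p hx
    have hright := mem_rightEigenspace_iff.1 (hp x)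
    have hone : ⁅sl2H, p x⁆ 1 = ⁅((0, sl2H) : sl2 × sl2), p x⁆ 1 := by
      rw [lie_left_apply, lie_h_right_apply, one_mul, mul_one]
    rw [hleft, hright, LinearMap.smul_apply, LinearMap.smul_apply] at hone
    exact mul_right_cancel₀ hne hone

theorem matrixHom_evalOneComp {ν : ℂ} (p : V →ₗ⁅ℂ,sl2⁆ Module.Dual ℂ Env)
    (hp : ∀ x, p x ∈ rightEigenspace sl2H ν) (v : V) : matrixHom (evalOneComp p hp) v = p v := by
  ext u
  change p (enveloping V u v) 1 = p v u
  rw [map_enveloping, enveloping_dual_apply, one_mul]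

theorem mem_matrixElements_of_antidominant (hV : IsProjectiveCover V (-(m : ℂ) - 1)) {n : ℕ}
    {ν : ℂ} {φ : Module.Dual ℂ Env} (hφ : φ ∈ hWeightSpace _ (-(m : ℂ) - 1))
    (hr : φ ∈ rightEigenspace sl2H ν)
    (hn : (toEnd ℂ sl2 (Module.Dual ℂ Env) sl2E ^ n) φ = 0)
    (hc : φ ∈ casimirBlock (Module.Dual ℂ Env) ((m : ℂ) ^ 2)) : φ ∈ matrixElements V := by
  obtain ⟨g⟩ := nonempty_equiv_bigProjective hV
  obtain ⟨p, hp⟩ := exists_hom_bigProjective_of_mem_casimirBlock hφ hn hc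
  have htop : (rightEigenspace sl2H ν).comap p = ⊤ :=
    eq_top_of_mem_of_lieSpan_eq_top (lieSpan_bigGenerator m) (LieSubmodule.mem_comap.2 (hp ▸ hr))
  have hright (x : V) : p.comp g.symm.toLieModuleHom x ∈ rightEigenspace sl2H ν :=
    htop.ge (LieSubmodule.mem_top (g.symm x))
  have hφeq : matrixHom (evalOneComp _ hright) (g (bigGenerator m)) = φ := by
    rw [matrixHom_evalOneComp]
    change p (g.symm (g (bigGenerator m))) = φ
    rw [g.symm_apply_apply, hp]
  exact hφeq ▸ matrixHom_mem _ _

theorem sq_ne_sq_of_lt_antidominant (m t : ℕ) :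
    (-(m : ℂ) - 1 - 2 * ((t + 1 : ℕ) : ℂ) + 1) ^ 2 ≠ (m : ℂ) ^ 2 := by
  intro h
  have hsq : (m + 2 * (t + 1)) ^ 2 = m ^ 2 := by
    have hcast : ((m + 2 * (t + 1) : ℕ) : ℂ) ^ 2 = (m : ℂ) ^ 2 := by
      rw [← h]
      push_cast
      ring
    exact_mod_cast hcast
  have := Nat.pow_left_injective two_ne_zero hsq
  lia

/-- In weights strictly below `-m - 1` the operator `f e` is invertible on the Casimir block of
`m ^ 2`, so the functional is reached by `f` from a higher weight. -/
theorem mem_matrixElements (hV : IsProjectiveCover V (-(m : ℂ) - 1)) {n t : ℕ}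
    {ν : ℂ} {φ : Module.Dual ℂ Env} (hφ : φ ∈ hWeightSpace _ (-(m : ℂ) - 1 - 2 * t))
    (hr : φ ∈ rightEigenspace sl2H ν)
    (hn : (toEnd ℂ sl2 (Module.Dual ℂ Env) sl2E ^ n) φ = 0)
    (hc : φ ∈ casimirBlock (Module.Dual ℂ Env) ((m : ℂ) ^ 2)) : φ ∈ matrixElements V := by
  induction t generalizing φ n with
  | zero =>
    rw [Nat.cast_zero, mul_zero, sub_zero] at hφ
    exact mem_matrixElements_of_antidominant hV hφ hr hn hc
  | succ t ih =>
    set μ : ℂ := -(m : ℂ) - 1 - 2 * ((t + 1 : ℕ) : ℂ) with hμ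
    have hμm : (X - C ((μ + 1) ^ 2) : Polynomial ℂ).eval ((m : ℂ) ^ 2) ≠ 0 := by
      rw [Polynomial.eval_sub, Polynomial.eval_X, Polynomial.eval_C, sub_ne_zero]
      exact (sq_ne_sq_of_lt_antidominant m t).symm
    obtain ⟨q, hq⟩ := exists_aeval_mul_apply_eq_self hμm hc
    set χ := aeval (casimir (Module.Dual ℂ Env)) q φ
    have hχ : χ ∈ hWeightSpace _ μ := aeval_casimir_mem_hWeightSpace q hφ
    have hφχ : φ = (4 : ℂ) • ⁅sl2F, ⁅sl2E, χ⁆⁆ := by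
      rw [mul_comm, map_mul, Module.End.mul_apply, map_sub, Polynomial.aeval_X,
        Polynomial.aeval_C, LinearMap.sub_apply, casimir_of_mem_hWeightSpace hχ,
        Module.algebraMap_end_apply, add_sub_cancel_right] at hq
      exact hq.symm
    have hχn : (toEnd ℂ sl2 (Module.Dual ℂ Env) sl2E ^ n) χ = 0 := by
      rw [← aeval_casimir_toEnd_pow, hn, map_zero]
    have heχ : ⁅sl2E, χ⁆ ∈ matrixElements V := by
      refine ih (n := n) ?_ (LieSubmodule.lie_mem _ (aeval_casimir_mem _ q hr)) ?_
        (LieSubmodule.lie_mem _ (aeval_casimir_mem _ q hc))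
      · convert hWeightSpace_e _ hχ using 2
        rw [hμ]
        push_cast
        ring
      · rw [← LieModule.toEnd_apply_apply ℂ, ← Module.End.mul_apply, ← pow_succ,
          toEnd_pow_succ_apply, hχn, lie_zero]
    rw [hφχ]
    exact Submodule.smul_mem _ _ (matrixElements_le_comap_left sl2F heχ)

end MatrixElements

/-! ### Decomposition of the image into Casimir blocks -/

section Decomposition

theorem e_pow_vartheta_monomialReg (i j : ℕ) (n : ℤ) :
    (toEnd ℂ sl2 (Module.Dual ℂ Env) sl2E ^ (i + 1)) (vartheta (monomialReg i j n)) = 0 := by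
  induction i generalizing n with
  | zero =>
    rw [zero_add, pow_one, LieModule.toEnd_apply_apply, lie_e_vartheta_monomialReg, Nat.cast_zero,
      neg_zero, zero_smul]
  | succ i ih =>
    rw [pow_succ, Module.End.mul_apply, LieModule.toEnd_apply_apply, lie_e_vartheta_monomialReg,
      map_smul, Nat.add_sub_cancel, ih, smul_zero]

theorem vartheta_monomialReg_mem_of_shift {M : Submodule ℂ (Module.Dual ℂ Env)}
    (hM : M ≤ M.comap (toEnd ℂ sl2 (Module.Dual ℂ Env) sl2E)) (i j k : ℕ) (n : ℤ)
    (h : vartheta (monomialReg (i + k) j (n - k)) ∈ M) : vartheta (monomialReg i j n) ∈ M := by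
  induction k generalizing i n with
  | zero => rwa [add_zero, Nat.cast_zero, sub_zero] at h
  | succ k ih =>
    have hsucc : vartheta (monomialReg (i + 1) j (n - 1)) ∈ M := by
      refine ih (i + 1) (n - 1) ?_
      rwa [add_assoc, add_comm 1, sub_sub, add_comm 1, ← Nat.cast_succ]
    have hlie := hM hsucc
    rw [Submodule.mem_comap, LieModule.toEnd_apply_apply, lie_e_vartheta_monomialReg,
      Nat.add_sub_cancel, sub_add_cancel] at hlie
    exact (Submodule.smul_mem_iff M (neg_ne_zero.2 (Nat.cast_ne_zero.2 i.succ_ne_zero))).1 hlie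

theorem isProjectiveCover_bigProjective_neg_sub_one (m : ℕ) :
    IsProjectiveCover (BigProjective m) (-(m : ℂ) - 1) := by
  refine isProjectiveCover_bigProjective (v := vartheta (monomialReg 0 0 (-(m : ℤ) - 1)))
    (fun h => ?_) ?_ (vartheta_monomialReg_mem_ker_e_left 0 _)
  · have hone := vartheta_monomialReg_apply_one (-(m : ℤ) - 1)
    rw [h, LinearMap.zero_apply] at hone
    exact zero_ne_one hone
  · convert vartheta_monomialReg_mem_hWeightSpace 0 0 (-(m : ℤ) - 1) using 2
    push_cast
    ring

theorem exists_eq_antidominant_sub {μ : ℤ} {j n : ℕ} (hj : j < n) (hμ : μ + n ≤ 0) :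
    ∃ m t : ℕ, (m : ℂ) ^ 2 = ((μ : ℂ) + 1 + 2 * j) ^ 2 ∧ (μ : ℂ) = -(m : ℂ) - 1 - 2 * t := by
  suffices h : ∃ m t : ℕ, (m : ℤ) ^ 2 = (μ + 1 + 2 * j) ^ 2 ∧ μ = -(m : ℤ) - 1 - 2 * t by
    exact_mod_cast h
  refine ⟨(μ + 1 + 2 * j).natAbs, if 0 ≤ μ + 1 + 2 * j then (-μ - 1 - j).toNat else j, ?_, ?_⟩
  · rw [Int.natCast_natAbs, sq_abs]
  · split_ifs <;> lia

/-- The element of `-P⁺⁺` at which the Casimir operator has eigenvalue `m ^ 2`. -/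
def antidominantWeight (m : ℕ) : strictlyAntidominant := ⟨-((m : ℤ) + 1), m, rfl⟩

theorem coe_antidominantWeight (m : ℕ) :
    ((antidominantWeight m : ℤ) : ℂ) = -(m : ℂ) - 1 := by
  rw [antidominantWeight]
  push_cast
  ring

theorem exists_antidominantWeight_eq (l : strictlyAntidominant) :
    ∃ m : ℕ, antidominantWeight m = l := by
  obtain ⟨_, m, rfl⟩ := l
  exact ⟨m, rfl⟩

theorem exists_isProjectiveCover (l : strictlyAntidominant) :
    ∃ (P : Type) (_ : AddCommGroup P) (_ : Module ℂ P) (_ : LieRingModule sl2 P)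
      (_ : LieModule ℂ sl2 P), IsProjectiveCover P ((l : ℤ) : ℂ) := by
  obtain ⟨m, rfl⟩ := exists_antidominantWeight_eq l
  rw [coe_antidominantWeight]
  exact ⟨BigProjective m, inferInstance, inferInstance, inferInstance, inferInstance,
    isProjectiveCover_bigProjective_neg_sub_one m⟩

variable {P : strictlyAntidominant → Type} [∀ l, AddCommGroup (P l)] [∀ l, Module ℂ (P l)]
  [∀ l, LieRingModule sl2 (P l)] [∀ l, LieModule ℂ sl2 (P l)]

theorem mem_iSup_matrixElements (hP : ∀ l, IsProjectiveCover (P l) ((l : ℤ) : ℂ)) {μ : ℤ} {ν : ℂ}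
    {n : ℕ} {φ : Module.Dual ℂ Env} (hφ : φ ∈ hWeightSpace _ (μ : ℂ))
    (hr : φ ∈ rightEigenspace sl2H ν) (hn : (toEnd ℂ sl2 (Module.Dual ℂ Env) sl2E ^ n) φ = 0)
    (hμ : μ + n ≤ 0) : φ ∈ ⨆ l, matrixElements (P l) := by
  have hright : (rightEigenspace sl2H ν : Submodule ℂ (Module.Dual ℂ Env)) ≤
      (rightEigenspace sl2H ν : Submodule ℂ (Module.Dual ℂ Env)).comap (casimir _) :=
    fun χ hχ => by simpa using aeval_casimir_mem (rightEigenspace sl2H ν) X hχ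
  have hker : LinearMap.ker (toEnd ℂ sl2 (Module.Dual ℂ Env) sl2E ^ n) ≤
      (LinearMap.ker (toEnd ℂ sl2 (Module.Dual ℂ Env) sl2E ^ n)).comap (casimir _) := by
    intro χ hχ
    rw [LinearMap.mem_ker] at hχ
    have hcomm := aeval_casimir_toEnd_pow X sl2E n χ
    rw [hχ, map_zero, Polynomial.aeval_X] at hcomm
    exact hcomm.symm
  have hblocks := mem_iSup_inf_maxGenEigenspace
    (inf_le_comap_inf (inf_le_comap_inf (hWeightSpace_le_comap_casimir (μ : ℂ)) hright) hker)
    (casimirPolynomial_ne_zero μ n) ⟨⟨hφ, hr⟩, hn⟩ (aeval_casimirPolynomial_apply_eq_zero hφ hn)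
  refine (iSup_le fun c χ hχ => ?_ : _ ≤ ⨆ l, matrixElements (P l)) hblocks
  obtain ⟨⟨⟨hχw, hχr⟩, hχn⟩, hχc⟩ := hχ
  rcases eq_or_ne χ 0 with rfl | hχ0
  · exact zero_mem _
  obtain ⟨j, hj, rfl⟩ := exists_eq_sq_of_mem_casimirBlock hχ0 hχw hχn hχc
  obtain ⟨m, t, hm, ht⟩ := exists_eq_antidominant_sub hj hμ
  have hPm := hP (antidominantWeight m)
  rw [coe_antidominantWeight] at hPm
  rw [ht] at hχw
  rw [← hm] at hχc
  exact Submodule.mem_iSup_of_mem _ (mem_matrixElements hPm hχw hχr hχn hχc)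

/-- Every `ϑ (monomialReg i j n)` is, up to a scalar, `e ^ k` applied to a functional of weight low
enough for `mem_iSup_matrixElements`. -/
theorem range_vartheta_le_iSup_matrixElements
    (hP : ∀ l, IsProjectiveCover (P l) ((l : ℤ) : ℂ)) :
    LinearMap.range vartheta ≤ ⨆ l, matrixElements (P l) := by
  have hstable : ⨆ l, matrixElements (P l) ≤
      (⨆ l, matrixElements (P l)).comap (toEnd ℂ sl2 (Module.Dual ℂ Env) sl2E) :=
    iSup_le fun l => (matrixElements_le_comap_left sl2E).trans
      (Submodule.comap_mono (le_iSup (fun l => matrixElements (P l)) l))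
  rw [LinearMap.range_eq_map, Submodule.map_le_iff_le_comap]
  refine (eq_top_of_forall_monomialReg_mem fun i j n => ?_).ge
  obtain ⟨k, hk⟩ : ∃ k : ℕ, n + j + 1 ≤ k := ⟨(n + j + 1).toNat, Int.self_le_toNat _⟩
  refine vartheta_monomialReg_mem_of_shift hstable i j k n
    (mem_iSup_matrixElements hP (vartheta_monomialReg_mem_hWeightSpace (i + k) j (n - k))
      (ν := ((n - k : ℤ) : ℂ) + (i + k : ℕ) - j) ?_ (e_pow_vartheta_monomialReg _ _ _) ?_)
  · rw [mem_rightEigenspace_iff, ← vartheta_lie, lie_h_monomialReg_right, map_smul]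
  · push_cast
    lia

theorem range_vartheta_eq_iSup_matrixElements
    (hP : ∀ l, IsProjectiveCover (P l) ((l : ℤ) : ℂ)) :
    LinearMap.range vartheta = ⨆ l, matrixElements (P l) := by
  refine (range_vartheta_le_iSup_matrixElements hP).antisymm (iSup_le fun l => ?_)
  obtain ⟨m, rfl⟩ := exists_antidominantWeight_eq l
  exact matrixElements_le_range_vartheta (coe_antidominantWeight m ▸ hP (antidominantWeight m))

theorem injective_sq_antidominant :
    Function.Injective fun l : strictlyAntidominant => (((l : ℤ) : ℂ) + 1) ^ 2 := by
  intro l l' h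
  obtain ⟨m, rfl⟩ := exists_antidominantWeight_eq l
  obtain ⟨m', rfl⟩ := exists_antidominantWeight_eq l'
  simp only [coe_antidominantWeight, sub_add_cancel, neg_sq] at h
  rw [Nat.pow_left_injective two_ne_zero (by exact_mod_cast h : m ^ 2 = m' ^ 2)]

theorem iSupIndep_matrixElements (hP : ∀ l, IsProjectiveCover (P l) ((l : ℤ) : ℂ)) :
    iSupIndep fun l => matrixElements (P l) := by
  refine ((casimir (Module.Dual ℂ Env)).independent_maxGenEigenspace.comp
    injective_sq_antidominant).mono fun l => ?_
  obtain ⟨m, rfl⟩ := exists_antidominantWeight_eq l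
  have hblock := matrixElements_le_casimirBlock
    (coe_antidominantWeight m ▸ hP (antidominantWeight m))
  rwa [Function.comp_apply, coe_antidominantWeight, sub_add_cancel, neg_sq]

end Decomposition

section Quotient

variable (V : Type) [AddCommGroup V] [Module ℂ V] [LieRingModule sl2 V] [LieModule ℂ sl2 V]

theorem range_matrixElementMap :
    LinearMap.range (matrixElementMap V : OuterTensor V (RestrictedDual V) →ₗ[ℂ] _) =
      matrixElements V := by
  refine le_antisymm ?_ (Submodule.span_le.2 ?_)
  · rintro _ ⟨t, rfl⟩
    change TensorProduct.lift (matrixElementBilin V) t ∈ _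
    induction t using TensorProduct.induction_on with
    | zero => exact map_zero (TensorProduct.lift (matrixElementBilin V)) ▸ zero_mem _
    | tmul v k => exact matrixHom_mem k v
    | add s t hs ht => exact map_add (TensorProduct.lift (matrixElementBilin V)) s t ▸ add_mem hs ht
  · rintro _ ⟨v, k, rfl⟩
    exact ⟨OuterTensor.tmul v k, rfl⟩

/-- The map `(V ⊗ V^⋆) / I → U(g)'` induced by `v ⊗ k ↦ φ_{v,k}`, where `I` is its kernel. -/
noncomputable def matrixElementQuotientMap :
    (OuterTensor V (RestrictedDual V) ⧸ vanishing V) →ₗ[ℂ] Module.Dual ℂ Env :=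
  (vanishing V).toSubmodule.liftQ
    (matrixElementMap V : OuterTensor V (RestrictedDual V) →ₗ[ℂ] Module.Dual ℂ Env) fun _ h => h

theorem matrixElementQuotientMap_injective : Function.Injective (matrixElementQuotientMap V) :=
  LinearMap.ker_eq_bot.1 (Submodule.ker_liftQ_eq_bot _ _ _ fun _ h => h)

theorem range_matrixElementQuotientMap :
    LinearMap.range (matrixElementQuotientMap V) = matrixElements V :=
  (Submodule.range_liftQ _ _ _).trans (range_matrixElementMap V)

theorem matrixElementQuotientMap_lie (a : sl2 × sl2)
    (q : OuterTensor V (RestrictedDual V) ⧸ vanishing V) :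
    matrixElementQuotientMap V ⁅a, q⁆ = ⁅a, matrixElementQuotientMap V q⁆ := by
  obtain ⟨t, rfl⟩ := LieSubmodule.Quotient.surjective_mk' (vanishing V) q
  rw [← LieModuleHom.map_lie]
  exact (matrixElementMap V).map_lie a t

end Quotient

section DirectSum

open DirectSum

variable {R ι L N N' : Type*} [CommRing R] [DecidableEq ι] [LieRing L] {M : ι → Type*}
  [∀ i, AddCommGroup (M i)] [∀ i, Module R (M i)] [AddCommGroup N] [Module R N]
  (f : ∀ i, M i →ₗ[R] N)

theorem toModule_eq_coeLinearMap_comp_lmap :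
    toModule R ι N f =
      DirectSum.coeLinearMap (fun i => LinearMap.range (f i)) ∘ₗ
        lmap fun i => (f i).rangeRestrict := by
  refine DirectSum.linearMap_ext R fun i => LinearMap.ext fun x => ?_
  simp only [LinearMap.comp_apply, toModule_lof, lmap_lof]
  exact (coeLinearMap_lof (fun i => LinearMap.range (f i)) i ((f i).rangeRestrict x)).symm

theorem range_toModule :
    LinearMap.range (toModule R ι N f) = ⨆ i, LinearMap.range (f i) := by
  rw [toModule_eq_coeLinearMap_comp_lmap, LinearMap.range_comp_of_range_eq_top _
    (LinearMap.range_eq_top.2 ((lmap_surjective _).2 fun i => (f i).surjective_rangeRestrict)),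
    range_coeLinearMap]

variable {f}

theorem toModule_injective (hf : ∀ i, Function.Injective (f i))
    (h : iSupIndep fun i => LinearMap.range (f i)) : Function.Injective (toModule R ι N f) := by
  rw [toModule_eq_coeLinearMap_comp_lmap]
  exact h.dfinsupp_lsum_injective.comp
    ((lmap_injective _).2 fun i => (f i).injective_rangeRestrict_iff.2 (hf i))

variable [∀ i, LieRingModule L (M i)] [LieRingModule L N]

theorem toModule_lie (hf : ∀ i (a : L) (x : M i), f i ⁅a, x⁆ = ⁅a, f i x⁆) (a : L)
    (x : ⨁ i, M i) : toModule R ι N f ⁅a, x⁆ = ⁅a, toModule R ι N f x⁆ := by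
  induction x using DirectSum.induction_on with
  | zero => rw [lie_zero, map_zero, lie_zero]
  | add x y hx hy => rw [lie_add, map_add, hx, hy, map_add, lie_add]
  | of i x =>
    change toModule R ι N f ⁅a, lieModuleOf R ι L M i x⁆ = ⁅a, toModule R ι N f (lof R ι M i x)⁆
    rw [← LieModuleHom.map_lie, toModule_lof, ← hf]
    exact toModule_lof R i _

theorem exists_lieModuleEquiv_directSum [AddCommGroup N'] [Module R N'] [LieRingModule L N']
    {g : N' →ₗ[R] N} (hg : Function.Injective g)
    (hgL : ∀ (a : L) (y : N'), g ⁅a, y⁆ = ⁅a, g y⁆) (hf : ∀ i, Function.Injective (f i))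
    (hfL : ∀ i (a : L) (x : M i), f i ⁅a, x⁆ = ⁅a, f i x⁆)
    (hindep : iSupIndep fun i => LinearMap.range (f i))
    (hrange : LinearMap.range g = ⨆ i, LinearMap.range (f i)) :
    ∃ Φ : N' ≃ₗ⁅R,L⁆ ⨁ i, M i, ∀ i (x : M i), g (Φ.symm (lieModuleOf R ι L M i x)) = f i x := by
  have hinj := toModule_injective hf hindep
  let e : N' ≃ₗ[R] ⨁ i, M i := LinearEquiv.ofInjective g hg ≪≫ₗ
    LinearEquiv.ofEq _ _ (hrange.trans (range_toModule f).symm) ≪≫ₗ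
    (LinearEquiv.ofInjective _ hinj).symm
  have he (y : N') : toModule R ι N f (e y) = g y :=
    congrArg Subtype.val ((LinearEquiv.ofInjective _ hinj).apply_symm_apply _)
  let Φ : N' ≃ₗ⁅R,L⁆ ⨁ i, M i :=
    { e with
      map_lie' := fun {a y} => hinj <| by
        change toModule R ι N f (e ⁅a, y⁆) = toModule R ι N f ⁅a, e y⁆
        rw [he, toModule_lie hfL, he, hgL] }
  refine ⟨Φ, fun i x => ?_⟩
  rw [← he]
  exact (congrArg _ (e.apply_symm_apply _)).trans (toModule_lof R i x)

end DirectSum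

end BigCell

open BigCell DirectSum in
theorem mainTheorem1 :
    (∀ l : strictlyAntidominant, ∃ (P : Type) (_ : AddCommGroup P) (_ : Module ℂ P)
      (_ : LieRingModule sl2 P) (_ : LieModule ℂ sl2 P), IsProjectiveCover P ((l : ℤ) : ℂ)) ∧
    ∀ (P : strictlyAntidominant → Type) [∀ l, AddCommGroup (P l)] [∀ l, Module ℂ (P l)]
      [∀ l, LieRingModule sl2 (P l)] [∀ l, LieModule ℂ sl2 (P l)],
      (∀ l, IsProjectiveCover (P l) ((l : ℤ) : ℂ)) →
      (Function.Injective vartheta ∧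
        (∀ (a : sl2 × sl2) (ψ : regularFunctions), vartheta ⁅a, ψ⁆ = ⁅a, vartheta ψ⁆) ∧
        LinearMap.range vartheta = ⨆ l, matrixElements (P l) ∧
        iSupIndep fun l => matrixElements (P l)) ∧
      ∃ Φ : regularFunctions ≃ₗ⁅ℂ,sl2 × sl2⁆
          ⨁ l, OuterTensor (P l) (RestrictedDual (P l)) ⧸ vanishing (P l),
        ∀ (l : strictlyAntidominant) (v : P l) (k : RestrictedDual (P l)),
          vartheta (Φ.symm (lieModuleOf ℂ strictlyAntidominant (sl2 × sl2)
            (fun l => OuterTensor (P l) (RestrictedDual (P l)) ⧸ vanishing (P l)) l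
            (LieSubmodule.Quotient.mk (OuterTensor.tmul v k)))) = matrixElement (P l) v k := by
  refine ⟨exists_isProjectiveCover, fun P _ _ _ _ hP => ?_⟩
  have hrange := range_vartheta_eq_iSup_matrixElements hP
  have hindep := iSupIndep_matrixElements hP
  refine ⟨⟨vartheta_injective, vartheta_lie, hrange, hindep⟩, ?_⟩
  have hq : (fun l => LinearMap.range (matrixElementQuotientMap (P l))) =
      fun l => matrixElements (P l) :=
    funext fun l => range_matrixElementQuotientMap (P l)
  obtain ⟨Φ, hΦ⟩ := exists_lieModuleEquiv_directSum (f := fun l => matrixElementQuotientMap (P l))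
    vartheta_injective vartheta_lie (fun l => matrixElementQuotientMap_injective (P l))
    (fun l => matrixElementQuotientMap_lie (P l)) (hq ▸ hindep) (by rw [hrange, ← hq])
  exact ⟨Φ, fun l v k => (hΦ l _).trans (matrixElementMap_tmul (P l) v k)⟩
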